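/- **Proposition (Bendixson–Dulac Criterion).** Let $\mathcal U\subset\mathbb R^2$ be an open set and let $X=(P,Q)$ be a $C^1$ vector field on $\mathcal U$, with associated system $\dot x=P(x,y)$, $\dot y=Q(x,y)$. Let $V$ be a rational function whose denominator does not vanish on $\mathcal U$, let $k>0$ be a real number, and put $$M=\langle\nabla V,X\rangle-k\,V\,\mathrm{div}X .$$ Assume that $M$ does not change sign on $\mathcal U$ (that is, $M\ge 0$ on $\mathcal U$ or $M\le 0$ on $\mathcal U$) and that the set $\{z\in\mathcal U: M(z)=0\}$ contains no non-constant orbit of $X$ defined for all times (for example, it consists of points and of curves that are not invariant by the flow of $X$). Then: * **(I)** If all the connected components of $\mathcal U\setminus\{V=0\}$ are simply connected, then the system has neither periodic orbits nor polycycles contained in $\mathcal U$. * **(II)** If all the connected components of $\mathcal U\setminus\{V=0\}$ are simply connected except one, $\widetilde{\mathcal U}$, which is 1-connected (its fundamental group is $\mathbb Z$), then $\mathcal U$ contains at most one closed curve that is a periodic orbit or a polycycle of the system (so at most one in total). Moreover, every limit cycle contained in $\mathcal U$ is hyperbolic and contained in $\widetilde{\mathcal U}$, and its stability is given by the sign of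 $-VM$ on $\widetilde{\mathcal U}$: this function does not change sign on $\widetilde{\mathcal U}$, the limit cycle is an attractor (orbitally asymptotically stable) if $-VM\le 0$ on $\widetilde{\mathcal U}$, and a repeller (an attractor for $-X$) if $-VM\ge 0$ on $\widetilde{\mathcal U}$. Here a *polycycle* is a simple closed curve formed by finitely many solutions of the system, namely distinct critical points $c_0,\dots,c_n$ ($n\ge 0$) and non-constant orbits going from $c_i$ to $c_{i+1}$ (indices modulo $n+1$), that admits a Poincaré return map: there is a half-open segment transversal to $X$ starting at a point $q$ of the curve (on one side of it) such that the solutions starting on it close enough to $q$ come back to it as close to $q$ as desired after having remained as close to the curve as desired. A *limit cycle* is a periodic orbit that is isolated among the periodic orbits, and it is *hyperbolic* if its non-trivial Floquet multiplier has modulus different from $1$. -/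

import Mathlib

open Set Filter Topology

noncomputable section

namespace PlanarODE

/-- The plane. -/
abbrev Plane : Type := ℝ × ℝ

/-- `γ` solves the autonomous system `ż = X z` on the time set `I`. -/
def IsSolutionOn (X : Plane → Plane) (γ : ℝ → Plane) (I : Set ℝ) : Prop :=
  IsIntegralCurveOn γ (fun _ => X) I

/-- `γ` solves the autonomous system `ż = X z` for all times. -/
def IsSolution (X : Plane → Plane) (γ : ℝ → Plane) : Prop :=
  IsIntegralCurve γ (fun _ => X)

/-- The divergence `∂P/∂x + ∂Q/∂y` of the vector field `X = (P, Q)`. -/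
def divergence (X : Plane → Plane) (z : Plane) : ℝ :=
  (fderiv ℝ X z (1, 0)).1 + (fderiv ℝ X z (0, 1)).2

/-- The function `p / q`, for polynomials `p, q` in two variables. -/
def ratFun (p q : MvPolynomial (Fin 2) ℝ) (z : Plane) : ℝ :=
  MvPolynomial.eval ![z.1, z.2] p / MvPolynomial.eval ![z.1, z.2] q

/-- `M = ⟨∇V, X⟩ - k V div X`. -/
def dulacM (V : Plane → ℝ) (k : ℝ) (X : Plane → Plane) (z : Plane) : ℝ :=
  (fderiv ℝ V z (1, 0) * (X z).1 + fderiv ℝ V z (0, 1) * (X z).2) - k * V z * divergence X z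

/-- `γ` is a non-constant solution of period `T > 0` (`T` need not be the minimal period). -/
structure IsPeriodicSolution (X : Plane → Plane) (γ : ℝ → Plane) (T : ℝ) : Prop where
  solution : IsSolution X γ
  regular : ∀ t, X (γ t) ≠ 0
  period_pos : 0 < T
  periodic : Function.Periodic γ T

/-- `Γ` is a periodic orbit of `X`. -/
def IsPeriodicOrbit (X : Plane → Plane) (Γ : Set Plane) : Prop :=
  ∃ γ T, IsPeriodicSolution X γ T ∧ range γ = Γ

/-- A limit cycle: a periodic orbit that is isolated among the periodic orbits. -/
def IsLimitCycle (X : Plane → Plane) (Γ : Set Plane) : Prop :=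
  IsPeriodicOrbit X Γ ∧
    ∃ O : Set Plane, IsOpen O ∧ Γ ⊆ O ∧ ∀ Γ', IsPeriodicOrbit X Γ' → Γ' ⊆ O → Γ' = Γ

/-- `Γ` admits a (one-sided) Poincaré return map: there is a half-open segment
`{q + s v : 0 < s}` starting at a point `q ∈ Γ`, transversal to `X` at `q`, such that the
solutions starting on it close enough to `q` come back to it as close to `q` as desired,
after having remained as close to `Γ` as desired. -/
def AdmitsReturnMap (X : Plane → Plane) (Γ : Set Plane) : Prop :=
  ∃ q ∈ Γ, ∃ v : Plane, (X q).1 * v.2 - (X q).2 * v.1 ≠ 0 ∧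
    ∀ ε > 0, ∃ δ > 0, ∀ s ∈ Ioo (0 : ℝ) δ, ∃ (τ : ℝ) (σ : ℝ → Plane), 0 < τ ∧
      IsSolutionOn X σ (Icc 0 τ) ∧ σ 0 = q + s • v ∧
      (∃ s' ∈ Ioo (0 : ℝ) ε, σ τ = q + s' • v) ∧
      ∀ t ∈ Icc 0 τ, Metric.infDist (σ t) Γ < ε

/-- `Γ` is a polycycle of `X`: a simple closed curve formed by finitely many solutions, namely
distinct critical points `c 0, …, c n` and non-constant orbits `γ i` going from `c i` to
`c (i + 1)` (indices modulo `n + 1`; `n = 0` is a homoclinic loop), that admits a Poincaré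
return map. As the `c i` are distinct, so are the orbits, and `Γ` is a simple closed curve. -/
def IsPolycycle (X : Plane → Plane) (Γ : Set Plane) : Prop :=
  (∃ (n : ℕ) (c : Fin (n + 1) → Plane) (γ : Fin (n + 1) → ℝ → Plane),
    Function.Injective c ∧ (∀ i, X (c i) = 0) ∧
    (∀ i, IsSolution X (γ i) ∧ (∀ t, X (γ i t) ≠ 0) ∧
      Tendsto (γ i) atBot (𝓝 (c i)) ∧ Tendsto (γ i) atTop (𝓝 (c (i + 1)))) ∧
    Γ = range c ∪ ⋃ i, range (γ i)) ∧
  AdmitsReturnMap X Γ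

/-- A periodic orbit is hyperbolic if, besides the trivial Floquet multiplier `1`, the monodromy
operator of the variational equation `Y' = DX(γ(t)) Y` along it has a multiplier of modulus
different from `1`. -/
def IsHyperbolicOrbit (X : Plane → Plane) (Γ : Set Plane) : Prop :=
  ∃ γ T, IsPeriodicSolution X γ T ∧ range γ = Γ ∧
    ∃ Y : ℝ → (Plane →L[ℝ] Plane), Y 0 = ContinuousLinearMap.id ℝ Plane ∧
      (∀ t, HasDerivAt Y ((fderiv ℝ X (γ t)).comp (Y t)) t) ∧
      ∃ μ : ℝ, |μ| ≠ 1 ∧ Module.End.HasEigenvalue (Y T : Plane →ₗ[ℝ] Plane) μ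

/-- `Γ` is an orbitally asymptotically stable set (an attractor): the solutions starting close
enough to `Γ` exist for all positive times, stay as close to `Γ` as desired, and tend to `Γ`. -/
def IsAttractor (X : Plane → Plane) (Γ : Set Plane) : Prop :=
  ∀ O : Set Plane, IsOpen O → Γ ⊆ O → ∃ O' : Set Plane, IsOpen O' ∧ Γ ⊆ O' ∧
    ∀ z ∈ O', ∃ σ : ℝ → Plane, IsSolutionOn X σ (Ici 0) ∧ σ 0 = z ∧ (∀ t ≥ 0, σ t ∈ O) ∧
      Tendsto (fun t => Metric.infDist (σ t) Γ) atTop (𝓝 0)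

/-- `Γ` is a repeller: an attractor for the time-reversed system. -/
def IsRepeller (X : Plane → Plane) (Γ : Set Plane) : Prop :=
  IsAttractor (fun z => -X z) Γ

/-- `S` is a connected component of the set `A`. -/
def IsComponentOf (S A : Set Plane) : Prop :=
  ∃ z ∈ A, S = connectedComponentIn A z

/-- `S` is 1-connected (doubly connected, i.e. it has exactly one hole): it is path connected and
its fundamental group is infinite cyclic. -/
def IsOneConnected (S : Set Plane) : Prop :=
  IsPathConnected S ∧ ∀ z : S, Nonempty (FundamentalGroup S z ≃* Multiplicative ℤ)

end PlanarODE

end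

/-! ### Cut-offs of vector fields and complete flows. -/

open Set Filter Topology

noncomputable section

namespace PlanarODE

/-! Replacing `V` by `-V` reduces everything to `M ≥ 0`. Off `{V = 0}` put `B = -sgn(V) |V|^(-1/k)`;
then `div (B X) = |V|^(-1-1/k) M / k ≥ 0` (`divergence_dulacFactor`), so `B` is a Dulac function on
each component of `U \ {V = 0}`. Along an orbit, `V exp(-k ∫ div X)` has derivative `M exp(-k ∫ div
X) ≥ 0`, so an orbit arc with `V` of one sign at both ends never meets `{V = 0}`
(`ne_zero_along_solution`). Arcs that follow a periodic orbit or a polycycle and come back to a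
point with `V ≠ 0` therefore stay in one component `S`.

The classical argument applies Green's formula to the inside of a closed orbit. Here neither the
Jordan curve theorem nor a smooth boundary is used. An orbit arc following `Γ`, with both ends
within `ε` of a point `q`, is closed up by a short segment, and the inside becomes the set `D` of
points with nonzero winding number or, for two loops, with a nonzero integer combination of winding
numbers. `D` is open and bounded, and its frontier lies on the loops. It lies in `S`: if `S` is
simply connected, a loop in `S` does not wind around a point outside `S`; if `π₁(S) = ℤ`, two loops
in `S` satisfy one nontrivial relation, valid for their winding numbers around all outside points
(`exists_winding_relation`).

The integral of `div (B X)` over the part of `D` away from its frontier is bounded by the flux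
through small balls around the points `q`, which is `O(ε)`, because the rest of the frontier
consists of orbit arcs (`flux_bound`). On the other hand a loop crosses a short transversal near a
point `p` with `M(p) ≠ 0` in one direction only, so the winding number changes between the two ends
of the transversal, and `D` contains one of two fixed balls where `div (B X) > 0`. For small `ε`
this is a contradiction (`false_of_winding_relation`). One loop gives (I); two distinct curves, each
with a point `p` off the other, give uniqueness in (II). For a polycycle, the existence of the arcs
requires showing that returning orbits pass near every one of its regular orbits
(`IsReturnSeq.frequently_near`).

For a periodic orbit, strict growth of `V exp(-k ∫ div X)` over a period shows that `∫ div X` has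
the sign of `-V`. Diliberto's formula makes `exp (∫ div X)` a Floquet multiplier, whence
hyperbolicity, and a weighted distance to the orbit, decreasing along the flow, gives stability
directly (`exists_weighted_decay`), without a Poincaré map. -/

/-- A `C¹` map on an open set agrees near a given compact subset with a compactly supported
`C¹` map of the whole plane. -/
theorem exists_compactly_supported_extension {F : Type*} [NormedAddCommGroup F] [NormedSpace ℝ F]
    {f : Plane → F} {U K : Set Plane} (hU : IsOpen U) (hK : IsCompact K) (hKU : K ⊆ U)
    (hf : ContDiffOn ℝ 1 f U) :
    ∃ (g : Plane → F) (O : Set Plane), IsOpen O ∧ K ⊆ O ∧ O ⊆ U ∧ EqOn g f O ∧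
      ContDiff ℝ 1 g ∧ HasCompactSupport g := by
  obtain ⟨K₁, hK₁, hKK₁, hK₁U⟩ := exists_compact_between hK hU hKU
  obtain ⟨χ, h0, h1, -⟩ := exists_contMDiffMap_zero_one_nhds_of_isClosed (n := 1)
    (modelWithCornersSelf ℝ Plane) (s := (interior K₁)ᶜ) (t := K)
    isOpen_interior.isClosed_compl hK.isClosed
    (disjoint_compl_left_iff_subset.2 hKK₁)
  have hχ : ContDiff ℝ 1 χ := χ.contMDiff.contDiff
  rw [eventually_nhdsSet_iff_forall] at h0
  obtain ⟨O, hO, hKO, hO1⟩ := eventually_nhdsSet_iff_exists.1 h1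
  have hsupp : Function.support (fun z => χ z • f z) ⊆ K₁ := by
    intro z hz
    by_contra hzK
    have hz' : z ∈ (interior K₁)ᶜ := fun h => hzK (interior_subset h)
    exact hz (by simp [(h0 z hz').self_of_nhds])
  refine ⟨fun z => χ z • f z, O ∩ interior K₁, hO.inter isOpen_interior,
    subset_inter hKO hKK₁, fun z hz => hK₁U (interior_subset hz.2), fun z hz => ?_, ?_, ?_⟩
  · simp [hO1 z hz.1]
  · refine contDiff_iff_contDiffAt.2 fun z => ?_
    by_cases hz : z ∈ interior K₁
    · exact hχ.contDiffAt.smul (hf.contDiffAt (hU.mem_nhds (hK₁U (interior_subset hz))))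
    · have : (fun z => χ z • f z) =ᶠ[𝓝 z] fun _ => 0 := by
        filter_upwards [h0 z hz] with w hw
        simp [hw]
      exact contDiffAt_const.congr_of_eventuallyEq this
  · exact HasCompactSupport.intro hK₁ fun z hz => by
      by_contra h
      exact hz (hsupp h)

/-- `φ` is the complete flow of `X`. -/
structure IsFlow (X : Plane → Plane) (φ : ℝ → Plane → Plane) : Prop where
  zero : ∀ z, φ 0 z = z
  hasDerivAt : ∀ z t, HasDerivAt (fun s => φ s z) (X (φ t z)) t

/-- Picard–Lindelöf on the ball of radius `C * (n + 1)`, which a solution of speed at most `C`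
cannot leave within time `n + 1`. -/
theorem exists_solution_Icc {X : Plane → Plane} {L C : NNReal} (hL : LipschitzWith L X)
    (hC : ∀ z, ‖X z‖ ≤ C) (z : Plane) (n : ℕ) :
    ∃ α : ℝ → Plane, α 0 = z ∧
      ∀ t ∈ Ioo (-(n + 1 : ℝ)) (n + 1), HasDerivAt α (X (α t)) t := by
  have hn : (0 : ℝ) ≤ n := n.cast_nonneg
  have hpl : IsPicardLindelof (fun _ : ℝ => X) (tmin := -(n + 1 : ℝ)) (tmax := n + 1)
      ⟨0, by constructor <;> linarith⟩ z (C * (n + 1)) 0 C L :=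
    { lipschitzOnWith := fun t _ => hL.lipschitzOnWith
      continuousOn := fun x _ => continuousOn_const
      norm_le := fun t _ x _ => hC x
      mul_max_le := by simp }
  obtain ⟨α, h0, hα⟩ := hpl.exists_eq_forall_mem_Icc_hasDerivWithinAt₀
  exact ⟨α, h0, fun t ht => (hα t (Ioo_subset_Icc_self ht)).hasDerivAt (Icc_mem_nhds ht.1 ht.2)⟩

theorem exists_isFlow {X : Plane → Plane} {L C : NNReal} (hL : LipschitzWith L X)
    (hC : ∀ z, ‖X z‖ ≤ C) : ∃ φ, IsFlow X φ := by
  choose α h0 hα using exists_solution_Icc hL hC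
  have hagree : ∀ z (m n : ℕ), m ≤ n → EqOn (α z m) (α z n) (Ioo (-(m + 1 : ℝ)) (m + 1)) := by
    intro z m n hmn
    have hmn' : (m : ℝ) ≤ n := by exact_mod_cast hmn
    have hm : (0 : ℝ) ≤ m := m.cast_nonneg
    refine ODE_solution_unique_of_mem_Ioo (v := fun _ => X) (s := fun _ => univ) (K := L) (t₀ := 0)
      (fun _ _ => hL.lipschitzOnWith) (by constructor <;> linarith)
      (fun t ht => ⟨hα z m t ht, trivial⟩) (fun t ht => ⟨hα z n t ?_, trivial⟩)
      ((h0 z m).trans (h0 z n).symm)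
    constructor <;> linarith [ht.1, ht.2]
  -- The solution of index `n` lives on `(-(n + 1), n + 1)`, so the index `⌈|t|⌉₊` covers a
  -- neighbourhood of `t`; by uniqueness the choice of index does not matter.
  refine ⟨fun t z => α z ⌈|t|⌉₊ t, fun z => h0 z _, fun z t => ?_⟩
  have key : ∀ s : ℝ, ∀ n : ℕ, |s| < n + 1 → α z ⌈|s|⌉₊ s = α z n s := by
    intro s n hs
    have h1 : |s| < (⌈|s|⌉₊ : ℝ) + 1 := by linarith [Nat.le_ceil |s|]
    rcases le_total ⌈|s|⌉₊ n with h | h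
    · exact hagree z _ _ h (abs_lt.1 h1)
    · exact (hagree z _ _ h (abs_lt.1 hs)).symm
  have h1 : |t| < (⌈|t|⌉₊ : ℝ) + 1 := by linarith [Nat.le_ceil |t|]
  refine (hα z ⌈|t|⌉₊ t (abs_lt.1 h1)).congr_of_eventuallyEq ?_
  filter_upwards [(continuous_abs.isOpen_preimage _ isOpen_Iio).mem_nhds h1] with s hs
  exact key s _ hs

namespace IsFlow

variable {X : Plane → Plane} {φ : ℝ → Plane → Plane} {L : NNReal}

theorem continuous_time (h : IsFlow X φ) (z : Plane) : Continuous fun t => φ t z :=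
  continuous_iff_continuousAt.2 fun t => (h.hasDerivAt z t).continuousAt

theorem eq_of_solution (h : IsFlow X φ) (hL : LipschitzWith L X) {γ : ℝ → Plane}
    (hγ : ∀ t, HasDerivAt γ (X (γ t)) t) (s t : ℝ) : φ t (γ s) = γ (s + t) := by
  have hγ' : ∀ t, HasDerivAt (fun t => γ (s + t)) (X (γ (s + t))) t := fun t =>
    (hγ (s + t)).comp_const_add s t
  have := ODE_solution_unique_univ (v := fun _ => X) (s := fun _ => univ) (t₀ := 0) (K := L)
    (fun _ => hL.lipschitzOnWith) (fun t => ⟨h.hasDerivAt (γ s) t, trivial⟩)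
    (fun t => ⟨hγ' t, trivial⟩) (by simp [h.zero])
  exact congrFun this t

theorem add (h : IsFlow X φ) (hL : LipschitzWith L X) (s t : ℝ) (z : Plane) :
    φ (s + t) z = φ t (φ s z) :=
  (h.eq_of_solution hL (h.hasDerivAt z) s t).symm

theorem neg (h : IsFlow X φ) : IsFlow (fun z => -X z) fun t => φ (-t) where
  zero z := by simp [h.zero]
  hasDerivAt z t :=
    ((h.hasDerivAt z (-t)).scomp t (hasDerivAt_neg t)).congr_deriv (by simp)

theorem dist_le_of_nonneg (h : IsFlow X φ) (hL : LipschitzWith L X) {t : ℝ} (ht : 0 ≤ t)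
    (z w : Plane) : dist (φ t z) (φ t w) ≤ dist z w * Real.exp (L * t) := by
  have := dist_le_of_trajectories_ODE (v := fun _ => X) (fun _ => hL) (a := 0) (b := t)
    (h.continuous_time z).continuousOn (fun s _ => (h.hasDerivAt z s).hasDerivWithinAt)
    (h.continuous_time w).continuousOn (fun s _ => (h.hasDerivAt w s).hasDerivWithinAt)
    (δ := dist z w) (by simp [h.zero]) t ⟨ht, le_rfl⟩
  simpa using this

theorem dist_le (h : IsFlow X φ) (hL : LipschitzWith L X) (t : ℝ) (z w : Plane) :
    dist (φ t z) (φ t w) ≤ dist z w * Real.exp (L * |t|) := by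
  rcases le_total 0 t with ht | ht
  · rw [abs_of_nonneg ht]
    exact h.dist_le_of_nonneg hL ht z w
  · have := h.neg.dist_le_of_nonneg (L := L) hL.neg (neg_nonneg.2 ht) z w
    rw [abs_of_nonpos ht]
    simpa using this

theorem eqOn_of_solutionOn (h : IsFlow X φ) (hL : LipschitzWith L X) {σ : ℝ → Plane} {τ : ℝ}
    (hσ : IsSolutionOn X σ (Icc 0 τ)) {t : ℝ} (ht : t ∈ Icc 0 τ) : σ t = φ t (σ 0) := by
  refine ODE_solution_unique (v := fun _ => X) (fun _ => hL) (fun s hs => (hσ s hs).continuousWithinAt)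
    (fun s hs => ?_) (h.continuous_time (σ 0)).continuousOn
    (fun s _ => (h.hasDerivAt _ s).hasDerivWithinAt) (by simp [h.zero]) ht
  exact (hσ s (Ico_subset_Icc_self hs)).mono_of_mem_nhdsWithin
    (mem_of_superset (Icc_mem_nhdsGE hs.2) (Icc_subset_Icc_left hs.1))

theorem continuous_uncurry (h : IsFlow X φ) (hL : LipschitzWith L X) :
    Continuous fun p : ℝ × Plane => φ p.1 p.2 := by
  refine continuous_iff_continuousAt.2 fun ⟨t, z⟩ => ?_
  rw [ContinuousAt, tendsto_iff_dist_tendsto_zero]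
  have h1 : Tendsto (fun p : ℝ × Plane => dist p.2 z * Real.exp (L * |p.1|) +
      dist (φ p.1 z) (φ t z)) (𝓝 (t, z)) (𝓝 (dist z z * Real.exp (L * |t|) +
      dist (φ t z) (φ t z))) := by
    refine Continuous.tendsto (f := fun p : ℝ × Plane => dist p.2 z * Real.exp (L * |p.1|) +
      dist (φ p.1 z) (φ t z)) ?_ (t, z)
    have := (h.continuous_time z).comp (continuous_fst (X := ℝ) (Y := Plane))
    exact ((continuous_snd.dist continuous_const).mul (by fun_prop)).add
      (this.dist continuous_const)
  simp only [dist_self, zero_mul, zero_add] at h1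
  refine squeeze_zero (fun _ => dist_nonneg) (fun p => ?_) h1
  calc dist (φ p.1 p.2) (φ t z) ≤ dist (φ p.1 p.2) (φ p.1 z) + dist (φ p.1 z) (φ t z) :=
        dist_triangle _ _ _
    _ ≤ _ := by gcongr; exact h.dist_le hL _ _ _

end IsFlow

/-- A vector field that is `C¹` near a compact set agrees near that set with a Lipschitz vector
field that has a complete flow. -/
theorem exists_complete_extension {X : Plane → Plane} {U K : Set Plane} (hU : IsOpen U)
    (hK : IsCompact K) (hKU : K ⊆ U) (hX : ContDiffOn ℝ 1 X U) :
    ∃ (Y : Plane → Plane) (O : Set Plane) (L : NNReal) (φ : ℝ → Plane → Plane), IsOpen O ∧ K ⊆ O ∧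
      O ⊆ U ∧ EqOn Y X O ∧ ContDiff ℝ 1 Y ∧ HasCompactSupport Y ∧ LipschitzWith L Y ∧
      IsFlow Y φ := by
  obtain ⟨Y, O, hO, hKO, hOU, hYX, hY, hYc⟩ := exists_compactly_supported_extension hU hK hKU hX
  obtain ⟨L, hL⟩ := ContDiff.lipschitzWith_of_hasCompactSupport (𝕂 := ℝ) hYc hY one_ne_zero
  obtain ⟨C, hC⟩ := hYc.exists_bound_of_continuous hY.continuous
  obtain ⟨φ, hφ⟩ := exists_isFlow hL (C := C.toNNReal)
    fun z => (hC z).trans (Real.le_coe_toNNReal C)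
  exact ⟨Y, O, L, φ, hO, hKO, hOU, hYX, hY, hYc, hL, hφ⟩

end PlanarODE
end

/-! ### Graphics, and the passage of returning orbits along them. -/

open Set Filter Topology

noncomputable section

namespace PlanarODE

open MeasureTheory Metric

/-- There are solutions as close to `Γ` as desired, with end points as close to `q` as desired,
that pass as close to `p` as desired. -/
def LoopNear (X : Plane → Plane) (Γ : Set Plane) (q p : Plane) : Prop :=
  ∀ ε > 0, ∃ τ > 0, ∃ σ : ℝ → Plane, Continuous σ ∧
    (∀ t ∈ Icc 0 τ, HasDerivAt σ (X (σ t)) t) ∧ dist (σ 0) q < ε ∧ dist (σ τ) q < ε ∧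
    (∀ t ∈ Icc 0 τ, infDist (σ t) Γ < ε) ∧ ∃ t ∈ Icc 0 τ, dist (σ t) p < ε

/-- `Γ` consists of critical points `c i` and of regular orbits `γ i` from `c i` to `c (i + 1)`. -/
structure IsGraphic (X : Plane → Plane) (Γ : Set Plane) {n : ℕ} (c : Fin (n + 1) → Plane)
    (γ : Fin (n + 1) → ℝ → Plane) : Prop where
  injective : Function.Injective c
  critical : ∀ i, X (c i) = 0
  solution : ∀ i t, HasDerivAt (γ i) (X (γ i t)) t
  regular : ∀ i t, X (γ i t) ≠ 0
  tendsto_atBot : ∀ i, Tendsto (γ i) atBot (𝓝 (c i))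
  tendsto_atTop : ∀ i, Tendsto (γ i) atTop (𝓝 (c (i + 1)))
  eq_union : Γ = range c ∪ ⋃ i, range (γ i)

theorem IsPolycycle.exists_isGraphic {X : Plane → Plane} {Γ : Set Plane} (h : IsPolycycle X Γ) :
    ∃ (n : ℕ) (c : Fin (n + 1) → Plane) (γ : Fin (n + 1) → ℝ → Plane), IsGraphic X Γ c γ := by
  obtain ⟨⟨n, c, γ, h1, h2, h3, h4⟩, -⟩ := h
  exact ⟨n, c, γ, h1, h2, fun i => (h3 i).1, fun i => (h3 i).2.1, fun i => (h3 i).2.2.1,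
    fun i => (h3 i).2.2.2, h4⟩

/-- The two half-orbits are reparametrised by `‖t‖`, so that each has a single limit along the
cocompact filter. -/
theorem isCompact_range_union {γ : ℝ → Plane} (hγ : Continuous γ) {a b : Plane}
    (ha : Tendsto γ atBot (𝓝 a)) (hb : Tendsto γ atTop (𝓝 b)) :
    IsCompact ({a, b} ∪ range γ) := by
  have h1 : IsCompact (insert b (range fun t => γ ‖t‖)) :=
    Filter.Tendsto.isCompact_insert_range_of_cocompact (hb.comp (tendsto_norm_cocompact_atTop (E := ℝ)))
      (hγ.comp continuous_norm)
  have h2 : IsCompact (insert a (range fun t => γ (-‖t‖))) :=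
    Filter.Tendsto.isCompact_insert_range_of_cocompact
      (ha.comp (tendsto_neg_atTop_atBot.comp (tendsto_norm_cocompact_atTop (E := ℝ))))
      (hγ.comp continuous_norm.neg)
  convert h1.union h2 using 1
  ext z
  constructor
  · rintro ((rfl | rfl) | ⟨t, rfl⟩)
    · exact Or.inr (Or.inl rfl)
    · exact Or.inl (Or.inl rfl)
    · rcases le_total 0 t with ht | ht
      · exact Or.inl (Or.inr ⟨t, by simp [abs_of_nonneg ht]⟩)
      · exact Or.inr (Or.inr ⟨t, by simp [abs_of_nonpos ht]⟩)
  · rintro ((rfl | ⟨t, rfl⟩) | (rfl | ⟨t, rfl⟩))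
    · exact Or.inl (Or.inr rfl)
    · exact Or.inr ⟨_, rfl⟩
    · exact Or.inl (Or.inl rfl)
    · exact Or.inr ⟨_, rfl⟩

/-- As a map of the plane, `(t, u) ↦ σ t` has a degenerate derivative everywhere, so its image is
null. -/
theorem volume_image_curve {σ v : ℝ → Plane} {s : Set ℝ} (h : ∀ t ∈ s, HasDerivAt σ (v t) t) :
    volume (σ '' s) = 0 := by
  have himg : σ '' s ⊆ (fun z : Plane => σ z.1) '' (s ×ˢ univ) := by
    rintro _ ⟨t, ht, rfl⟩
    exact ⟨(t, 0), ⟨ht, trivial⟩, rfl⟩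
  refine measure_mono_null himg (addHaar_image_eq_zero_of_det_fderivWithin_eq_zero volume
    (f' := fun z => (ContinuousLinearMap.smulRight (1 : ℝ →L[ℝ] ℝ) (v z.1)).comp
      (ContinuousLinearMap.fst ℝ ℝ ℝ)) (fun z hz => ?_) fun z hz => ?_)
  · exact ((h z.1 hz.1).hasFDerivAt.comp z hasFDerivAt_fst).hasFDerivWithinAt
  · refine LinearMap.det_eq_zero_iff_ker_ne_bot.2 fun hbot => ?_
    have : ((0, 1) : Plane) ∈ LinearMap.ker
        (((ContinuousLinearMap.smulRight (1 : ℝ →L[ℝ] ℝ) (v z.1)).comp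
        (ContinuousLinearMap.fst ℝ ℝ ℝ) : Plane →L[ℝ] Plane) : Plane →ₗ[ℝ] Plane) := by simp
    rw [hbot] at this
    simp at this

namespace IsGraphic

variable {X : Plane → Plane} {Γ : Set Plane} {n : ℕ} {c : Fin (n + 1) → Plane}
  {γ : Fin (n + 1) → ℝ → Plane} {L : NNReal} {φ : ℝ → Plane → Plane}

theorem continuous (G : IsGraphic X Γ c γ) (i : Fin (n + 1)) : Continuous (γ i) :=
  continuous_iff_continuousAt.2 fun t => (G.solution i t).continuousAt

theorem mem_orbit (G : IsGraphic X Γ c γ) (i : Fin (n + 1)) (t : ℝ) : γ i t ∈ Γ := by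
  rw [G.eq_union]
  exact Or.inr (mem_iUnion.2 ⟨i, t, rfl⟩)

theorem mem_critical (G : IsGraphic X Γ c γ) (i : Fin (n + 1)) : c i ∈ Γ := by
  rw [G.eq_union]
  exact Or.inl ⟨i, rfl⟩

theorem exists_orbit_of_regular (G : IsGraphic X Γ c γ) {z : Plane} (hz : z ∈ Γ) (hX : X z ≠ 0) :
    ∃ i s, γ i s = z := by
  rw [G.eq_union] at hz
  rcases hz with ⟨i, rfl⟩ | hz
  · exact absurd (G.critical i) hX
  · obtain ⟨i, s, rfl⟩ := mem_iUnion.1 hz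
    exact ⟨i, s, rfl⟩

theorem isCompact (G : IsGraphic X Γ c γ) : IsCompact Γ := by
  have h : Γ = ⋃ i, ({c i, c (i + 1)} ∪ range (γ i)) := by
    rw [G.eq_union]
    ext z
    simp only [mem_union, mem_iUnion, mem_insert_iff, mem_singleton_iff]
    constructor
    · rintro (⟨i, rfl⟩ | ⟨i, hi⟩)
      · exact ⟨i, Or.inl (Or.inl rfl)⟩
      · exact ⟨i, Or.inr hi⟩
    · rintro ⟨i, (rfl | rfl) | hi⟩
      · exact Or.inl ⟨_, rfl⟩
      · exact Or.inl ⟨_, rfl⟩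
      · exact Or.inr ⟨i, hi⟩
  rw [h]
  exact isCompact_iUnion fun i =>
    isCompact_range_union (G.continuous i) (G.tendsto_atBot i) (G.tendsto_atTop i)

theorem volume_eq_zero (G : IsGraphic X Γ c γ) : volume Γ = 0 := by
  rw [G.eq_union]
  refine measure_union_null ((finite_range c).measure_zero _) (measure_iUnion_null fun i => ?_)
  rw [← image_univ]
  exact volume_image_curve fun t _ => G.solution i t

theorem congr {Y : Plane → Plane} (G : IsGraphic X Γ c γ) (h : EqOn Y X Γ) :
    IsGraphic Y Γ c γ where
  injective := G.injective
  critical i := (h (G.mem_critical i)).trans (G.critical i)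
  solution i t := by rw [h (G.mem_orbit i t)]; exact G.solution i t
  regular i t := by rw [h (G.mem_orbit i t)]; exact G.regular i t
  tendsto_atBot := G.tendsto_atBot
  tendsto_atTop := G.tendsto_atTop
  eq_union := G.eq_union

theorem flow_eq (G : IsGraphic X Γ c γ) (hφ : IsFlow X φ) (hL : LipschitzWith L X)
    (i : Fin (n + 1)) (s t : ℝ) : φ t (γ i s) = γ i (s + t) :=
  hφ.eq_of_solution hL (G.solution i) s t

/-- Orbits through a common point have the same limit at `-∞`, and the corners `c i` are distinct.
-/
theorem index_unique (G : IsGraphic X Γ c γ) (hφ : IsFlow X φ) (hL : LipschitzWith L X)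
    {i j : Fin (n + 1)} {s t : ℝ} (h : γ i s = γ j t) : i = j := by
  have h1 : ∀ u, γ i (s + u) = γ j (t + u) := fun u => by
    rw [← G.flow_eq hφ hL, ← G.flow_eq hφ hL, h]
  have h2 : Tendsto (fun u => γ i (s + u)) atBot (𝓝 (c i)) :=
    (G.tendsto_atBot i).comp (tendsto_atBot_add_const_left _ s tendsto_id)
  have h3 : Tendsto (fun u => γ i (s + u)) atBot (𝓝 (c j)) := by
    simp only [h1]
    exact (G.tendsto_atBot j).comp (tendsto_atBot_add_const_left _ t tendsto_id)
  exact G.injective (tendsto_nhds_unique h2 h3)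

/-- A second visit would make the orbit periodic, and its limit at `+∞` would be a regular point. -/
theorem time_unique (G : IsGraphic X Γ c γ) (hφ : IsFlow X φ) (hL : LipschitzWith L X)
    {i : Fin (n + 1)} {s t : ℝ} (ht : 0 < t) : γ i (s + t) ≠ γ i s := by
  intro h
  have h1 : ∀ k : ℕ, γ i (s + k * t) = γ i s := by
    intro k
    induction k with
    | zero => simp
    | succ k ih =>
      have : s + ((k + 1 : ℕ) : ℝ) * t = (s + k * t) + t := by push_cast; ring
      rw [this, ← G.flow_eq hφ hL, ih, G.flow_eq hφ hL, h]
  have h2 : Tendsto (fun k : ℕ => γ i (s + k * t)) atTop (𝓝 (c (i + 1))) :=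
    (G.tendsto_atTop i).comp (tendsto_atTop_add_const_left _ s
      (tendsto_natCast_atTop_atTop.atTop_mul_const ht))
  simp only [h1] at h2
  have h3 := tendsto_nhds_unique tendsto_const_nhds h2
  exact G.regular i s (by rw [h3]; exact G.critical _)

end IsGraphic

section Flow

variable {X : Plane → Plane} {L : NNReal} {φ : ℝ → Plane → Plane}

/-- The flow times between convergent sequences of points tend to infinity if the limits are not
on the same orbit. -/
theorem IsFlow.tendsto_atTop_of_ne (hφ : IsFlow X φ) (hL : LipschitzWith L X) {z : ℕ → Plane}
    {θ : ℕ → ℝ} {x q : Plane} {a : ℝ} (ha : 0 ≤ a) (hz : Tendsto z atTop (𝓝 x))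
    (hθ : ∀ᶠ n in atTop, a ≤ θ n) (hq : Tendsto (fun n => φ (θ n) (z n)) atTop (𝓝 q))
    (hne : ∀ t, a ≤ t → φ t x ≠ q) : Tendsto θ atTop atTop := by
  refine tendsto_atTop.2 fun b => ?_
  have hKc : IsCompact ((fun t => φ t x) '' Icc a b) :=
    isCompact_Icc.image (hφ.continuous_time x)
  have hqK : q ∉ (fun t => φ t x) '' Icc a b := by
    rintro ⟨t, ht, he⟩
    exact hne t ht.1 he
  obtain ⟨d, hd, hdK⟩ := Metric.mem_nhds_iff.1 (hKc.isClosed.isOpen_compl.mem_nhds hqK)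
  have h1 : Tendsto (fun n => dist (z n) x * Real.exp (L * b) + dist (φ (θ n) (z n)) q) atTop
      (𝓝 0) := by
    have := ((tendsto_iff_dist_tendsto_zero.1 hz).mul_const (Real.exp (L * b))).add
      (tendsto_iff_dist_tendsto_zero.1 hq)
    simpa using this
  filter_upwards [hθ, h1.eventually (gt_mem_nhds hd)] with n hn hn'
  by_contra hb
  push Not at hb
  refine hdK (a := φ (θ n) x) ?_ ⟨θ n, ⟨hn, hb.le⟩, rfl⟩
  rw [mem_ball]
  calc dist (φ (θ n) x) q ≤ dist (φ (θ n) (z n)) (φ (θ n) x) + dist (φ (θ n) (z n)) q := by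
        rw [dist_comm (φ (θ n) (z n)) (φ (θ n) x)]
        exact dist_triangle _ _ _
    _ ≤ dist (z n) x * Real.exp (L * b) + dist (φ (θ n) (z n)) q := by
        gcongr
        refine (hφ.dist_le_of_nonneg hL (ha.trans hn) _ _).trans ?_
        gcongr
    _ < d := hn'

theorem exists_first_exit {f : ℝ → ℝ} (hf : Continuous f) {a b r : ℝ} (hab : a ≤ b) (ha : f a < r)
    (hb : r ≤ f b) : ∃ e ∈ Icc a b, f e = r ∧ ∀ t ∈ Icc a e, f t ≤ r := by
  have hcl : IsClosed (Icc a b ∩ f ⁻¹' Ici r) := isClosed_Icc.inter (isClosed_Ici.preimage hf)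
  have hne : (Icc a b ∩ f ⁻¹' Ici r).Nonempty := ⟨b, ⟨hab, le_rfl⟩, hb⟩
  have hbd : BddBelow (Icc a b ∩ f ⁻¹' Ici r) := ⟨a, fun u hu => hu.1.1⟩
  set e := sInf (Icc a b ∩ f ⁻¹' Ici r) with he
  have hmem : e ∈ Icc a b ∩ f ⁻¹' Ici r := hcl.csInf_mem hne hbd
  have hlt : ∀ t, a ≤ t → t < e → f t < r := fun t hat hte => by
    by_contra hc
    exact not_le.2 hte (csInf_le hbd ⟨⟨hat, hte.le.trans hmem.1.2⟩, not_lt.1 hc⟩)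
  have hae : a < e := lt_of_le_of_ne hmem.1.1 fun h => absurd ha (not_lt.2 (by rw [h]; exact hmem.2))
  have hle : f e ≤ r := by
    refine le_of_tendsto (hf.continuousAt.tendsto.mono_left (nhdsWithin_le_nhds (s := Iio e))) ?_
    filter_upwards [Ioo_mem_nhdsLT hae] with t ht
    exact (hlt t ht.1.le ht.2).le
  refine ⟨e, hmem.1, le_antisymm hle hmem.2, fun t ht => ?_⟩
  rcases ht.2.eq_or_lt with h | h
  · rw [h]; exact hle
  · exact (hlt t ht.1 h).le

/-- A sequence of orbit arcs that start near `q`, come back to `q`, and converge to `Γ`. -/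
structure IsReturnSeq (φ : ℝ → Plane → Plane) (Γ : Set Plane) (q : Plane) (z : ℕ → Plane)
    (τ : ℕ → ℝ) : Prop where
  tendsto_start : Tendsto z atTop (𝓝 q)
  tendsto_end : Tendsto (fun n => φ (τ n) (z n)) atTop (𝓝 q)
  near : ∀ η > 0, ∀ᶠ n in atTop, ∀ t ∈ Icc 0 (τ n), infDist (φ t (z n)) Γ < η

theorem IsReturnSeq.subseq {Γ : Set Plane} {q : Plane} {z : ℕ → Plane} {τ : ℕ → ℝ}
    (h : IsReturnSeq φ Γ q z τ) {k : ℕ → ℕ} (hk : StrictMono k) :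
    IsReturnSeq φ Γ q (z ∘ k) (τ ∘ k) :=
  ⟨h.tendsto_start.comp hk.tendsto_atTop, h.tendsto_end.comp hk.tendsto_atTop,
    fun η hη => hk.tendsto_atTop.eventually (h.near η hη)⟩

variable {Γ : Set Plane} {n : ℕ} {c : Fin (n + 1) → Plane} {γ : Fin (n + 1) → ℝ → Plane}

/-- Orbit arcs that pass near one of the regular orbits of a graphic go on to the next one. -/
theorem IsReturnSeq.next (G : IsGraphic X Γ c γ) (hφ : IsFlow X φ) (hL : LipschitzWith L X)
    {i j : Fin (n + 1)} {s₀ s : ℝ} (hij : j + 1 ≠ i) {z : ℕ → Plane} {τ t : ℕ → ℝ}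
    (h : IsReturnSeq φ Γ (γ i s₀) z τ) (ht : ∀ᶠ m in atTop, 0 ≤ t m)
    (hts : Tendsto (fun m => φ (t m) (z m)) atTop (𝓝 (γ j s)))
    (hτ : Tendsto (fun m => τ m - t m) atTop atTop) :
    ∃ (k : ℕ → ℕ) (t' : ℕ → ℝ) (s' : ℝ), StrictMono k ∧ Tendsto t' atTop atTop ∧
      Tendsto (fun m => φ (t' m) (z (k m))) atTop (𝓝 (γ (j + 1) s')) ∧
      Tendsto (fun m => τ (k m) - t' m) atTop atTop := by
  set C := c (j + 1) with hC
  set w : ℕ → Plane := fun m => φ (t m) (z m) with hw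
  -- A ball around the corner `C` that contains neither the base point nor another corner.
  obtain ⟨r, hr, hball⟩ : ∃ r > 0, closedBall C r ⊆ (insert (γ i s₀) (c '' {j + 1}ᶜ))ᶜ := by
    refine Metric.nhds_basis_closedBall.mem_iff.1 (IsOpen.mem_nhds ?_ ?_)
    · exact (((toFinite _).image c).insert _).isClosed.isOpen_compl
    · rintro (h1 | ⟨l, hl, hlC⟩)
      · exact G.regular i s₀ (h1 ▸ G.critical _)
      · exact hl (G.injective hlC)
  obtain ⟨a, ha0, ha⟩ : ∃ a, 0 ≤ a ∧ ∀ u, a ≤ u → dist (γ j (s + u)) C < r / 2 := by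
    have := ((G.tendsto_atTop j).comp (tendsto_atTop_add_const_left atTop s tendsto_id)).eventually
      (ball_mem_nhds _ (half_pos hr))
    obtain ⟨a, ha⟩ := eventually_atTop.1 this
    exact ⟨max a 0, le_max_right _ _, fun u hu => ha u ((le_max_left _ _).trans hu)⟩
  have hwd : Tendsto (fun m => dist (w m) (γ j s)) atTop (𝓝 0) :=
    tendsto_iff_dist_tendsto_zero.1 hts
  -- By Grönwall, the arcs follow `γ j` into the ball and remain there for as long as desired. Since
  -- they end near `γ i s₀`, outside the ball, they have a first exit time `e`, and these times tend
  -- to infinity.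
  have hstay : ∀ b, a ≤ b → ∀ᶠ m in atTop, ∀ u ∈ Icc a b, dist (φ u (w m)) C < r := by
    intro b hb
    have h1 := hwd.mul_const (Real.exp (L * b))
    rw [zero_mul] at h1
    filter_upwards [h1.eventually (gt_mem_nhds (half_pos hr))] with m hm u hu
    calc dist (φ u (w m)) C ≤ dist (φ u (w m)) (φ u (γ j s)) + dist (φ u (γ j s)) C :=
          dist_triangle _ _ _
      _ ≤ dist (w m) (γ j s) * Real.exp (L * b) + dist (γ j (s + u)) C := by
          rw [← G.flow_eq hφ hL]
          gcongr
          refine (hφ.dist_le_of_nonneg hL (ha0.trans hu.1) _ _).trans ?_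
          gcongr
          exact hu.2
      _ < r / 2 + r / 2 := add_lt_add hm (ha u hu.1)
      _ = r := add_halves r
  have hend : Tendsto (fun m => φ (τ m - t m) (w m)) atTop (𝓝 (γ i s₀)) := by
    refine h.tendsto_end.congr fun m => ?_
    rw [hw, ← hφ.add hL]
    congr 1
    ring
  have hqr : r < dist (γ i s₀) C := by
    by_contra hc
    exact hball (mem_closedBall.2 (not_lt.1 hc)) (mem_insert _ _)
  have hexit : ∀ᶠ m in atTop, ∃ e ∈ Icc a (τ m - t m), dist (φ e (w m)) C = r ∧
      ∀ u ∈ Icc a e, dist (φ u (w m)) C ≤ r := by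
    filter_upwards [hstay a le_rfl, hτ.eventually_ge_atTop a,
      (hend.dist tendsto_const_nhds).eventually (lt_mem_nhds hqr)] with m h1 h2 h3
    exact exists_first_exit ((hφ.continuous_time (w m)).dist continuous_const) h2
      (h1 a ⟨le_rfl, le_rfl⟩) h3.le
  obtain ⟨e, he⟩ : ∃ e : ℕ → ℝ, ∀ᶠ m in atTop, e m ∈ Icc a (τ m - t m) ∧
      dist (φ (e m) (w m)) C = r ∧ ∀ u ∈ Icc a (e m), dist (φ u (w m)) C ≤ r := by
    have : ∀ m, ∃ e : ℝ, (∃ e ∈ Icc a (τ m - t m), dist (φ e (w m)) C = r ∧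
      ∀ u ∈ Icc a e, dist (φ u (w m)) C ≤ r) → e ∈ Icc a (τ m - t m) ∧
      dist (φ e (w m)) C = r ∧ ∀ u ∈ Icc a e, dist (φ u (w m)) C ≤ r := fun m => by
      by_cases hm : ∃ e ∈ Icc a (τ m - t m), dist (φ e (w m)) C = r ∧
        ∀ u ∈ Icc a e, dist (φ u (w m)) C ≤ r
      · obtain ⟨e, he⟩ := hm
        exact ⟨e, fun _ => he⟩
      · exact ⟨0, fun hm' => absurd hm' hm⟩
    choose e he using this
    exact ⟨e, hexit.mono fun m hm => he m hm⟩
  have hetop : Tendsto e atTop atTop := by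
    refine tendsto_atTop.2 fun b => ?_
    filter_upwards [he, hstay (max a b) (le_max_left _ _)] with m hm hm'
    by_contra hb
    push Not at hb
    exact absurd hm.2.1 (hm' (e m) ⟨hm.1.1, hb.le.trans (le_max_right _ _)⟩).ne
  -- A limit of the exit points lies on `Γ`, and it is regular because no corner is on the sphere.
  obtain ⟨x, hx, k, hk, hkx⟩ := (isCompact_sphere C r).tendsto_subseq'
    (x := fun m => φ (e m) (w m)) (he.mono fun m hm => mem_sphere.2 hm.2.1).frequently
  have hkt := hk.tendsto_atTop
  have hxΓ : x ∈ Γ := by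
    have hne : Γ.Nonempty := ⟨_, G.mem_orbit i s₀⟩
    rw [G.isCompact.isClosed.mem_iff_infDist_zero hne]
    refine le_antisymm (le_of_forall_pos_le_add fun η hη => ?_) infDist_nonneg
    rw [zero_add]
    refine le_of_tendsto (((continuous_infDist_pt Γ).tendsto x).comp hkx) (hkt.eventually
      (p := fun m => infDist (φ (e m) (w m)) Γ ≤ η) ?_)
    filter_upwards [h.near η hη, he, ht] with m h1 h2 h3
    have h4 : φ (e m) (w m) = φ (t m + e m) (z m) := (hφ.add hL _ _ _).symm
    change infDist (φ (e m) (w m)) Γ ≤ η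
    rw [h4]
    refine (h1 _ ⟨?_, ?_⟩).le
    · linarith [h2.1.1]
    · linarith [h2.1.2]
  obtain ⟨l, s', hl⟩ : ∃ l s', γ l s' = x := by
    rw [G.eq_union] at hxΓ
    rcases hxΓ with ⟨l, rfl⟩ | hxΓ
    · exfalso
      by_cases hlj : l = j + 1
      · rw [hlj, mem_sphere, dist_self] at hx
        exact hr.ne hx
      · exact hball (sphere_subset_closedBall hx) (mem_insert_of_mem _ ⟨l, hlj, rfl⟩)
    · obtain ⟨l, s', h1⟩ := mem_iUnion.1 hxΓ
      exact ⟨l, s', h1⟩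
  -- The whole backward orbit of `x` stays in the ball, because the exit times tend to infinity. Its
  -- limit at `-∞` is then a corner in the ball, which can only be `C`; so `x` is on the orbit
  -- leaving `C`.
  have hback : ∀ b, 0 ≤ b → γ l (s' - b) ∈ closedBall C r := by
    intro b hb
    have h1 : Tendsto (fun m => φ (-b) (φ (e (k m)) (w (k m)))) atTop (𝓝 (φ (-b) x)) :=
      (((hφ.continuous_uncurry hL).comp (Continuous.prodMk_right (-b))).tendsto x).comp hkx
    rw [← hl, G.flow_eq hφ hL, ← sub_eq_add_neg] at h1
    refine isClosed_closedBall.mem_of_tendsto h1 (hkt.eventually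
      (p := fun m => φ (-b) (φ (e m) (w m)) ∈ closedBall C r) ?_)
    filter_upwards [he, hetop.eventually_ge_atTop (a + b)] with m h1 h2
    rw [← hφ.add hL]
    exact h1.2.2 _ ⟨by linarith, by linarith⟩
  have hlj : l = j + 1 := by
    have h1 : c l ∈ closedBall C r := by
      refine isClosed_closedBall.mem_of_tendsto ((G.tendsto_atBot l).comp
        (tendsto_atBot_add_const_left _ s' tendsto_neg_atTop_atBot)) ?_
      filter_upwards [eventually_ge_atTop 0] with b hb
      exact hback b hb
    by_contra hne
    exact hball h1 (mem_insert_of_mem _ ⟨l, hne, rfl⟩)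
  subst hlj
  have hek : Tendsto (fun m => e (k m)) atTop atTop := hetop.comp hkt
  refine ⟨k, fun m => t (k m) + e (k m), s', hk, ?_, ?_, ?_⟩
  · refine tendsto_atTop_mono' _ ?_ hek
    filter_upwards [hkt.eventually ht] with m hm
    linarith
  · rw [hl]
    refine hkx.congr fun m => ?_
    exact (hφ.add hL _ _ _).symm
  -- The time left is unbounded, as the base point is not on the orbit of `x`: this is where `j + 1
  -- ≠ i` enters.
  · refine hφ.tendsto_atTop_of_ne hL (z := fun m => φ (e (k m)) (w (k m))) (x := x)
      (q := γ i s₀) le_rfl hkx ?_ ?_ fun u _ hu => ?_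
    · filter_upwards [hkt.eventually he] with m hm
      linarith [hm.1.2]
    · refine (h.tendsto_end.comp hkt).congr fun m => ?_
      change _ = φ (τ (k m) - (t (k m) + e (k m))) (φ (e (k m)) (φ (t (k m)) (z (k m))))
      rw [← hφ.add hL, ← hφ.add hL]
      exact congrArg₂ φ (by ring) rfl
    · rw [← hl, G.flow_eq hφ hL] at hu
      exact hij (G.index_unique hφ hL hu)

theorem fin_cyclic_induction {P : Fin (n + 1) → Prop} {i : Fin (n + 1)} (h0 : P i)
    (hs : ∀ j, P j → P (j + 1)) (j : Fin (n + 1)) : P j := by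
  have h1 : ∀ m : ℕ, P (i + Fin.ofNat (n + 1) m) := fun m => by
    induction m with
    | zero => simpa using h0
    | succ m ih =>
      have h2 : Fin.ofNat (n + 1) (m + 1) = Fin.ofNat (n + 1) m + 1 := by
        ext
        simp [Fin.val_add]
      rw [h2, ← add_assoc]
      exact hs _ ih
  have h2 : j = i + Fin.ofNat (n + 1) (j - i).val := by
    rw [Fin.ofNat_val_eq_self]
    abel
  rw [h2]
  exact h1 _

/-- Orbit arcs that return to a graphic pass near each of its regular points. -/
theorem IsReturnSeq.frequently_near (G : IsGraphic X Γ c γ) (hφ : IsFlow X φ)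
    (hL : LipschitzWith L X) {i : Fin (n + 1)} {s₀ τ₀ : ℝ} (hτ₀ : 0 < τ₀) {z : ℕ → Plane}
    {τ : ℕ → ℝ} (h : IsReturnSeq φ Γ (γ i s₀) z τ) (hτ : ∀ m, τ₀ ≤ τ m) (j : Fin (n + 1)) (s : ℝ)
    {ε : ℝ} (hε : 0 < ε) : ∃ m, ∃ t ∈ Icc 0 (τ m), dist (φ t (z m)) (γ j s) < ε := by
  have hφc : ∀ u, Continuous (φ u) := fun u =>
    (hφ.continuous_uncurry hL).comp (Continuous.prodMk_right u)
  have htop : ∀ {z : ℕ → Plane} {τ : ℕ → ℝ}, IsReturnSeq φ Γ (γ i s₀) z τ → (∀ m, τ₀ ≤ τ m) →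
      Tendsto τ atTop atTop := fun h hτ =>
    hφ.tendsto_atTop_of_ne hL hτ₀.le h.tendsto_start (Eventually.of_forall hτ) h.tendsto_end
      fun t ht => by
        rw [G.flow_eq hφ hL]
        exact G.time_unique hφ hL (hτ₀.trans_le ht)
  have key : ∀ j, ∃ (k : ℕ → ℕ) (t : ℕ → ℝ) (s : ℝ), StrictMono k ∧ (∀ᶠ m in atTop, 0 ≤ t m) ∧
      Tendsto (fun m => φ (t m) (z (k m))) atTop (𝓝 (γ j s)) ∧
      Tendsto (fun m => τ (k m) - t m) atTop atTop ∧ (j = i ∨ Tendsto t atTop atTop) := by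
    have hbase : ∃ (k : ℕ → ℕ) (t : ℕ → ℝ) (s : ℝ), StrictMono k ∧ (∀ᶠ m in atTop, 0 ≤ t m) ∧
      Tendsto (fun m => φ (t m) (z (k m))) atTop (𝓝 (γ i s)) ∧
      Tendsto (fun m => τ (k m) - t m) atTop atTop ∧ (i = i ∨ Tendsto t atTop atTop) :=
      ⟨id, fun _ => 0, s₀, strictMono_id, Eventually.of_forall fun _ => le_rfl,
        by simpa [hφ.zero] using h.tendsto_start, by simpa using htop h hτ, Or.inl rfl⟩
    refine fin_cyclic_induction hbase fun j hj => ?_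
    by_cases hji : j + 1 = i
    · rw [hji]
      exact hbase
    obtain ⟨k, t, s, hk, ht, hts, hτt, -⟩ := hj
    obtain ⟨k', t', s', hk', ht', hts', hτt'⟩ :=
      IsReturnSeq.next G hφ hL hji (h.subseq hk) ht hts hτt
    exact ⟨k ∘ k', t', s', hk.comp hk', ht'.eventually_ge_atTop 0, hts', hτt', Or.inr ht'⟩
  obtain ⟨k, t, s₁, hk, ht, hts, hτt, hor⟩ := key j
  by_cases hcase : j = i ∧ s < s₀
  -- A point of the starting orbit that precedes the base point is approached at the end of the
  -- arcs, by flowing back from their end points.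
  · obtain ⟨rfl, hs⟩ := hcase
    have h1 : Tendsto (fun m => φ (s - s₀) (φ (τ m) (z m))) atTop (𝓝 (φ (s - s₀) (γ j s₀))) :=
      ((hφc _).tendsto _).comp h.tendsto_end
    rw [G.flow_eq hφ hL, add_sub_cancel] at h1
    obtain ⟨m, hm1, hm2⟩ := ((h1.eventually (ball_mem_nhds _ hε)).and
      ((htop h hτ).eventually_ge_atTop (s₀ - s))).exists
    refine ⟨m, τ m + (s - s₀), ⟨by linarith, by linarith⟩, ?_⟩
    rw [hφ.add hL]
    exact hm1
  · rcases hor with rfl | htt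
    · have hs : s₀ ≤ s := by
        by_contra hc
        exact hcase ⟨rfl, not_le.1 hc⟩
      have h1 : Tendsto (fun m => φ (s - s₀) (z m)) atTop (𝓝 (φ (s - s₀) (γ j s₀))) :=
        ((hφc _).tendsto _).comp h.tendsto_start
      rw [G.flow_eq hφ hL, add_sub_cancel] at h1
      obtain ⟨m, hm1, hm2⟩ := ((h1.eventually (ball_mem_nhds _ hε)).and
        ((htop h hτ).eventually_ge_atTop (s - s₀))).exists
      exact ⟨m, s - s₀, ⟨by linarith, hm2⟩, hm1⟩
    · have h1 : Tendsto (fun m => φ (s - s₁) (φ (t m) (z (k m)))) atTop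
          (𝓝 (φ (s - s₁) (γ j s₁))) := ((hφc _).tendsto _).comp hts
      rw [G.flow_eq hφ hL, add_sub_cancel] at h1
      obtain ⟨m, ⟨hm1, hm2⟩, hm3⟩ := (((h1.eventually (ball_mem_nhds _ hε)).and
        (htt.eventually_ge_atTop (s₁ - s))).and (hτt.eventually_ge_atTop (s - s₁))).exists
      refine ⟨k m, t m + (s - s₁), ⟨by linarith, by linarith⟩, ?_⟩
      rw [hφ.add hL]
      exact hm1

/-- Uniform version of `IsReturnSeq.frequently_near`: counterexamples for `δ = 1 / (m + 1)` would
form a return sequence. -/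
theorem IsGraphic.exists_near_of_return (G : IsGraphic X Γ c γ) (hφ : IsFlow X φ)
    (hL : LipschitzWith L X) {i : Fin (n + 1)} {s₀ τ₀ : ℝ} (hτ₀ : 0 < τ₀) (j : Fin (n + 1)) (s : ℝ)
    {ε : ℝ} (hε : 0 < ε) : ∃ δ > 0, ∀ z τ, τ₀ ≤ τ → dist z (γ i s₀) < δ →
      dist (φ τ z) (γ i s₀) < δ → (∀ t ∈ Icc 0 τ, infDist (φ t z) Γ < δ) →
      ∃ t ∈ Icc 0 τ, dist (φ t z) (γ j s) < ε := by
  by_contra! hcon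
  choose z τ h1 h2 h3 h4 h5 using fun m : ℕ => hcon (1 / ((m : ℝ) + 1)) Nat.one_div_pos_of_nat
  have h0 : Tendsto (fun m : ℕ => 1 / ((m : ℝ) + 1)) atTop (𝓝 0) :=
    tendsto_one_div_add_atTop_nhds_zero_nat
  have hseq : IsReturnSeq φ Γ (γ i s₀) z τ := by
    refine ⟨?_, ?_, fun η hη => ?_⟩
    · exact tendsto_iff_dist_tendsto_zero.2
        (squeeze_zero (fun _ => dist_nonneg) (fun m => (h2 m).le) h0)
    · exact tendsto_iff_dist_tendsto_zero.2
        (squeeze_zero (fun _ => dist_nonneg) (fun m => (h3 m).le) h0)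
    · filter_upwards [h0.eventually (gt_mem_nhds hη)] with m hm t ht
      exact (h4 m t ht).trans hm
  obtain ⟨m, t, ht, hd⟩ := hseq.frequently_near G hφ hL hτ₀ h1 j s hε
  exact absurd hd (not_lt.2 (h5 m t ht))

/-- The orbits through a transversal segment do not return to it immediately. -/
theorem IsFlow.exists_no_quick_return (hφ : IsFlow X φ) (hL : LipschitzWith L X) {q v : Plane}
    (hv : (X q).1 * v.2 - (X q).2 * v.1 ≠ 0) : ∃ τ₀ > 0, ∃ δ > 0, ∀ s s' τ : ℝ, |s| < δ → 0 < τ →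
      φ τ (q + s • v) = q + s' • v → τ₀ ≤ τ := by
  set F : ℝ × Plane → ℝ := fun p => (X (φ p.1 p.2)).1 * v.2 - (X (φ p.1 p.2)).2 * v.1 with hF
  have hXc : Continuous fun p : ℝ × Plane => X (φ p.1 p.2) :=
    hL.continuous.comp (hφ.continuous_uncurry hL)
  have hFc : Continuous F := (hXc.fst.mul continuous_const).sub (hXc.snd.mul continuous_const)
  have hmap : Continuous fun p : ℝ × ℝ => F (p.1, q + p.2 • v) := hFc.comp (by fun_prop)
  have h0 : F (0, q + (0 : ℝ) • v) ≠ 0 := by simpa [hF, hφ.zero] using hv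
  obtain ⟨δ, hδ, hball⟩ := Metric.mem_nhds_iff.1
    ((hmap.isOpen_preimage _ isOpen_compl_singleton).mem_nhds (x := ((0 : ℝ), (0 : ℝ))) h0)
  refine ⟨δ, hδ, δ, hδ, fun s s' τ hs hτ he => ?_⟩
  by_contra hc
  push Not at hc
  -- `f` vanishes when the orbit is on the line `q + ℝ v`. Two visits would give, by Rolle, a zero
  -- of `f'`, which is `X × v` and does not vanish near `q`.
  set f : ℝ → ℝ := fun t => (φ t (q + s • v) - q).1 * v.2 - (φ t (q + s • v) - q).2 * v.1 with hf
  have hder : ∀ t, HasDerivAt f (F (t, q + s • v)) t := fun t => by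
    have h1 := (hφ.hasDerivAt (q + s • v) t).sub_const q
    have h2 : HasDerivAt (fun t => (φ t (q + s • v) - q).1) (X (φ t (q + s • v))).1 t := h1.fst
    have h3 : HasDerivAt (fun t => (φ t (q + s • v) - q).2) (X (φ t (q + s • v))).2 t := h1.snd
    exact (h2.mul_const _).sub (h3.mul_const _)
  obtain ⟨t, ht, ht0⟩ := exists_hasDerivAt_eq_zero (f := f) hτ
    (fun t _ => (hder t).continuousAt.continuousWithinAt)
    (by simp only [hf, hφ.zero, he, add_sub_cancel_left, Prod.smul_fst, Prod.smul_snd, smul_eq_mul]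
        ring) (fun t _ => hder t)
  refine hball (a := (t, s)) ?_ ht0
  rw [mem_ball, Prod.dist_eq, max_lt_iff]
  simp only [Real.dist_eq, sub_zero]
  exact ⟨by rw [abs_of_pos ht.1]; exact ht.2.trans hc, hs⟩

end Flow

end PlanarODE
end

/-! ### Orbit arcs that follow a periodic orbit or a polycycle. -/

open Set Filter Topology

noncomputable section

namespace PlanarODE

open MeasureTheory Metric

variable {X : Plane → Plane} {Γ U : Set Plane}

theorem dist_add_smul_lt {q v : Plane} {s δ : ℝ} (hs : 0 < s) (h : s < δ / (‖v‖ + 1)) :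
    dist (q + s • v) q < δ := by
  have hv : 0 < ‖v‖ + 1 := by positivity
  rw [dist_self_add_left, norm_smul, Real.norm_of_nonneg hs.le]
  calc s * ‖v‖ ≤ s * (‖v‖ + 1) := by gcongr; linarith
    _ < δ := (lt_div_iff₀ hv).1 h

/-- Transfers the return map to the complete flow of the extension `Y`, and adds the passage near a
prescribed regular point `y`, which the definition of a polycycle does not provide. -/
theorem IsGraphic.exists_return {Y : Plane → Plane} {O : Set Plane} {L : NNReal}
    {φ : ℝ → Plane → Plane} {n : ℕ} {c : Fin (n + 1) → Plane} {γ : Fin (n + 1) → ℝ → Plane}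
    (G : IsGraphic Y Γ c γ) (hφ : IsFlow Y φ) (hL : LipschitzWith L Y) (hO : IsOpen O)
    (hΓO : Γ ⊆ O) (hYX : EqOn Y X O) {q₀ v : Plane} (hq₀ : q₀ ∈ Γ)
    (hv : (Y q₀).1 * v.2 - (Y q₀).2 * v.1 ≠ 0)
    (hret : ∀ ε > 0, ∃ δ > 0, ∀ s ∈ Ioo (0 : ℝ) δ, ∃ (τ : ℝ) (σ : ℝ → Plane), 0 < τ ∧
      IsSolutionOn X σ (Icc 0 τ) ∧ σ 0 = q₀ + s • v ∧
      (∃ s' ∈ Ioo (0 : ℝ) ε, σ τ = q₀ + s' • v) ∧ ∀ t ∈ Icc 0 τ, infDist (σ t) Γ < ε)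
    {y : Plane} (hy : y ∈ Γ) (hXy : Y y ≠ 0) {ε : ℝ} (hε : 0 < ε) :
    ∃ δ > 0, ∀ s ∈ Ioo (0 : ℝ) δ, ∃ τ > 0, (∃ s' ∈ Ioo (0 : ℝ) ε, φ τ (q₀ + s • v) = q₀ + s' • v) ∧
      (∀ t ∈ Icc 0 τ, infDist (φ t (q₀ + s • v)) Γ < ε) ∧
      ∃ t ∈ Icc 0 τ, dist (φ t (q₀ + s • v)) y < ε := by
  have hne : Γ.Nonempty := ⟨_, hy⟩
  have hXq : Y q₀ ≠ 0 := fun h => hv (by simp [h])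
  obtain ⟨i, s₀, rfl⟩ := G.exists_orbit_of_regular hq₀ hXq
  obtain ⟨j, s₁, rfl⟩ := G.exists_orbit_of_regular hy hXy
  obtain ⟨η, hη, hηO⟩ := G.isCompact.exists_thickening_subset_open hO hΓO
  obtain ⟨τ₀, hτ₀, δ₀, hδ₀, hquick⟩ := hφ.exists_no_quick_return hL hv
  obtain ⟨δ₁, hδ₁, hnear⟩ := G.exists_near_of_return hφ hL (i := i) (s₀ := s₀) hτ₀ j s₁ hε
  have hvpos : 0 < ‖v‖ + 1 := by positivity
  -- `η` keeps the arc in the set where `Y = X`; `δ₁` and `δ₁ / (‖v‖ + 1)` provide the closeness to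
  -- `Γ` and to the base point that `hnear` requires.
  obtain ⟨δ, hδ, h⟩ := hret (min (min ε η) (min δ₁ (δ₁ / (‖v‖ + 1)))) (by positivity)
  refine ⟨min δ (min δ₀ (δ₁ / (‖v‖ + 1))), by positivity, fun s hs => ?_⟩
  obtain ⟨hs0, hs⟩ := hs
  simp only [lt_min_iff] at hs
  obtain ⟨τ, σ, hτ, hσ, hσ0, ⟨s', hs', hστ⟩, hd⟩ := h s ⟨hs0, hs.1⟩
  simp only [lt_min_iff, mem_Ioo] at hd hs'
  have hσY : IsSolutionOn Y σ (Icc 0 τ) := fun t ht => by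
    have : Y (σ t) = X (σ t) := hYX (hηO ((mem_thickening_iff_infDist_lt hne).2 (hd t ht).1.2))
    change HasDerivWithinAt σ (Y (σ t)) _ t
    rw [this]
    exact hσ t ht
  have hσφ : ∀ t ∈ Icc 0 τ, σ t = φ t (γ i s₀ + s • v) := fun t ht => by
    rw [← hσ0]
    exact hφ.eqOn_of_solutionOn hL hσY ht
  have hend : φ τ (γ i s₀ + s • v) = γ i s₀ + s' • v := by
    rw [← hσφ τ ⟨hτ.le, le_rfl⟩, hστ]
  refine ⟨τ, hτ, ⟨s', ⟨hs'.1, hs'.2.1.1⟩, hend⟩, fun t ht => ?_, ?_⟩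
  · rw [← hσφ t ht]
    exact (hd t ht).1.1
  · refine hnear _ τ (hquick s s' τ (by rw [abs_of_pos hs0]; exact hs.2.1) hτ hend)
      (dist_add_smul_lt hs0 hs.2.2) ?_ fun t ht => ?_
    · rw [hend]
      exact dist_add_smul_lt hs'.1 hs'.2.2.2
    · rw [← hσφ t ht]
      exact (hd t ht).2.1

theorem IsPolycycle.isCompact (h : IsPolycycle X Γ) : IsCompact Γ := by
  obtain ⟨n, c, γ, G⟩ := h.exists_isGraphic
  exact G.isCompact

theorem IsPolycycle.volume_eq_zero (h : IsPolycycle X Γ) : volume Γ = 0 := by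
  obtain ⟨n, c, γ, G⟩ := h.exists_isGraphic
  exact G.volume_eq_zero

/-- The return map is based at its own point `q₀`. Three consecutive returns are concatenated,
passing near `q`, near `p` and near `q`; the arc between the two passages near `q` is the one
sought. -/
theorem IsPolycycle.loopNear (hU : IsOpen U) (hX : ContDiffOn ℝ 1 X U) (hΓU : Γ ⊆ U)
    (h : IsPolycycle X Γ) {q p : Plane} (hq : q ∈ Γ) (hXq : X q ≠ 0) (hp : p ∈ Γ)
    (hXp : X p ≠ 0) : LoopNear X Γ q p := by
  obtain ⟨n, c, γ, G⟩ := h.exists_isGraphic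
  obtain ⟨-, q₀, hq₀, v, hv, hret⟩ := h
  have hne : Γ.Nonempty := ⟨_, hq⟩
  obtain ⟨Y, O, L, φ, hO, hΓO, -, hYX, -, -, hL, hφ⟩ :=
    exists_complete_extension hU G.isCompact hΓU hX
  obtain ⟨η, hη, hηO⟩ := G.isCompact.exists_thickening_subset_open hO hΓO
  have G' := G.congr (hYX.mono hΓO)
  rw [← hYX (hΓO hq₀)] at hv
  rw [← hYX (hΓO hq)] at hXq
  rw [← hYX (hΓO hp)] at hXp
  intro ε₀ hε₀
  set ε := min ε₀ η with hεdef
  have hε : 0 < ε := lt_min hε₀ hη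
  -- The tolerances are fixed from the last return to the first, so that each return lands where the
  -- following one is defined.
  obtain ⟨δ₃, hδ₃, h₃⟩ := G'.exists_return hφ hL hO hΓO hYX hq₀ hv hret hq hXq hε
  obtain ⟨δ₂, hδ₂, h₂⟩ := G'.exists_return hφ hL hO hΓO hYX hq₀ hv hret hp hXp (lt_min hε hδ₃)
  obtain ⟨δ₁, hδ₁, h₁⟩ := G'.exists_return hφ hL hO hΓO hYX hq₀ hv hret hq hXq (lt_min hε hδ₂)
  obtain ⟨τ₁, hτ₁, ⟨s₁, hs₁, e₁⟩, n₁, t₁, ht₁, d₁⟩ := h₁ (δ₁ / 2) ⟨half_pos hδ₁, half_lt_self hδ₁⟩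
  obtain ⟨τ₂, hτ₂, ⟨s₂, hs₂, e₂⟩, n₂, t₂, ht₂, d₂⟩ :=
    h₂ s₁ ⟨hs₁.1, hs₁.2.trans_le (min_le_right _ _)⟩
  obtain ⟨τ₃, hτ₃, -, n₃, t₃, ht₃, d₃⟩ := h₃ s₂ ⟨hs₂.1, hs₂.2.trans_le (min_le_right _ _)⟩
  set z := q₀ + (δ₁ / 2) • v with hz
  have e2 : ∀ u, φ (τ₁ + u) z = φ u (q₀ + s₁ • v) := fun u => by rw [hφ.add hL, e₁]
  have e3 : ∀ u, φ (τ₁ + (τ₂ + u)) z = φ u (q₀ + s₂ • v) := fun u => by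
    rw [e2, hφ.add hL, e₂]
  have hnear : ∀ u ∈ Icc 0 (τ₁ + (τ₂ + t₃)), infDist (φ u z) Γ < ε := by
    intro u hu
    rcases le_total u τ₁ with h1 | h1
    · exact (n₁ u ⟨hu.1, h1⟩).trans_le (min_le_left _ _)
    rcases le_total u (τ₁ + τ₂) with h2 | h2
    · have := e2 (u - τ₁)
      rw [add_sub_cancel] at this
      rw [this]
      exact (n₂ _ ⟨by linarith, by linarith⟩).trans_le (min_le_left _ _)
    · have := e3 (u - τ₁ - τ₂)
      rw [show τ₁ + (τ₂ + (u - τ₁ - τ₂)) = u by ring] at this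
      rw [this]
      exact n₃ _ ⟨by linarith, by linarith [hu.2, ht₃.2]⟩
  refine ⟨τ₁ - t₁ + τ₂ + t₃, by linarith [ht₁.2, ht₃.1], fun t => φ (t₁ + t) z,
    (hφ.continuous_time z).comp (continuous_const_add t₁), fun t ht => ?_, ?_, ?_, fun t ht => ?_, ?_⟩
  · have h1 : φ (t₁ + t) z ∈ O := hηO ((mem_thickening_iff_infDist_lt hne).2
      ((hnear _ ⟨by linarith [ht₁.1, ht.1], by linarith [ht.2]⟩).trans_le (min_le_right _ _)))
    rw [← hYX h1]
    exact (hφ.hasDerivAt z (t₁ + t)).comp_const_add t₁ t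
  · simp only [add_zero]
    exact d₁.trans_le ((min_le_left _ _).trans (min_le_left _ _))
  · simp only
    rw [show t₁ + (τ₁ - t₁ + τ₂ + t₃) = τ₁ + (τ₂ + t₃) by ring, e3]
    exact d₃.trans_le (min_le_left _ _)
  · exact (hnear _ ⟨by linarith [ht₁.1, ht.1], by linarith [ht.2]⟩).trans_le (min_le_left _ _)
  · refine ⟨τ₁ - t₁ + t₂, ⟨by linarith [ht₁.2, ht₂.1], by linarith [ht₂.2, ht₃.1]⟩, ?_⟩
    simp only
    rw [show t₁ + (τ₁ - t₁ + t₂) = τ₁ + t₂ by ring, e2]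
    exact d₂.trans_le ((min_le_left _ _).trans (min_le_left _ _))

namespace IsPeriodicOrbit

theorem exists_solution (h : IsPeriodicOrbit X Γ) : ∃ (γ : ℝ → Plane) (T : ℝ),
    (∀ t, HasDerivAt γ (X (γ t)) t) ∧ (∀ t, X (γ t) ≠ 0) ∧ 0 < T ∧ Function.Periodic γ T ∧ range γ = Γ := by
  obtain ⟨γ, T, hγ, hr⟩ := h
  exact ⟨γ, T, hγ.1, hγ.2, hγ.3, hγ.4, hr⟩

theorem isCompact (h : IsPeriodicOrbit X Γ) : IsCompact Γ := by
  obtain ⟨γ, T, hγ, -, hT, hper, rfl⟩ := h.exists_solution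
  rw [← hper.image_Icc hT 0]
  exact isCompact_Icc.image (continuous_iff_continuousAt.2 fun t => (hγ t).continuousAt)

theorem volume_eq_zero (h : IsPeriodicOrbit X Γ) : volume Γ = 0 := by
  obtain ⟨γ, T, hγ, -, -, -, rfl⟩ := h.exists_solution
  rw [← image_univ]
  exact volume_image_curve fun t _ => hγ t

theorem loopNear (h : IsPeriodicOrbit X Γ) {q p : Plane} (hq : q ∈ Γ) (hp : p ∈ Γ) :
    LoopNear X Γ q p := by
  obtain ⟨γ, T, hγ, -, hT, hper, rfl⟩ := h.exists_solution
  obtain ⟨s, rfl⟩ := hq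
  obtain ⟨u, hu, rfl⟩ := (hper.image_Icc hT s).symm ▸ hp
  intro ε hε
  refine ⟨T, hT, fun t => γ (s + t), (continuous_iff_continuousAt.2 fun t =>
    (hγ t).continuousAt).comp (continuous_const_add s), fun t _ => (hγ (s + t)).comp_const_add s t,
    by simpa using hε, by simpa [hper s] using hε, fun t _ => ?_,
    u - s, ⟨by linarith [hu.1], by linarith [hu.2]⟩, by simpa using hε⟩
  rw [infDist_zero_of_mem (mem_range_self _)]
  exact hε

end IsPeriodicOrbit

theorem isCompact_of_isPeriodicOrbit_or_isPolycycle (h : IsPeriodicOrbit X Γ ∨ IsPolycycle X Γ) :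
    IsCompact Γ :=
  h.elim IsPeriodicOrbit.isCompact IsPolycycle.isCompact

theorem volume_eq_zero_of_isPeriodicOrbit_or_isPolycycle
    (h : IsPeriodicOrbit X Γ ∨ IsPolycycle X Γ) : volume Γ = 0 :=
  h.elim IsPeriodicOrbit.volume_eq_zero IsPolycycle.volume_eq_zero

theorem loopNear_of_isPeriodicOrbit_or_isPolycycle (hU : IsOpen U) (hX : ContDiffOn ℝ 1 X U)
    (hΓU : Γ ⊆ U) (h : IsPeriodicOrbit X Γ ∨ IsPolycycle X Γ) {q p : Plane} (hq : q ∈ Γ)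
    (hXq : X q ≠ 0) (hp : p ∈ Γ) (hXp : X p ≠ 0) : LoopNear X Γ q p :=
  h.elim (fun h => h.loopNear hq hp) fun h => h.loopNear hU hX hΓU hq hXq hp hXp

theorem exists_regular_solution (h : IsPeriodicOrbit X Γ ∨ IsPolycycle X Γ) :
    ∃ γ : ℝ → Plane, (∀ t, HasDerivAt γ (X (γ t)) t) ∧ (∀ t, X (γ t) ≠ 0) ∧ ∀ t, γ t ∈ Γ := by
  rcases h with h | h
  · obtain ⟨γ, T, hγ, hreg, -, -, rfl⟩ := h.exists_solution
    exact ⟨γ, hγ, hreg, mem_range_self⟩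
  · obtain ⟨n, c, γ, G⟩ := h.exists_isGraphic
    exact ⟨γ 0, G.solution 0, G.regular 0, G.mem_orbit 0⟩

theorem IsGraphic.not_mem_of_periodic {L : NNReal} {φ : ℝ → Plane → Plane} {n : ℕ}
    {c : Fin (n + 1) → Plane} {γ : Fin (n + 1) → ℝ → Plane} (G : IsGraphic X Γ c γ)
    (hφ : IsFlow X φ) (hL : LipschitzWith L X) {σ : ℝ → Plane} {T : ℝ}
    (hσ : ∀ t, HasDerivAt σ (X (σ t)) t) (hT : 0 < T) (hper : Function.Periodic σ T) {t : ℝ}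
    (hreg : X (σ t) ≠ 0) : σ t ∉ Γ := by
  intro hmem
  obtain ⟨i, s, hs⟩ := G.exists_orbit_of_regular hmem hreg
  refine G.time_unique hφ hL (i := i) (s := s) hT ?_
  rw [← G.flow_eq hφ hL, hs, hφ.eq_of_solution hL hσ, hper t]

theorem IsGraphic.endpoints_eq {L : NNReal} {φ : ℝ → Plane → Plane} {n n' : ℕ}
    {c : Fin (n + 1) → Plane} {γ : Fin (n + 1) → ℝ → Plane} {Γ' : Set Plane}
    {c' : Fin (n' + 1) → Plane} {γ' : Fin (n' + 1) → ℝ → Plane} (G : IsGraphic X Γ c γ)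
    (G' : IsGraphic X Γ' c' γ') (hφ : IsFlow X φ) (hL : LipschitzWith L X) {i : Fin (n + 1)}
    {i' : Fin (n' + 1)} {s s' : ℝ} (h : γ i s = γ' i' s') :
    c i = c' i' ∧ c (i + 1) = c' (i' + 1) ∧ range (γ i) = range (γ' i') := by
  have h1 : ∀ u, γ i (s + u) = γ' i' (s' + u) := fun u => by
    rw [← G.flow_eq hφ hL, ← G'.flow_eq hφ hL, h]
  refine ⟨?_, ?_, ?_⟩
  · have h2 : Tendsto (fun u => γ i (s + u)) atBot (𝓝 (c i)) :=
      (G.tendsto_atBot i).comp (tendsto_atBot_add_const_left _ s tendsto_id)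
    simp only [h1] at h2
    exact tendsto_nhds_unique h2
      ((G'.tendsto_atBot i').comp (tendsto_atBot_add_const_left _ s' tendsto_id))
  · have h2 : Tendsto (fun u => γ i (s + u)) atTop (𝓝 (c (i + 1))) :=
      (G.tendsto_atTop i).comp (tendsto_atTop_add_const_left _ s tendsto_id)
    simp only [h1] at h2
    exact tendsto_nhds_unique h2
      ((G'.tendsto_atTop i').comp (tendsto_atTop_add_const_left _ s' tendsto_id))
  · refine Subset.antisymm ?_ ?_
    · rintro _ ⟨t, rfl⟩
      exact ⟨s' + (t - s), by rw [← h1, add_sub_cancel]⟩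
    · rintro _ ⟨t, rfl⟩
      exact ⟨s + (t - s'), by rw [h1, add_sub_cancel]⟩

/-- A common point gives a common orbit with common end points. If the orbit leaving `c' j` belongs
to both graphics, so does the one leaving `c' (j + 1)`, because the corners are distinct; going
around the cycle, nothing of `Γ'` is missed. -/
theorem IsGraphic.eq_of_forall_exists_mem {L : NNReal} {φ : ℝ → Plane → Plane} {n n' : ℕ}
    {c : Fin (n + 1) → Plane} {γ : Fin (n + 1) → ℝ → Plane} {Γ' : Set Plane}
    {c' : Fin (n' + 1) → Plane} {γ' : Fin (n' + 1) → ℝ → Plane} (G : IsGraphic X Γ c γ)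
    (G' : IsGraphic X Γ' c' γ') (hφ : IsFlow X φ) (hL : LipschitzWith L X)
    (h : ∀ i, ∃ t, γ i t ∈ Γ') : Γ = Γ' := by
  have h1 : ∀ i, ∃ i', c i = c' i' ∧ c (i + 1) = c' (i' + 1) ∧ range (γ i) = range (γ' i') := by
    intro i
    obtain ⟨t, ht⟩ := h i
    obtain ⟨i', s, hs⟩ := G'.exists_orbit_of_regular ht (G.regular i t)
    exact ⟨i', G.endpoints_eq G' hφ hL hs.symm⟩
  obtain ⟨i₀, hi₀⟩ := h1 0
  have h2 : ∀ i', ∃ i, c i = c' i' ∧ c (i + 1) = c' (i' + 1) ∧ range (γ i) = range (γ' i') := by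
    refine fin_cyclic_induction ⟨0, hi₀⟩ ?_
    rintro j ⟨i, -, hi, -⟩
    obtain ⟨j', hj'⟩ := h1 (i + 1)
    obtain rfl : j' = j + 1 := G'.injective (hj'.1.symm.trans hi)
    exact ⟨i + 1, hj'⟩
  rw [G.eq_union, G'.eq_union]
  refine Subset.antisymm (union_subset_union ?_ ?_) (union_subset_union ?_ ?_)
  · rintro _ ⟨i, rfl⟩
    obtain ⟨i', hi', -⟩ := h1 i
    exact ⟨i', hi'.symm⟩
  · refine iUnion_subset fun i => ?_
    obtain ⟨i', -, -, hi'⟩ := h1 i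
    exact hi'.subset.trans (subset_iUnion (fun i => range (γ' i)) i')
  · rintro _ ⟨i', rfl⟩
    obtain ⟨i, hi, -⟩ := h2 i'
    exact ⟨i, hi⟩
  · refine iUnion_subset fun i' => ?_
    obtain ⟨i, -, -, hi⟩ := h2 i'
    exact hi.superset.trans (subset_iUnion (fun i => range (γ i)) i)

/-- One of the regular orbits of a periodic orbit or polycycle is disjoint from any other one. -/
theorem exists_orbit_disjoint (hU : IsOpen U) (hX : ContDiffOn ℝ 1 X U) {Γ' : Set Plane}
    (hΓU : Γ ⊆ U) (hΓU' : Γ' ⊆ U) (h : IsPeriodicOrbit X Γ ∨ IsPolycycle X Γ)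
    (h' : IsPeriodicOrbit X Γ' ∨ IsPolycycle X Γ') (hne : Γ ≠ Γ') :
    ∃ γ : ℝ → Plane, (∀ t, HasDerivAt γ (X (γ t)) t) ∧ (∀ t, X (γ t) ≠ 0) ∧ (∀ t, γ t ∈ Γ) ∧
      ∀ t, γ t ∉ Γ' := by
  obtain ⟨Y, O, L, φ, hO, hΓO, -, hYX, -, -, hL, hφ⟩ := exists_complete_extension hU
    ((isCompact_of_isPeriodicOrbit_or_isPolycycle h).union
      (isCompact_of_isPeriodicOrbit_or_isPolycycle h')) (union_subset hΓU hΓU') hX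
  have hY : EqOn Y X Γ := hYX.mono (subset_union_left.trans hΓO)
  have hY' : EqOn Y X Γ' := hYX.mono (subset_union_right.trans hΓO)
  rcases h with h | h
  · obtain ⟨γ, T, hγ, hreg, hT, hper, rfl⟩ := h.exists_solution
    have hγY : ∀ t, HasDerivAt γ (Y (γ t)) t := fun t => by rw [hY (mem_range_self t)]; exact hγ t
    refine ⟨γ, hγ, hreg, mem_range_self, fun t ht => ?_⟩
    rcases h' with h' | h'
    · obtain ⟨γ', T', hγ', hreg', hT', hper', rfl⟩ := h'.exists_solution
      have hγY' : ∀ t, HasDerivAt γ' (Y (γ' t)) t := fun t => by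
        rw [hY' (mem_range_self t)]; exact hγ' t
      obtain ⟨s, hs⟩ := ht
      have h1 : ∀ u, γ (t + u) = γ' (s + u) := fun u => by
        rw [← hφ.eq_of_solution hL hγY, ← hφ.eq_of_solution hL hγY', hs]
      refine hne (Subset.antisymm ?_ ?_)
      · rintro _ ⟨u, rfl⟩
        exact ⟨s + (u - t), by rw [← h1, add_sub_cancel]⟩
      · rintro _ ⟨u, rfl⟩
        exact ⟨t + (u - s), by rw [h1, add_sub_cancel]⟩
    · obtain ⟨n, c, γ', G⟩ := h'.exists_isGraphic
      refine (G.congr hY').not_mem_of_periodic hφ hL hγY hT hper ?_ ht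
      rw [hY (mem_range_self t)]
      exact hreg t
  · obtain ⟨n, c, γ, G⟩ := h.exists_isGraphic
    by_contra! hcon
    have hmeet : ∀ i, ∃ t, γ i t ∈ Γ' := fun i =>
      hcon (γ i) (G.solution i) (G.regular i) (G.mem_orbit i)
    rcases h' with h' | h'
    · obtain ⟨γ', T', hγ', hreg', hT', hper', rfl⟩ := h'.exists_solution
      obtain ⟨t, s, hs⟩ := hmeet 0
      refine (G.congr hY).not_mem_of_periodic hφ hL (σ := γ') (t := s)
        (fun t => by rw [hY' (mem_range_self t)]; exact hγ' t) hT' hper' ?_ ?_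
      · rw [hY' (mem_range_self s)]
        exact hreg' s
      · rw [hs]
        exact G.mem_orbit 0 t
    · obtain ⟨n', c', γ', G'⟩ := h'.exists_isGraphic
      exact hne ((G.congr hY).eq_of_forall_exists_mem (G'.congr hY') hφ hL hmeet)

end PlanarODE
end

/-! ### Winding numbers by continuous logarithms. -/

open Set Filter Topology

noncomputable section

namespace PlanarODE

/-- The identification of the plane with `ℂ`. -/
def toComplex (z : Plane) : ℂ := ⟨z.1, z.2⟩

@[simp] theorem toComplex_re (z : Plane) : (toComplex z).re = z.1 := rfl
@[simp] theorem toComplex_im (z : Plane) : (toComplex z).im = z.2 := rfl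

theorem continuous_toComplex : Continuous toComplex :=
  Complex.equivRealProdCLM.symm.continuous

theorem toComplex_injective : Function.Injective toComplex := fun _ _ h =>
  Prod.ext (congrArg Complex.re h) (congrArg Complex.im h)

theorem toComplex_sub_ne_zero {z w : Plane} (h : z ≠ w) : toComplex z - toComplex w ≠ 0 :=
  sub_ne_zero.2 (toComplex_injective.ne h)

theorem exists_continuous_log {A : Type*} [TopologicalSpace A] [SimplyConnectedSpace A]
    [LocallyPathConnectedSpace A] {c : A → ℂ} (hc : Continuous c) (h0 : ∀ a, c a ≠ 0) :
    ∃ l : A → ℂ, Continuous l ∧ ∀ a, Complex.exp (l a) = c a := by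
  obtain ⟨a₀⟩ : Nonempty A := inferInstance
  obtain ⟨F, ⟨-, hF⟩, -⟩ := Complex.isCoveringMapOn_exp.existsUnique_continuousMap_lifts
    ⟨c, hc⟩ (a₀ := a₀) (Complex.exp_log (h0 a₀)) (fun a => h0 a)
  exact ⟨F, F.continuous, fun a => congrFun hF a⟩

/-- The difference of two logarithms takes values in the discrete group `2πi ℤ`. -/
theorem log_sub_eq {A : Type*} [TopologicalSpace A] {s : Set A} (hs : IsPreconnected s)
    {l l' : A → ℂ} (hl : ContinuousOn l s) (hl' : ContinuousOn l' s)
    (h : ∀ a ∈ s, Complex.exp (l a) = Complex.exp (l' a)) {x y : A} (hx : x ∈ s) (hy : y ∈ s) :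
    l x - l' x = l y - l' y := by
  have hT : DiscreteTopology (AddSubgroup.zmultiples (2 * Real.pi * Complex.I : ℂ)) :=
    NormedSpace.discreteTopology_zmultiples _
  have hmaps : MapsTo (fun a => l a - l' a) s
      (AddSubgroup.zmultiples (2 * Real.pi * Complex.I : ℂ) : Set ℂ) := by
    intro a ha
    obtain ⟨n, hn⟩ := Complex.exp_eq_exp_iff_exists_int.1 (h a ha)
    exact ⟨n, by simp [hn]⟩
  exact hs.constant_of_mapsTo ⟨hT⟩ (hl.sub hl') hmaps hx hy

/-- The closed curve `λ` on `[0, T]` has winding number `n` around `z`. -/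
def HasWinding (lam : ℝ → Plane) (T : ℝ) (z : Plane) (n : ℤ) : Prop :=
  ∃ l : ℝ → ℂ, ContinuousOn l (Icc 0 T) ∧
    (∀ t ∈ Icc 0 T, Complex.exp (l t) = toComplex (lam t) - toComplex z) ∧
    l T - l 0 = n * (2 * Real.pi * Complex.I)

section

variable {lam : ℝ → Plane} {T : ℝ} {z z' : Plane}

theorem continuous_clamp (T : ℝ) : Continuous fun t : ℝ => max 0 (min t T) := by fun_prop

theorem clamp_mem (hT : 0 ≤ T) (t : ℝ) : max 0 (min t T) ∈ Icc 0 T :=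
  ⟨le_max_left _ _, max_le hT (min_le_right _ _)⟩

theorem clamp_eq {t : ℝ} (ht : t ∈ Icc 0 T) : max 0 (min t T) = t := by
  rw [min_eq_left ht.2, max_eq_right ht.1]

theorem HasWinding.ne {n : ℤ} (h : HasWinding lam T z n) {t : ℝ} (ht : t ∈ Icc 0 T) :
    lam t ≠ z := by
  obtain ⟨l, -, hl, -⟩ := h
  intro heq
  have := hl t ht
  rw [heq, sub_self] at this
  exact Complex.exp_ne_zero _ this

theorem exists_hasWinding (hlam : ContinuousOn lam (Icc 0 T)) (hT : 0 ≤ T)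
    (hloop : lam T = lam 0) (hz : ∀ t ∈ Icc 0 T, lam t ≠ z) : ∃ n, HasWinding lam T z n := by
  have hc : Continuous fun t => toComplex (lam (max 0 (min t T))) - toComplex z :=
    (continuous_toComplex.comp (hlam.comp_continuous (continuous_clamp T)
      fun t => clamp_mem hT t)).sub continuous_const
  obtain ⟨l, hl, hexp⟩ := exists_continuous_log hc
    fun t => toComplex_sub_ne_zero (hz _ (clamp_mem hT t))
  have h1 : ∀ t ∈ Icc 0 T, Complex.exp (l t) = toComplex (lam t) - toComplex z := fun t ht => by
    rw [hexp, clamp_eq ht]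
  have h2 : Complex.exp (l T) = Complex.exp (l 0) := by
    rw [h1 T ⟨hT, le_rfl⟩, h1 0 ⟨le_rfl, hT⟩, hloop]
  obtain ⟨n, hn⟩ := Complex.exp_eq_exp_iff_exists_int.1 h2
  exact ⟨n, l, hl.continuousOn, h1, by simp [hn]⟩

theorem two_pi_I_mul_cancel {m n : ℤ}
    (h : (m : ℂ) * (2 * Real.pi * Complex.I) = n * (2 * Real.pi * Complex.I)) : m = n := by
  exact_mod_cast mul_right_cancel₀ Complex.two_pi_I_ne_zero h

theorem HasWinding.unique (hT : 0 ≤ T) {m n : ℤ} (hm : HasWinding lam T z m)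
    (hn : HasWinding lam T z n) : m = n := by
  obtain ⟨l, hl, he, hd⟩ := hm
  obtain ⟨l', hl', he', hd'⟩ := hn
  have := log_sub_eq isPreconnected_Icc hl hl' (fun t ht => (he t ht).trans (he' t ht).symm)
    (right_mem_Icc.2 hT) (left_mem_Icc.2 hT)
  apply two_pi_I_mul_cancel
  rw [← hd, ← hd']
  linear_combination this

/-- If `w = (u - z') / (u - z)` is real and `w ≤ 0`, then `u = (-w z + z') / (1 - w)`, a convex
combination. -/
theorem mem_segment_of_div_notMem_slitPlane {u : Plane} (hz : u ≠ z)
    (h : (toComplex u - toComplex z') / (toComplex u - toComplex z) ∉ Complex.slitPlane) :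
    u ∈ segment ℝ z z' := by
  rw [Complex.mem_slitPlane_iff, not_or, not_lt, not_not] at h
  set w := (toComplex u - toComplex z') / (toComplex u - toComplex z) with hw
  have hzne := toComplex_sub_ne_zero hz
  have hmul : w * (toComplex u - toComplex z) = toComplex u - toComplex z' :=
    div_mul_cancel₀ _ hzne
  have hre := congrArg Complex.re hmul
  have him := congrArg Complex.im hmul
  simp only [Complex.mul_re, Complex.mul_im, h.2, Complex.sub_re, Complex.sub_im, toComplex_re,
    toComplex_im, zero_mul, sub_zero, add_zero] at hre him
  have h1 : 0 < 1 - w.re := by linarith [h.1]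
  refine ⟨-w.re / (1 - w.re), 1 / (1 - w.re), div_nonneg (by linarith [h.1]) h1.le,
    by positivity, by field_simp; ring, ?_⟩
  ext
  · simp only [Prod.fst_add, Prod.smul_fst, smul_eq_mul]
    field_simp
    linear_combination hre
  · simp only [Prod.snd_add, Prod.smul_snd, smul_eq_mul]
    field_simp
    linear_combination him

/-- Off the segment, `(lam - z') / (lam - z)` stays in the slit plane. Its principal logarithm turns
a logarithm for `z` into one for `z'`, and it takes equal values at the two ends of the loop. -/
theorem HasWinding.of_segment_disjoint {n : ℤ} (hlam : ContinuousOn lam (Icc 0 T))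
    (hloop : lam T = lam 0) (hseg : ∀ t ∈ Icc 0 T, lam t ∉ segment ℝ z z')
    (h : HasWinding lam T z n) : HasWinding lam T z' n := by
  obtain ⟨l, hl, he, hd⟩ := h
  have hz : ∀ t ∈ Icc 0 T, lam t ≠ z := fun t ht heq =>
    hseg t ht (heq ▸ left_mem_segment ℝ z z')
  have hz' : ∀ t ∈ Icc 0 T, lam t ≠ z' := fun t ht heq =>
    hseg t ht (heq ▸ right_mem_segment ℝ z z')
  have hc : ContinuousOn (fun t => toComplex (lam t)) (Icc 0 T) :=
    continuous_toComplex.comp_continuousOn hlam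
  refine ⟨fun t => l t +
    Complex.log ((toComplex (lam t) - toComplex z') / (toComplex (lam t) - toComplex z)),
    hl.add (ContinuousOn.clog ?_ ?_), fun t ht => ?_, ?_⟩
  · exact (hc.sub continuousOn_const).div (hc.sub continuousOn_const)
      fun t ht => toComplex_sub_ne_zero (hz t ht)
  · intro t ht
    by_contra hns
    exact hseg t ht (mem_segment_of_div_notMem_slitPlane (hz t ht) hns)
  · have h1 := toComplex_sub_ne_zero (hz t ht)
    rw [Complex.exp_add, he t ht, Complex.exp_log (div_ne_zero
      (toComplex_sub_ne_zero (hz' t ht)) h1), mul_div_cancel₀ _ h1]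
  · simp only [hloop]
    rw [← hd]
    ring

/-- In `lam - z = -z (1 - lam / z)` the second factor stays in the disc of radius `1` about `1`,
where the principal logarithm is continuous. -/
theorem HasWinding.zero_of_norm_lt (hlam : ContinuousOn lam (Icc 0 T)) (hT : 0 ≤ T)
    (hloop : lam T = lam 0) (hz : ∀ t ∈ Icc 0 T, ‖toComplex (lam t)‖ < ‖toComplex z‖) :
    HasWinding lam T z 0 := by
  have hz0 : toComplex z ≠ 0 := by
    have := (norm_nonneg _).trans_lt (hz 0 ⟨le_rfl, hT⟩)
    exact norm_pos_iff.1 this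
  have hsl : ∀ t ∈ Icc 0 T, 1 + -(toComplex (lam t) / toComplex z) ∈ Complex.slitPlane := by
    intro t ht
    apply Complex.mem_slitPlane_of_norm_lt_one
    rw [norm_neg, norm_div, div_lt_one (norm_pos_iff.2 hz0)]
    exact hz t ht
  refine ⟨fun t => Complex.log (-toComplex z) +
    Complex.log (1 + -(toComplex (lam t) / toComplex z)), ?_, fun t ht => ?_, ?_⟩
  · exact continuousOn_const.add (ContinuousOn.clog (continuousOn_const.add
      ((continuous_toComplex.comp_continuousOn hlam).div_const _).neg) hsl)
  · rw [Complex.exp_add, Complex.exp_log (neg_ne_zero.2 hz0),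
      Complex.exp_log (Complex.slitPlane_ne_zero (hsl t ht))]
    field_simp
    ring
  · simp [hloop]

/-- A continuous function that crosses the integers downwards only never crosses them upwards. -/
theorem lt_of_crossing_down {G : ℝ → ℝ} {T : ℝ} (hG : ContinuousOn G (Icc 0 T)) {k : ℤ}
    (h : ∀ t ∈ Icc 0 T, G t = k → ∀ᶠ s in 𝓝[<] t, (k : ℝ) < G s) {s t : ℝ} (hs : 0 ≤ s)
    (hst : s ≤ t) (ht : t ≤ T) (hGs : G s < k) : G t < k := by
  by_contra hcon
  push Not at hcon
  have hsub : Icc s t ⊆ Icc 0 T := Icc_subset_Icc hs ht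
  have hcl : IsClosed {u ∈ Icc s t | (k : ℝ) ≤ G u} :=
    (hG.mono hsub).preimage_isClosed_of_isClosed isClosed_Icc isClosed_Ici
  have hne : {u ∈ Icc s t | (k : ℝ) ≤ G u}.Nonempty := ⟨t, ⟨hst, le_rfl⟩, hcon⟩
  have hbdd : BddBelow {u ∈ Icc s t | (k : ℝ) ≤ G u} := ⟨s, fun u hu => hu.1.1⟩
  set m := sInf {u ∈ Icc s t | (k : ℝ) ≤ G u} with hm
  obtain ⟨hmI, hmk⟩ : m ∈ Icc s t ∧ (k : ℝ) ≤ G m := hcl.csInf_mem hne hbdd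
  have hlt : ∀ u, s ≤ u → u < m → G u < k := fun u hu hum => by
    by_contra hc
    exact not_le.2 hum (csInf_le hbdd ⟨⟨hu, hum.le.trans hmI.2⟩, not_lt.1 hc⟩)
  have hsm : s < m := lt_of_le_of_ne hmI.1 fun he => by
    rw [← he] at hmk
    linarith
  have hIoo : Ioo s m ∈ 𝓝[<] m := Ioo_mem_nhdsLT hsm
  have hle : G m ≤ k := by
    have h1 : Tendsto G (𝓝[<] m) (𝓝 (G m)) :=
      ((hG.mono hsub) m hmI).mono_left (nhdsWithin_le_of_mem
        (mem_of_superset hIoo fun u hu => ⟨hu.1.le, hu.2.le.trans hmI.2⟩))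
    exact le_of_tendsto h1 (mem_of_superset hIoo fun u hu => (hlt u hu.1.le hu.2).le)
  have hev := h m (hsub hmI) (le_antisymm hle hmk)
  obtain ⟨u, hu1, hu2⟩ := (hev.and hIoo).exists
  exact lt_asymm hu1 (hlt u hu2.1.le hu2.2)

/-- A closed curve that crosses the segment `[a, b]` in one direction only, and at least once, has
different winding numbers around its end points. -/
theorem HasWinding.ne_of_crossing {a b : Plane} {m n : ℤ}
    (ha : HasWinding lam T a m) (hb : HasWinding lam T b n)
    (hcross : ∀ t ∈ Icc 0 T, lam t ∈ segment ℝ a b → ∃ v : Plane, HasDerivAt lam v t ∧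
      0 < v.1 * (b - a).2 - v.2 * (b - a).1)
    {t₀ : ℝ} (ht₀ : t₀ ∈ Ioo 0 T) (hmem : lam t₀ ∈ segment ℝ a b) : m ≠ n := by
  obtain ⟨l, hl, he, hd⟩ := ha
  obtain ⟨l', hl', he', hd'⟩ := hb
  have hne : ∀ t ∈ Icc 0 T, toComplex (lam t) - toComplex b ≠ 0 := fun t ht =>
    he' t ht ▸ Complex.exp_ne_zero _
  have hne' : ∀ t ∈ Icc 0 T, toComplex (lam t) - toComplex a ≠ 0 := fun t ht =>
    he t ht ▸ Complex.exp_ne_zero _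
  -- `ell` is the signed distance to the line `ab`, up to a factor; it increases at each crossing of
  -- the segment.
  set ell : ℝ → ℝ := fun t => (lam t - a).1 * (b - a).2 - (lam t - a).2 * (b - a).1 with hell
  -- `θ` is a continuous argument of `(lam - a) / (lam - b)`, a negative real when `lam` is strictly
  -- between `a` and `b`. With `G = (θ - π) / 2π`, the loop is on the segment when `G` is an
  -- integer.
  set θ : ℝ → ℝ := fun t => (l t - l' t).im with hθ
  have hexp : ∀ t ∈ Icc 0 T, Complex.exp (l t - l' t) * (toComplex (lam t) - toComplex b) =
      toComplex (lam t) - toComplex a := fun t ht => by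
    rw [Complex.exp_sub, he t ht, he' t ht, div_mul_cancel₀ _ (hne t ht)]
  have hsin : ∀ t ∈ Icc 0 T, Real.exp (l t - l' t).re * Real.sin (θ t) *
      Complex.normSq (toComplex (lam t) - toComplex b) = ell t := fun t ht => by
    have h1 := congrArg Complex.re (hexp t ht)
    have h2 := congrArg Complex.im (hexp t ht)
    simp only [Complex.mul_re, Complex.mul_im, Complex.exp_re, Complex.exp_im] at h1 h2
    simp only [Complex.normSq_apply, hell, hθ]
    simp only [Complex.sub_re, Complex.sub_im, toComplex_re, toComplex_im, Prod.fst_sub,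
      Prod.snd_sub] at h1 h2 ⊢
    linear_combination ((lam t).1 - b.1) * h2 - ((lam t).2 - b.2) * h1
  have hnpos : ∀ t ∈ Icc 0 T, 0 < Complex.normSq (toComplex (lam t) - toComplex b) :=
    fun t ht => Complex.normSq_pos.2 (hne t ht)
  set G : ℝ → ℝ := fun t => (θ t - Real.pi) / (2 * Real.pi) with hGdef
  have hpi := Real.pi_pos
  have hGθ : ∀ t, θ t = 2 * Real.pi * G t + Real.pi := fun t => by
    simp only [hGdef]; field_simp; ring
  have hGc : ContinuousOn G (Icc 0 T) :=
    ((Complex.continuous_im.comp_continuousOn (hl.sub hl')).sub continuousOn_const).div_const _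
  have hsegiff : ∀ t ∈ Icc 0 T, ∀ k : ℤ, G t = k → lam t ∈ segment ℝ a b := by
    intro t ht k hk
    refine mem_segment_of_div_notMem_slitPlane (z := a) (z' := b)
      (sub_ne_zero.1 fun h => hne' t ht ?_) ?_
    · rw [sub_eq_zero.1 h, sub_self]
    · rw [← hexp t ht, div_mul_cancel_right₀ (hne t ht), ← Complex.exp_neg,
        Complex.mem_slitPlane_iff, not_or, not_lt, not_not]
      have h1 : θ t = Real.pi + k * (2 * Real.pi) := by rw [hGθ, hk]; ring
      rw [Complex.exp_re, Complex.exp_im, Complex.neg_im]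
      change Real.exp _ * Real.cos (-θ t) ≤ 0 ∧ Real.exp _ * Real.sin (-θ t) = 0
      rw [Real.cos_neg, Real.sin_neg, h1, Real.cos_add_int_mul_two_pi, Real.sin_add_int_mul_two_pi]
      simp [Real.exp_nonneg]
  have hsinG : ∀ t, ∀ k : ℤ, Real.sin (θ t) = - Real.sin (2 * Real.pi * (G t - k)) := by
    intro t k
    have : θ t = 2 * Real.pi * (G t - k) + Real.pi + k * (2 * Real.pi) := by rw [hGθ]; ring
    rw [this, Real.sin_add_int_mul_two_pi, Real.sin_add_pi]
  have hellzero : ∀ t, lam t ∈ segment ℝ a b → ell t = 0 := by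
    rintro t ⟨x, y, -, -, hxy, heq⟩
    simp only [hell, ← heq, Prod.fst_sub, Prod.snd_sub, Prod.fst_add, Prod.snd_add, Prod.smul_fst,
      Prod.smul_snd, smul_eq_mul]
    obtain rfl : x = 1 - y := by linarith
    ring
  -- `ell` passes from negative to positive values, and has the sign of `sin θ = -sin (2π (G - k))`;
  -- hence `G` crosses `k` downwards.
  have hloc : ∀ t ∈ Icc 0 T, ∀ k : ℤ, G t = k →
      (∀ᶠ s in 𝓝[<] t, s ∈ Icc 0 T → (k : ℝ) < G s) ∧
      (∀ᶠ s in 𝓝[>] t, s ∈ Icc 0 T → G s < k) := by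
    intro t ht k hk
    obtain ⟨v, hv, hpos⟩ := hcross t ht (hsegiff t ht k hk)
    have hz := hellzero t (hsegiff t ht k hk)
    have hder : HasDerivAt ell (v.1 * (b - a).2 - v.2 * (b - a).1) t := by
      have h1 : HasDerivAt (fun t => (lam t - a).1) v.1 t := (hv.sub_const a).fst
      have h2 : HasDerivAt (fun t => (lam t - a).2) v.2 t := (hv.sub_const a).snd
      exact (h1.mul_const _).sub (h2.mul_const _)
    have hslope := (hasDerivAt_iff_tendsto_slope.1 hder).eventually (lt_mem_nhds hpos)
    have hnear : ∀ᶠ s in 𝓝 t, s ∈ Icc 0 T → |G s - k| < 1 / 2 := by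
      have := (hGc t ht).eventually (Metric.ball_mem_nhds (G t) (by norm_num : (0 : ℝ) < 1 / 2))
      rw [eventually_nhdsWithin_iff] at this
      filter_upwards [this] with s hs hsI
      rw [← hk, ← Real.dist_eq]
      exact hs hsI
    constructor
    · filter_upwards [nhdsWithin_mono t (fun s (hs : s < t) => hs.ne) hslope,
        nhdsWithin_le_nhds hnear, self_mem_nhdsWithin] with s h1 h2 h3 hsI
      rw [slope_def_field, hz, sub_zero] at h1
      have hneg : ell s < 0 := by
        have : s - t < 0 := sub_neg.2 h3
        by_contra hc
        exact absurd h1 (not_lt.2 (div_nonpos_of_nonneg_of_nonpos (not_lt.1 hc) this.le))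
      rw [← hsin s hsI, hsinG s k] at hneg
      by_contra hc
      have h4 := abs_lt.1 (h2 hsI)
      have h5 : Real.sin (2 * Real.pi * (G s - k)) ≤ 0 :=
        Real.sin_nonpos_of_nonpos_of_neg_pi_le (by nlinarith) (by nlinarith)
      have : 0 ≤ Real.exp (l s - l' s).re * -Real.sin (2 * Real.pi * (G s - k)) *
        Complex.normSq (toComplex (lam s) - toComplex b) :=
        mul_nonneg (mul_nonneg (Real.exp_nonneg _) (by linarith)) (hnpos s hsI).le
      linarith
    · filter_upwards [nhdsWithin_mono t (fun s (hs : t < s) => hs.ne') hslope,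
        nhdsWithin_le_nhds hnear, self_mem_nhdsWithin] with s h1 h2 h3 hsI
      rw [slope_def_field, hz, sub_zero] at h1
      have hneg : 0 < ell s := by
        have : 0 < s - t := sub_pos.2 h3
        by_contra hc
        exact absurd h1 (not_lt.2 (div_nonpos_of_nonpos_of_nonneg (not_lt.1 hc) this.le))
      rw [← hsin s hsI, hsinG s k] at hneg
      by_contra hc
      have h4 := abs_lt.1 (h2 hsI)
      have h5 : 0 ≤ Real.sin (2 * Real.pi * (G s - k)) :=
        Real.sin_nonneg_of_nonneg_of_le_pi (by nlinarith) (by nlinarith)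
      have : 0 ≤ Real.exp (l s - l' s).re * Real.sin (2 * Real.pi * (G s - k)) *
        Complex.normSq (toComplex (lam s) - toComplex b) :=
        mul_nonneg (mul_nonneg (Real.exp_nonneg _) h5) (hnpos s hsI).le
      linarith
  have ht₀' : t₀ ∈ Icc 0 T := Ioo_subset_Icc_self ht₀
  -- On the segment `sin θ = 0`. The case `cos θ = 1` would make the quotient positive, which forces
  -- `a = b`, and a degenerate segment has no transversal crossing.
  obtain ⟨k, hk⟩ : ∃ k : ℤ, G t₀ = k := by
    have h0 := hsin t₀ ht₀'
    rw [hellzero t₀ hmem] at h0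
    have hs0 : Real.sin (θ t₀) = 0 := by
      rcases mul_eq_zero.1 h0 with h | h
      · exact (mul_eq_zero.1 h).resolve_left (Real.exp_ne_zero _)
      · exact absurd h (hnpos t₀ ht₀').ne'
    have hcos : Real.cos (θ t₀) = -1 := by
      rcases Real.sin_eq_zero_iff_cos_eq.1 hs0 with h | h
      · exfalso
        obtain ⟨x, y, hx, hy, hxy, heq⟩ := hmem
        have h1 := congrArg Complex.re (hexp t₀ ht₀')
        have h2 := congrArg Complex.im (hexp t₀ ht₀')
        simp only [Complex.mul_re, Complex.mul_im, Complex.exp_re, Complex.exp_im] at h1 h2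
        change Real.exp _ * Real.cos (θ t₀) * _ - Real.exp _ * Real.sin (θ t₀) * _ = _ at h1
        change Real.exp _ * Real.cos (θ t₀) * _ + Real.exp _ * Real.sin (θ t₀) * _ = _ at h2
        rw [hs0, h] at h1 h2
        simp only [Complex.sub_re, Complex.sub_im, toComplex_re, toComplex_im, ← heq,
          Prod.fst_add, Prod.snd_add, Prod.smul_fst, Prod.smul_snd, smul_eq_mul] at h1 h2
        obtain rfl : x = 1 - y := by linarith
        set E := Real.exp (l t₀ - l' t₀).re
        have hE : 0 < E := Real.exp_pos _
        have hpos : 0 < E * (1 - y) + y := by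
          rcases hx.eq_or_lt with h' | h'
          · rw [← h']; nlinarith
          · have := mul_pos hE h'; linarith
        have e1 : a.1 = b.1 := by
          have : (E * (1 - y) + y) * (a.1 - b.1) = 0 := by linear_combination h1
          linarith [(mul_eq_zero.1 this).resolve_left hpos.ne']
        have e2 : a.2 = b.2 := by
          have : (E * (1 - y) + y) * (a.2 - b.2) = 0 := by linear_combination h2
          linarith [(mul_eq_zero.1 this).resolve_left hpos.ne']
        have hab : a = b := Prod.ext e1 e2
        have := hcross t₀ ht₀' ⟨1 - y, y, hx, hy, hxy, heq⟩
        simp [hab] at this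
      · exact h
    obtain ⟨k, hk⟩ := Real.cos_eq_neg_one_iff.1 hcos
    refine ⟨k, ?_⟩
    simp only [hGdef, ← hk]
    field_simp
    ring
  have hdown : ∀ t ∈ Icc 0 T, G t = k → ∀ᶠ s in 𝓝[<] t, t = 0 ∨ (k : ℝ) < G s := by
    intro t ht htk
    rcases ht.1.eq_or_lt with h0 | h0
    · exact Eventually.of_forall fun _ => Or.inl h0.symm
    · filter_upwards [(hloc t ht k htk).1, Ioo_mem_nhdsLT h0] with s hs hs'
      exact Or.inr (hs ⟨hs'.1.le, hs'.2.le.trans ht.2⟩)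
  obtain ⟨s, hs1, hs2⟩ : ∃ s, s ∈ Ioo t₀ T ∧ G s < k := by
    obtain ⟨s, hs, hs'⟩ := ((hloc t₀ ht₀' k hk).2.and (Ioo_mem_nhdsGT ht₀.2)).exists
    exact ⟨s, hs', hs ⟨ht₀.1.le.trans hs'.1.le, hs'.2.le⟩⟩
  -- `lt_of_crossing_down` is applied after a shift by `u`, so that the origin, which has no left
  -- neighbourhood in the interval, is a time with `G < k` and never a crossing time.
  have key : ∀ u v, 0 ≤ u → u ≤ v → v ≤ T → G u < k → G v < k := by
    intro u v hu huv hv hGu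
    rcases huv.eq_or_lt with rfl | huv'
    · exact hGu
    have hsh := lt_of_crossing_down (G := fun t => G (t + u)) (T := T - u) (k := k)
      (hGc.comp (by fun_prop) fun t ht => ⟨by linarith [ht.1], by linarith [ht.2]⟩)
      (s := 0) (t := v - u) (fun t ht htk => ?_) le_rfl (by linarith) (by linarith)
      (by simpa using hGu)
    · simpa using hsh
    · have htI : t + u ∈ Icc 0 T := ⟨by linarith [ht.1], by linarith [ht.2]⟩
      have hpos : t + u ≠ 0 := fun h0 => by
        have h1 : t = 0 := by linarith [ht.1]
        have h2 : G (t + u) = k := htk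
        rw [h1, zero_add] at h2
        linarith
      have hmap : Tendsto (fun s => s + u) (𝓝[<] t) (𝓝[<] (t + u)) := by
        refine tendsto_nhdsWithin_iff.2 ⟨?_, ?_⟩
        · exact ((continuous_id.add continuous_const).tendsto t).mono_left nhdsWithin_le_nhds
        · filter_upwards [self_mem_nhdsWithin] with s hs
          exact add_lt_add_left (mem_Iio.1 hs) u
      exact (hmap.eventually (hdown _ htI htk)).mono fun s hs => hs.resolve_left hpos
  have hT0 : 0 ≤ T := ht₀.1.le.trans ht₀.2.le
  -- Thus `G T < k ≤ G 0`, whereas equal winding numbers would give `G T = G 0`.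
  have hGT : G T < k := key s T (ht₀.1.le.trans hs1.1.le) hs1.2.le le_rfl hs2
  have hG0 : k ≤ G 0 := by
    by_contra hc
    exact absurd hk (key 0 t₀ le_rfl ht₀.1.le ht₀.2.le (not_le.1 hc)).ne
  intro hmn
  subst hmn
  have : l T - l' T = l 0 - l' 0 := by linear_combination hd - hd'
  have : G T = G 0 := by simp only [hGdef, hθ, this]
  linarith

end

end PlanarODE
end

/-! ### Winding numbers and the fundamental group. -/

open Set Filter Topology

noncomputable section

namespace PlanarODE

section LogVariation

variable {A : Type*} [TopologicalSpace A]

theorem exists_log_path {u : A → ℂ} (hu : Continuous u) (h0 : ∀ a, u a ≠ 0) {x y : A}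
    (P : Path x y) (e : ℂ) (he : Complex.exp e = u x) :
    ∃ l : unitInterval → ℂ, Continuous l ∧ (∀ t, Complex.exp (l t) = u (P t)) ∧ l 0 = e := by
  have : ContractibleSpace unitInterval := (convex_Icc (0 : ℝ) 1).contractibleSpace ⟨0, by simp⟩
  have : LocallyPathConnectedSpace unitInterval := (convex_Icc (0 : ℝ) 1).locallyPathConnectedSpace
  obtain ⟨F, ⟨hF0, hF⟩, -⟩ := Complex.isCoveringMapOn_exp.existsUnique_continuousMap_lifts
    ⟨fun t => u (P t), hu.comp P.continuous⟩ (a₀ := (0 : unitInterval)) (e₀ := e)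
    (by simpa using he) (fun a => h0 _)
  exact ⟨F, F.continuous, fun t => congrFun hF t, hF0⟩

/-- The variation of `log u` along a homotopy class of paths. -/
def logVariation (u : A → ℂ) (hu : Continuous u) (h0 : ∀ a, u a ≠ 0) {x y : A}
    (γ : Path.Homotopic.Quotient x y) : ℂ :=
  (Complex.isCoveringMap_exp.monodromy
    (γ.map ⟨fun a => (⟨u a, h0 a⟩ : {z : ℂ // z ≠ 0}), by fun_prop⟩)
    ⟨Complex.log (u x), Subtype.ext (Complex.exp_log (h0 x))⟩).1 - Complex.log (u x)

variable {u : A → ℂ} {hu : Continuous u} {h0 : ∀ a, u a ≠ 0}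

/-- The monodromy lift that starts at the principal value is one logarithm along the path, and any
other differs from it by a constant. -/
theorem logVariation_mk {x y : A} (P : Path x y) {l : unitInterval → ℂ} (hl : Continuous l)
    (hexp : ∀ t, Complex.exp (l t) = u (P t)) :
    logVariation u hu h0 (Path.Homotopic.Quotient.mk P) = l 1 - l 0 := by
  obtain ⟨l', hl', hexp', h0'⟩ := exists_log_path hu h0 P (Complex.log (u x))
    (Complex.exp_log (h0 x))
  have h1 : logVariation u hu h0 (Path.Homotopic.Quotient.mk P) = l' 1 - l' 0 := by
    rw [h0', logVariation, ← Path.Homotopic.Quotient.mk_map]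
    congr 1
    have := (Complex.isCoveringMap_exp.eq_liftPath_iff'
      (γ := (⟨fun t => ⟨u (P t), h0 _⟩, by have := P.continuous; fun_prop⟩ :
        C(unitInterval, {z : ℂ // z ≠ 0})))
      (e := Complex.log (u x)) (γ_0 := Subtype.ext (by simp [Complex.exp_log (h0 x)]))
      (Γ := ⟨l', hl'⟩)).2 ⟨funext fun t => Subtype.ext (hexp' t), h0'⟩
    exact (congrArg (fun f : C(unitInterval, ℂ) => f 1) this).symm
  rw [h1]
  have := log_sub_eq isPreconnected_univ hl'.continuousOn hl.continuousOn
    (fun t _ => (hexp' t).trans (hexp t).symm) (mem_univ (1 : unitInterval)) (mem_univ 0)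
  linear_combination this

theorem logVariation_trans {x y z : A} (γ : Path.Homotopic.Quotient x y)
    (δ : Path.Homotopic.Quotient y z) :
    logVariation u hu h0 (γ.trans δ) = logVariation u hu h0 γ + logVariation u hu h0 δ := by
  induction γ using Path.Homotopic.Quotient.ind with | _ P =>
  induction δ using Path.Homotopic.Quotient.ind with | _ Q =>
  obtain ⟨l, hl, he, -⟩ := exists_log_path hu h0 P (Complex.log (u x)) (Complex.exp_log (h0 x))
  obtain ⟨m, hm, he', hm0⟩ := exists_log_path hu h0 Q (l 1) (by simp [he])
  let lP : Path (l 0) (l 1) := ⟨⟨l, hl⟩, rfl, rfl⟩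
  let mP : Path (l 1) (m 1) := ⟨⟨m, hm⟩, hm0, rfl⟩
  rw [← Path.Homotopic.Quotient.mk_trans, logVariation_mk P hl he, logVariation_mk Q hm he',
    logVariation_mk (P.trans Q) (l := lP.trans mP) (lP.trans mP).continuous, hm0]
  · simp
  · intro t
    rw [Path.trans_apply, Path.trans_apply]
    split_ifs
    · exact he _
    · exact he' _

theorem logVariation_refl (x : A) :
    logVariation u hu h0 (Path.Homotopic.Quotient.refl x) = 0 := by
  rw [← Path.Homotopic.Quotient.mk_refl, logVariation_mk (Path.refl x)
    (l := fun _ => Complex.log (u x)) continuous_const (fun t => by simp [Complex.exp_log (h0 x)])]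
  simp

theorem logVariation_symm {x y : A} (P : Path x y) :
    logVariation u hu h0 (Path.Homotopic.Quotient.mk P.symm) =
      -logVariation u hu h0 (Path.Homotopic.Quotient.mk P) := by
  obtain ⟨l, hl, he, -⟩ := exists_log_path hu h0 P (Complex.log (u x)) (Complex.exp_log (h0 x))
  rw [logVariation_mk P hl he, logVariation_mk P.symm (l := fun t => l (unitInterval.symm t))
    (by fun_prop) (fun t => he _)]
  simp

/-- The variation of `log u` as a homomorphism on the fundamental group. -/
def logVariationHom (u : A → ℂ) (hu : Continuous u) (h0 : ∀ a, u a ≠ 0) (x : A) :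
    FundamentalGroup A x →* Multiplicative ℂ where
  toFun γ := Multiplicative.ofAdd (logVariation u hu h0 (FundamentalGroup.toPath γ))
  map_one' := by
    rw [FundamentalGroup.one_def]
    exact congrArg Multiplicative.ofAdd (logVariation_refl x)
  map_mul' γ δ := by
    -- The target is commutative, so the order in which loops are composed is immaterial.
    rw [FundamentalGroup.mul_def, mul_comm]
    exact congrArg Multiplicative.ofAdd (logVariation_trans _ _)

end LogVariation

/-- The loop of the space `S` given by a closed curve. -/
def loopPath {S : Set Plane} (lam : ℝ → Plane) {T : ℝ} (hT : 0 ≤ T)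
    (hlam : ContinuousOn lam (Icc 0 T)) (hS : ∀ t ∈ Icc 0 T, lam t ∈ S) (hloop : lam T = lam 0) :
    Path (⟨lam 0, hS 0 ⟨le_rfl, hT⟩⟩ : S) ⟨lam 0, hS 0 ⟨le_rfl, hT⟩⟩ where
  toFun t := ⟨lam (t * T), hS _ ⟨mul_nonneg t.2.1 hT, mul_le_of_le_one_left hT t.2.2⟩⟩
  continuous_toFun := Continuous.subtype_mk (hlam.comp_continuous (by fun_prop)
    fun t => ⟨mul_nonneg t.2.1 hT, mul_le_of_le_one_left hT t.2.2⟩) _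
  source' := by simp
  target' := by simp [hloop]

section

variable {S : Set Plane} {lam : ℝ → Plane} {T : ℝ} {hT : 0 ≤ T}
  {hlam : ContinuousOn lam (Icc 0 T)} {hS : ∀ t ∈ Icc 0 T, lam t ∈ S} {hloop : lam T = lam 0}

theorem logVariation_loopPath {z : Plane} {n : ℤ} (h : HasWinding lam T z n)
    {hu : Continuous fun x : S => toComplex x - toComplex z}
    {h0 : ∀ x : S, toComplex x - toComplex z ≠ 0} :
    logVariation (fun x : S => toComplex x - toComplex z) hu h0
      (Path.Homotopic.Quotient.mk (loopPath lam hT hlam hS hloop)) =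
      n * (2 * Real.pi * Complex.I) := by
  obtain ⟨l, hl, he, hd⟩ := h
  have hmem : ∀ t : unitInterval, (t : ℝ) * T ∈ Icc 0 T := fun t =>
    ⟨mul_nonneg t.2.1 hT, mul_le_of_le_one_left hT t.2.2⟩
  rw [logVariation_mk _ (l := fun t => l (t * T)) (hl.comp_continuous (by fun_prop) hmem)
    (fun t => he _ (hmem t))]
  simpa using hd

/-- For `z` outside `S`, `x - z` does not vanish on `S`, and its logarithm has no variation along a
null-homotopic loop. -/
theorem hasWinding_zero_of_isSimplyConnected (hsc : IsSimplyConnected S) (hT : 0 ≤ T)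
    (hlam : ContinuousOn lam (Icc 0 T)) (hS : ∀ t ∈ Icc 0 T, lam t ∈ S) (hloop : lam T = lam 0)
    {z : Plane} (hz : z ∉ S) {n : ℤ} (h : HasWinding lam T z n) : n = 0 := by
  have := hsc.simplyConnectedSpace
  have hu : Continuous fun x : S => toComplex x - toComplex z :=
    (continuous_toComplex.comp continuous_subtype_val).sub continuous_const
  have h0 : ∀ x : S, toComplex x - toComplex z ≠ 0 := fun x =>
    toComplex_sub_ne_zero fun hx => hz (hx ▸ x.2)
  have h1 := logVariation_loopPath (hT := hT) (hlam := hlam) (hS := hS) (hloop := hloop) h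
    (hu := hu) (h0 := h0)
  have h2 : Path.Homotopic.Quotient.mk (loopPath lam hT hlam hS hloop) =
      Path.Homotopic.Quotient.refl _ := by
    rw [← Path.Homotopic.Quotient.mk_refl]
    exact Path.Homotopic.Quotient.eq.2 (SimplyConnectedSpace.paths_homotopic _ _)
  rw [h2, logVariation_refl] at h1
  apply two_pi_I_mul_cancel
  rw [← h1]
  simp

/-- If the loops are `p` and `q` in `π₁(S) ≅ ℤ`, then `α ^ q * β ^ (-p) = 1`. Winding around any
outside point is a homomorphism on `π₁(S)`, so the same relation holds for all these points at once.
-/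
theorem exists_winding_relation (hone : IsOneConnected S) {lam' : ℝ → Plane} {T' : ℝ}
    (hT : 0 ≤ T) (hlam : ContinuousOn lam (Icc 0 T)) (hS : ∀ t ∈ Icc 0 T, lam t ∈ S)
    (hloop : lam T = lam 0) (hT' : 0 ≤ T') (hlam' : ContinuousOn lam' (Icc 0 T'))
    (hS' : ∀ t ∈ Icc 0 T', lam' t ∈ S) (hloop' : lam' T' = lam' 0) :
    ∃ a b : ℤ, (a ≠ 0 ∨ b ≠ 0) ∧ ∀ z ∉ S, ∀ m n, HasWinding lam T z m → HasWinding lam' T' z n →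
      a * m + b * n = 0 := by
  obtain ⟨hpc, hg⟩ := hone
  have := isPathConnected_iff_pathConnectedSpace.1 hpc
  set x : S := ⟨lam 0, hS 0 ⟨le_rfl, hT⟩⟩ with hx
  set y : S := ⟨lam' 0, hS' 0 ⟨le_rfl, hT'⟩⟩ with hy
  obtain ⟨e⟩ := hg x
  let P := loopPath lam hT hlam hS hloop
  let Q := loopPath lam' hT' hlam' hS' hloop'
  let R : Path x y := PathConnectedSpace.somePath x y
  let α : FundamentalGroup S x := FundamentalGroup.fromPath (Path.Homotopic.Quotient.mk P)
  -- The second loop is brought to the base point of the first along `R`, whose two contributions to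
  -- the variation cancel.
  let β : FundamentalGroup S x := FundamentalGroup.fromPath
    ((Path.Homotopic.Quotient.mk R).trans ((Path.Homotopic.Quotient.mk Q).trans
      (Path.Homotopic.Quotient.mk R.symm)))
  have key : ∀ z ∉ S, ∀ m n, HasWinding lam T z m → HasWinding lam' T' z n → ∀ i j : ℤ,
      α ^ i * β ^ j = 1 → i * m + j * n = 0 := by
    intro z hz m n hm hn i j hij
    have hu : Continuous fun x : S => toComplex x - toComplex z :=
      (continuous_toComplex.comp continuous_subtype_val).sub continuous_const
    have h0 : ∀ x : S, toComplex x - toComplex z ≠ 0 := fun x =>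
      toComplex_sub_ne_zero fun hx => hz (hx ▸ x.2)
    have h1 := congrArg (logVariationHom _ hu h0 x) hij
    have hα : logVariationHom _ hu h0 x α =
        Multiplicative.ofAdd (m * (2 * Real.pi * Complex.I) : ℂ) :=
      congrArg Multiplicative.ofAdd (logVariation_loopPath hm)
    have hβ : logVariationHom _ hu h0 x β =
        Multiplicative.ofAdd (n * (2 * Real.pi * Complex.I) : ℂ) := by
      refine congrArg Multiplicative.ofAdd ?_
      change logVariation _ hu h0 ((Path.Homotopic.Quotient.mk R).trans
        ((Path.Homotopic.Quotient.mk Q).trans (Path.Homotopic.Quotient.mk R.symm))) = _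
      rw [logVariation_trans, logVariation_trans, logVariation_symm, logVariation_loopPath hn]
      ring
    rw [map_mul, map_zpow, map_zpow, map_one, hα, hβ, ← ofAdd_zsmul, ← ofAdd_zsmul, ← ofAdd_add,
      ← ofAdd_zero] at h1
    have h2 := Multiplicative.ofAdd.injective h1
    simp only [zsmul_eq_mul] at h2
    apply two_pi_I_mul_cancel
    push_cast
    linear_combination h2
  set p : ℤ := Multiplicative.toAdd (e α) with hp
  set q : ℤ := Multiplicative.toAdd (e β) with hq
  have hrel : ∀ i j : ℤ, i * p + j * q = 0 → α ^ i * β ^ j = 1 := by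
    intro i j hij
    apply e.injective
    rw [map_mul, map_zpow, map_zpow, map_one]
    apply Multiplicative.toAdd.injective
    rw [toAdd_mul, toAdd_zpow, toAdd_zpow, toAdd_one]
    simpa using hij
  -- When both classes are trivial, `(q, -p)` is no relation, but `(1, 0)` is one.
  by_cases hpq : p = 0 ∧ q = 0
  · exact ⟨1, 0, Or.inl one_ne_zero, fun z hz m n hm hn =>
      key z hz m n hm hn 1 0 (hrel 1 0 (by simp [hpq.1]))⟩
  · refine ⟨q, -p, ?_, fun z hz m n hm hn => key z hz m n hm hn q (-p) (hrel _ _ (by ring))⟩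
    rw [not_and_or] at hpq
    rcases hpq with h | h
    · exact Or.inr (neg_ne_zero.2 h)
    · exact Or.inl h

end

end PlanarODE
end

/-! ### The flux estimate, by integration by parts against a Lipschitz cut-off. -/

open Set Filter Topology

noncomputable section

namespace PlanarODE

open MeasureTheory Metric

/-- The indicator function of `D`, cut off linearly near `A` and near `N`. -/
def cutoff (D A N : Set Plane) (r ε : ℝ) : Plane → ℝ :=
  D.indicator fun z => min (min 1 (infDist z A / r)) (infDist z N / ε)

theorem exists_mem_segment_frontier {D : Set Plane} (hD : IsOpen D) {z w : Plane} (hz : z ∈ D)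
    (hw : w ∉ D) : ∃ y ∈ segment ℝ z w, y ∈ frontier D := by
  by_contra! hcon
  have hpre : IsPreconnected (segment ℝ z w) := (convex_segment z w).isPreconnected
  have := hpre.subset_left_of_subset_union hD isClosed_closure.isOpen_compl
    (disjoint_compl_right_iff_subset.2 subset_closure) (fun y hy => by
      by_cases hyD : y ∈ D
      · exact Or.inl hyD
      · refine Or.inr fun hyc => hcon y hy ?_
        rw [hD.frontier_eq]
        exact ⟨hyc, hyD⟩) ⟨z, left_mem_segment ℝ z w, hz⟩
  exact hw (this (right_mem_segment ℝ z w))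

section

variable {D A N : Set Plane} {r ε : ℝ}

theorem cutoff_nonneg (hr : 0 < r) (hε : 0 < ε) (z : Plane) : 0 ≤ cutoff D A N r ε z := by
  refine indicator_nonneg (fun z _ => ?_) z
  exact le_min (le_min zero_le_one (div_nonneg infDist_nonneg hr.le))
    (div_nonneg infDist_nonneg hε.le)

theorem cutoff_le (hr : 0 < r) (hε : 0 < ε) (z : Plane) :
    cutoff D A N r ε z ≤ min (min 1 (infDist z A / r)) (infDist z N / ε) :=
  indicator_le_self' (fun _ _ => le_min (le_min zero_le_one (div_nonneg infDist_nonneg hr.le))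
    (div_nonneg infDist_nonneg hε.le)) z

/-- The indicator creates no jump: a segment leaving `D` meets its frontier, contained in `A ∪ N`,
where the linear cut-offs vanish. -/
theorem cutoff_lipschitz (hD : IsOpen D) (hfr : frontier D ⊆ A ∪ N) (hr : 0 < r) (hε : 0 < ε) :
    ∃ C, LipschitzWith C (cutoff D A N r ε) := by
  set g : Plane → ℝ := fun z => min (min 1 (infDist z A / r)) (infDist z N / ε) with hg
  have hg0 : ∀ z, 0 ≤ g z := fun z => le_min (le_min zero_le_one (div_nonneg infDist_nonneg hr.le))
    (div_nonneg infDist_nonneg hε.le)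
  have hgl : ∀ z w, g z ≤ g w + (1 / r + 1 / ε) * dist z w := by
    intro z w
    rw [← sub_le_iff_le_add]
    have hd : 0 ≤ dist z w := dist_nonneg
    have h1 : infDist z A / r ≤ infDist w A / r + 1 / r * dist z w := by
      rw [one_div_mul_eq_div, ← add_div]
      exact div_le_div_of_nonneg_right infDist_le_infDist_add_dist hr.le
    have h2 : infDist z N / ε ≤ infDist w N / ε + 1 / ε * dist z w := by
      rw [one_div_mul_eq_div, ← add_div]
      exact div_le_div_of_nonneg_right infDist_le_infDist_add_dist hε.le
    have h3 : 0 ≤ 1 / r * dist z w := by positivity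
    have h4 : 0 ≤ 1 / ε * dist z w := by positivity
    have g1 : g z ≤ 1 := (min_le_left _ _).trans (min_le_left _ _)
    have g2 : g z ≤ infDist z A / r := (min_le_left _ _).trans (min_le_right _ _)
    have g3 : g z ≤ infDist z N / ε := min_le_right _ _
    refine le_min (le_min ?_ ?_) ?_ <;> linarith
  have hfr0 : ∀ y ∈ frontier D, g y = 0 := by
    intro y hy
    refine le_antisymm ?_ (hg0 y)
    rcases hfr hy with h | h
    · exact (min_le_left _ _).trans ((min_le_right _ _).trans (by simp [infDist_zero_of_mem h]))
    · exact (min_le_right _ _).trans (by simp [infDist_zero_of_mem h])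
  refine ⟨Real.toNNReal (1 / r + 1 / ε), LipschitzWith.of_le_add_mul' _ fun z w => ?_⟩
  have hK : 0 ≤ (1 / r + 1 / ε) * dist z w := by positivity
  by_cases hz : z ∈ D
  · rw [cutoff, indicator_of_mem hz]
    by_cases hw : w ∈ D
    · rw [indicator_of_mem hw]
      exact hgl z w
    · rw [indicator_of_notMem hw, zero_add]
      obtain ⟨y, hy, hyf⟩ := exists_mem_segment_frontier hD hz hw
      have h1 := hgl z y
      rw [hfr0 y hyf, zero_add] at h1
      refine h1.trans (mul_le_mul_of_nonneg_left ?_ (by positivity))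
      linarith [dist_add_dist_of_mem_segment hy, dist_nonneg (x := y) (y := w)]
  · have hz0 : cutoff D A N r ε z = 0 := indicator_of_notMem hz _
    linarith [cutoff_nonneg (D := D) (A := A) (N := N) hr hε w]

/-- An upper bound for `t` of both signs bounds the derivative on both sides, and for a minimum of
functions upper bounds are the easy ones. -/
theorem abs_fderiv_le_of_eventually_le {h : Plane → ℝ} {z v : Plane} (hd : DifferentiableAt ℝ h z)
    {c : ℝ} (hle : ∀ η > 0, ∀ᶠ t : ℝ in 𝓝 0, h (z + t • v) ≤ h z + (c + η) * |t|) :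
    |fderiv ℝ h z v| ≤ c := by
  have hder : HasDerivAt (fun t : ℝ => h (z + t • v)) (fderiv ℝ h z v) 0 :=
    hd.hasFDerivAt.hasLineDerivAt v
  have hsl := hasDerivAt_iff_tendsto_slope.1 hder
  have hsr : Tendsto (slope (fun t : ℝ => h (z + t • v)) 0) (𝓝[>] 0) (𝓝 (fderiv ℝ h z v)) :=
    hsl.mono_left (nhdsWithin_mono _ fun s (hs : 0 < s) => hs.ne')
  have hslf : Tendsto (slope (fun t : ℝ => h (z + t • v)) 0) (𝓝[<] 0) (𝓝 (fderiv ℝ h z v)) :=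
    hsl.mono_left (nhdsWithin_mono _ fun s (hs : s < 0) => hs.ne)
  refine le_of_forall_pos_le_add fun η hη => abs_le.2 ⟨?_, ?_⟩
  · refine ge_of_tendsto hslf ?_
    filter_upwards [nhdsWithin_le_nhds (hle η hη), self_mem_nhdsWithin] with t ht ht0
    have ht0' : t < 0 := ht0
    rw [slope_def_field, sub_zero, zero_smul, add_zero, le_div_iff_of_neg ht0']
    rw [abs_of_neg ht0'] at ht
    linarith
  · refine le_of_tendsto hsr ?_
    filter_upwards [nhdsWithin_le_nhds (hle η hη), self_mem_nhdsWithin] with t ht ht0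
    have ht0' : 0 < t := ht0
    rw [slope_def_field, sub_zero, zero_smul, add_zero, div_le_iff₀ ht0']
    rw [abs_of_pos ht0'] at ht
    linarith

/-- Comparing the motion of `z` with the solution through its nearest point in `A` shows that the
distance to `A` changes at rate at most `L` times itself. In the layer of width `r`, after division
by `r`, the bound is `L`: it does not blow up as `r → 0`. Near `N` the trivial bound `‖X‖ / ε` is
kept. -/
theorem abs_fderiv_cutoff_le {X : Plane → Plane} {L : NNReal} (hX : LipschitzWith L X)
    (hA : IsCompact A) (hAne : A.Nonempty)
    (hsol : ∀ y ∈ A, y ∉ N → ∃ σ : ℝ → Plane, σ 0 = y ∧ HasDerivAt σ (X y) 0 ∧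
      ∀ᶠ t in 𝓝 0, σ t ∈ A)
    (hr : 0 < r) (hrε : r < ε) {z : Plane} (hd : DifferentiableAt ℝ (cutoff D A N r ε) z) :
    |fderiv ℝ (cutoff D A N r ε) z (X z)| ≤
      (D ∩ cthickening r A).indicator (fun _ => (L : ℝ)) z +
      (D ∩ {z | infDist z N ≤ ε}).indicator (fun z => ‖X z‖ / ε) z := by
  have hε : 0 < ε := hr.trans hrε
  set h := cutoff D A N r ε with hh
  have hrhs1 : 0 ≤ (D ∩ cthickening r A).indicator (fun _ => (L : ℝ)) z :=
    indicator_nonneg (fun _ _ => L.2) z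
  have hrhs2 : 0 ≤ (D ∩ {z | infDist z N ≤ ε}).indicator (fun z => ‖X z‖ / ε) z :=
    indicator_nonneg (fun _ _ => by positivity) z
  have hmin : h z = 0 → fderiv ℝ h z = 0 := fun h0 =>
    IsLocalMin.fderiv_eq_zero (Eventually.of_forall fun w => h0 ▸ cutoff_nonneg hr hε w)
  by_cases hz0 : h z = 0
  · rw [hmin hz0]
    simpa using add_nonneg hrhs1 hrhs2
  have hzD : z ∈ D := by
    by_contra hzD
    exact hz0 (indicator_of_notMem hzD _)
  have hhz : h z = min (min 1 (infDist z A / r)) (infDist z N / ε) := indicator_of_mem hzD _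
  have hle := fun w => cutoff_le (D := D) (A := A) (N := N) hr hε w
  rcases min_choice (min 1 (infDist z A / r)) (infDist z N / ε) with hm | hm
  · rcases min_choice 1 (infDist z A / r) with hm' | hm'
    · have h1 : h z = 1 := by rw [hhz, hm, hm']
      have : fderiv ℝ h z = 0 := IsLocalMax.fderiv_eq_zero (Eventually.of_forall fun w => by
        rw [h1]
        exact (hle w).trans ((min_le_left _ _).trans (min_le_left _ _)))
      rw [this]
      simpa using add_nonneg hrhs1 hrhs2
    · have h1 : h z = infDist z A / r := by rw [hhz, hm, hm']
      have h1' : infDist z A / r ≤ 1 := by rw [← hm']; exact min_le_left _ _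
      have hdr : infDist z A ≤ r := by rwa [div_le_one hr] at h1'
      obtain ⟨y, hyA, hy⟩ := hA.exists_infDist_eq_dist hAne z
      -- If the nearest point were in `N`, then `r < ε` would make the cut-off near `N` strictly the
      -- smaller one.
      have hyN : y ∉ N := by
        intro hyN
        have h2 : infDist z N ≤ infDist z A := hy ▸ infDist_le_dist_of_mem hyN
        have h3 : infDist z A / r ≤ infDist z N / ε := by
          rw [← hm', ← hm]; exact min_le_right _ _
        have h4 : 0 < infDist z A := by
          rcases (infDist_nonneg (x := z) (s := A)).eq_or_lt with h | h
          · exact absurd (by rw [h1, ← h, zero_div]) hz0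
          · exact h
        have h5 : infDist z N / ε ≤ infDist z A / ε := by gcongr
        have h6 : infDist z A / ε < infDist z A / r := div_lt_div_of_pos_left h4 hr hrε
        linarith
      obtain ⟨σ, hσ0, hσ, hσA⟩ := hsol y hyA hyN
      have hzth : z ∈ D ∩ cthickening r A :=
        ⟨hzD, mem_cthickening_of_dist_le z y r A hyA (hy ▸ hdr)⟩
      rw [indicator_of_mem hzth]
      suffices |fderiv ℝ h z (X z)| ≤ L by linarith
      refine abs_fderiv_le_of_eventually_le hd fun η hη => ?_
      have ho : ∀ᶠ t in 𝓝 (0 : ℝ), ‖σ t - y - t • X y‖ ≤ (η * r) * |t| := by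
        have := (hasDerivAt_iff_isLittleO.1 hσ).def (mul_pos hη hr)
        filter_upwards [this] with t ht
        simpa [hσ0] using ht
      filter_upwards [ho, hσA] with t ht htA
      have e1 : infDist (z + t • X z) A ≤ infDist z A + L * infDist z A * |t| + (η * r) * |t| := by
        calc infDist (z + t • X z) A ≤ dist (z + t • X z) (σ t) := infDist_le_dist_of_mem htA
          _ = ‖(z - y) + t • (X z - X y) - (σ t - y - t • X y)‖ := by
              rw [dist_eq_norm]; congr 1; rw [smul_sub]; abel
          _ ≤ ‖z - y‖ + |t| * ‖X z - X y‖ + ‖σ t - y - t • X y‖ := by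
              refine (norm_sub_le _ _).trans (add_le_add_left ((norm_add_le _ _).trans ?_) _)
              rw [norm_smul, Real.norm_eq_abs]
          _ ≤ _ := by
              have hLz : ‖X z - X y‖ ≤ L * ‖z - y‖ := hX.norm_sub_le z y
              rw [hy, dist_eq_norm]
              nlinarith [abs_nonneg t]
      calc h (z + t • X z) ≤ infDist (z + t • X z) A / r :=
            (hle _).trans ((min_le_left _ _).trans (min_le_right _ _))
        _ ≤ (infDist z A + L * infDist z A * |t| + (η * r) * |t|) / r := by gcongr
        _ = infDist z A / r + (L * (infDist z A / r) + η) * |t| := by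
            field_simp
            ring
        _ ≤ h z + (L + η) * |t| := by
            rw [h1]
            have : (L : ℝ) * (infDist z A / r) ≤ L * 1 := by gcongr
            nlinarith [abs_nonneg t]
  · have h1 : h z = infDist z N / ε := by rw [hhz, hm]
    have h1' : infDist z N ≤ ε := by
      rw [← div_le_one hε, ← hm]
      exact (min_le_left _ _).trans (min_le_left _ _)
    rw [indicator_of_mem (s := D ∩ {z | infDist z N ≤ ε}) ⟨hzD, h1'⟩]
    suffices |fderiv ℝ h z (X z)| ≤ ‖X z‖ / ε by linarith
    refine abs_fderiv_le_of_eventually_le hd fun η hη => Eventually.of_forall fun t => ?_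
    have e1 : infDist (z + t • X z) N ≤ infDist z N + |t| * ‖X z‖ := by
      refine (infDist_le_infDist_add_dist (y := z)).trans_eq ?_
      rw [dist_eq_norm, add_sub_cancel_left, norm_smul, Real.norm_eq_abs]
    calc h (z + t • X z) ≤ infDist (z + t • X z) N / ε := (hle _).trans (min_le_right _ _)
      _ ≤ (infDist z N + |t| * ‖X z‖) / ε := by gcongr
      _ = infDist z N / ε + (‖X z‖ / ε) * |t| := by field_simp
      _ ≤ h z + (‖X z‖ / ε + η) * |t| := by
          rw [h1]
          nlinarith [abs_nonneg t]

end

theorem integrable_mul_of_hasCompactSupport {f g : Plane → ℝ} (hf : Continuous f)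
    (hfc : HasCompactSupport f) (hg : Continuous g) : Integrable fun z => f z * g z :=
  (hf.mul hg).integrable_of_hasCompactSupport (HasCompactSupport.mul_right (f := f) (f' := g) hfc)

theorem continuous_divergence {Y : Plane → Plane} (hY : ContDiff ℝ 1 Y) :
    Continuous (divergence Y) := by
  have h := hY.continuous_fderiv one_ne_zero
  have h1 : Continuous fun z => fderiv ℝ Y z ((1 : ℝ), (0 : ℝ)) := h.clm_apply continuous_const
  have h2 : Continuous fun z => fderiv ℝ Y z ((0 : ℝ), (1 : ℝ)) := h.clm_apply continuous_const
  exact h1.fst.add h2.snd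

theorem hasCompactSupport_fderiv_comp {Y : Plane → Plane} (hYc : HasCompactSupport Y)
    {g : (Plane →L[ℝ] Plane) → ℝ} (hg : g 0 = 0) :
    HasCompactSupport fun z => g (fderiv ℝ Y z) :=
  (hYc.fderiv ℝ).mono fun z hz h0 => hz (by simp only [h0, hg])

theorem hasCompactSupport_divergence {Y : Plane → Plane} (hYc : HasCompactSupport Y) :
    HasCompactSupport (divergence Y) :=
  hasCompactSupport_fderiv_comp hYc (g := fun f => (f (1, 0)).1 + (f (0, 1)).2) (by simp)

/-- Integration by parts of a `C¹` compactly supported vector field against a Lipschitz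
function. -/
theorem integral_divergence_mul {Y : Plane → Plane} (hY : ContDiff ℝ 1 Y)
    (hYc : HasCompactSupport Y) {h : Plane → ℝ} {C : NNReal} (hh : LipschitzWith C h) :
    Integrable (fun z => fderiv ℝ h z (Y z)) ∧
    ∫ z, divergence Y z * h z = ∫ z, -fderiv ℝ h z (Y z) := by
  have hY1 : ContDiff ℝ 1 fun z => (Y z).1 := hY.fst
  have hY2 : ContDiff ℝ 1 fun z => (Y z).2 := hY.snd
  have hc1 : HasCompactSupport fun z => (Y z).1 := hYc.comp_left (g := Prod.fst) rfl
  have hc2 : HasCompactSupport fun z => (Y z).2 := hYc.comp_left (g := Prod.snd) rfl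
  obtain ⟨L1, hL1⟩ := ContDiff.lipschitzWith_of_hasCompactSupport (𝕂 := ℝ) hc1 hY1 one_ne_zero
  obtain ⟨L2, hL2⟩ := ContDiff.lipschitzWith_of_hasCompactSupport (𝕂 := ℝ) hc2 hY2 one_ne_zero
  have hd : ∀ z, HasFDerivAt Y (fderiv ℝ Y z) z := fun z =>
    (hY.differentiable one_ne_zero z).hasFDerivAt
  have hld1 : ∀ z, lineDeriv ℝ (fun z => (Y z).1) z (-(1, 0)) = -(fderiv ℝ Y z (1, 0)).1 := by
    intro z
    rw [((hd z).fst.hasLineDerivAt _).lineDeriv, map_neg]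
    rfl
  have hld2 : ∀ z, lineDeriv ℝ (fun z => (Y z).2) z (-(0, 1)) = -(fderiv ℝ Y z (0, 1)).2 := by
    intro z
    rw [((hd z).snd.hasLineDerivAt _).lineDeriv, map_neg]
    rfl
  have i1 := hh.integral_lineDeriv_mul_eq (μ := volume) hL1 hc1 (1, 0)
  have i2 := hh.integral_lineDeriv_mul_eq (μ := volume) hL2 hc2 (0, 1)
  simp only [hld1, hld2] at i1 i2
  have hDc : Continuous fun z => fderiv ℝ Y z := hY.continuous_fderiv one_ne_zero
  have h1 : Continuous fun z => fderiv ℝ Y z ((1 : ℝ), (0 : ℝ)) := hDc.clm_apply continuous_const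
  have h2 : Continuous fun z => fderiv ℝ Y z ((0 : ℝ), (1 : ℝ)) := hDc.clm_apply continuous_const
  have int1 : Integrable fun z => -(fderiv ℝ Y z (1, 0)).1 * h z :=
    integrable_mul_of_hasCompactSupport h1.fst.neg
      (hasCompactSupport_fderiv_comp hYc (g := fun f => -(f (1, 0)).1) (by simp)) hh.continuous
  have int2 : Integrable fun z => -(fderiv ℝ Y z (0, 1)).2 * h z :=
    integrable_mul_of_hasCompactSupport h2.snd.neg
      (hasCompactSupport_fderiv_comp hYc (g := fun f => -(f (0, 1)).2) (by simp)) hh.continuous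
  have bd : ∀ v : Plane, ∀ᵐ z, ‖lineDeriv ℝ h z v‖ ≤ C * ‖v‖ := fun v =>
    Eventually.of_forall fun z => norm_lineDeriv_le_of_lipschitz ℝ hh
  have int3 : Integrable fun z => lineDeriv ℝ h z (1, 0) * (Y z).1 :=
    (hY1.continuous.integrable_of_hasCompactSupport hc1).bdd_mul
      (aestronglyMeasurable_lineDeriv hh.continuous _) (bd _)
  have int4 : Integrable fun z => lineDeriv ℝ h z (0, 1) * (Y z).2 :=
    (hY2.continuous.integrable_of_hasCompactSupport hc2).bdd_mul
      (aestronglyMeasurable_lineDeriv hh.continuous _) (bd _)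
  have hae : (fun z => lineDeriv ℝ h z (1, 0) * (Y z).1 + lineDeriv ℝ h z (0, 1) * (Y z).2)
      =ᵐ[volume] fun z => fderiv ℝ h z (Y z) := by
    filter_upwards [hh.ae_differentiableAt] with z hz
    rw [hz.lineDeriv_eq_fderiv, hz.lineDeriv_eq_fderiv]
    have : Y z = (Y z).1 • ((1, 0) : Plane) + (Y z).2 • ((0, 1) : Plane) := by ext <;> simp
    conv_rhs => rw [this]
    rw [map_add, map_smul, map_smul, smul_eq_mul, smul_eq_mul]
    ring
  refine ⟨(int3.add int4).congr hae, ?_⟩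
  rw [integral_neg, ← integral_congr_ae hae, integral_add int3 int4, i1, i2, ← integral_add int1 int2,
    ← integral_neg]
  congr 1
  ext z
  simp only [divergence]
  ring

/-- The cut-off is `1` on `R` and nonnegative on `D`, so the integral over `R` is at most that of
`div (B X)` times the cut-off. Integration by parts moves the derivative to the cut-off, where
`abs_fderiv_cutoff_le` applies. -/
theorem flux_bound_cutoff {S : Set Plane} (hS : IsOpen S) {X : Plane → Plane} {B : Plane → ℝ}
    (hX : ContDiffOn ℝ 1 X S) (hB : ContDiffOn ℝ 1 B S) {D A N K : Set Plane} (hK : IsCompact K)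
    (hKS : K ⊆ S) (hDK : D ⊆ K) (hAK : A ⊆ K) (hDo : IsOpen D) (hfr : frontier D ⊆ A ∪ N)
    (hA : IsCompact A) (hAne : A.Nonempty) (hNne : N.Nonempty) (hN : IsCompact N)
    (hsol : ∀ y ∈ A, y ∉ N → ∃ σ : ℝ → Plane, σ 0 = y ∧ HasDerivAt σ (X y) 0 ∧
      ∀ᶠ t in 𝓝 0, σ t ∈ A) {ε : ℝ}
    (hdiv : ∀ z ∈ D, 0 ≤ divergence (fun z => B z • X z) z) {R : Set Plane}
    (hRm : MeasurableSet R) (hRD : R ⊆ D) (hRN : ∀ z ∈ R, ε ≤ infDist z N)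
    {C : ℝ} (hC0 : 0 ≤ C) (hC : ∀ z ∈ D, infDist z N ≤ ε → |B z| * ‖X z‖ ≤ C) :
    ∃ b : ℝ, ∀ r, 0 < r → r < ε → (∀ z ∈ R, r ≤ infDist z A) →
      ∫ z in R, divergence (fun z => B z • X z) z ≤
        b * volume.real (cthickening r A) + C / ε * volume.real (cthickening ε N) := by
  -- `Y` extends `B X` and serves in the integration by parts; the extension `X'` of `X` provides a
  -- global Lipschitz constant.
  obtain ⟨Y, O, hO, hKO, -, hYO, hY, hYc⟩ := exists_compactly_supported_extension hS hK hKS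
    (hB.smul hX)
  obtain ⟨X', O', hO', hKO', -, hXO', hX', hXc'⟩ :=
    exists_compactly_supported_extension hS hK hKS hX
  obtain ⟨L, hL⟩ := ContDiff.lipschitzWith_of_hasCompactSupport (𝕂 := ℝ) hXc' hX' one_ne_zero
  obtain ⟨b, hb⟩ := hK.exists_bound_of_continuousOn (hB.continuousOn.mono hKS)
  have hb0 : 0 ≤ b := by
    obtain ⟨y, hy⟩ := hAne
    exact (norm_nonneg _).trans (hb y (hAK hy))
  -- The constant does not depend on `r`, so that `r → 0` removes the contribution of the null set
  -- `A`.
  refine ⟨b * L, fun r hr hrε hRA => ?_⟩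
  have hε : 0 < ε := hr.trans hrε
  obtain ⟨Lh, hLh⟩ := cutoff_lipschitz hDo hfr hr hε
  obtain ⟨hint, hparts⟩ := integral_divergence_mul hY hYc hLh
  set h := cutoff D A N r ε with hh
  have hdivY : ∀ z ∈ D, divergence Y z = divergence (fun z => B z • X z) z := fun z hz => by
    have : Y =ᶠ[𝓝 z] fun z => B z • X z := by
      filter_upwards [hO.mem_nhds (hKO (hDK hz))] with w hw
      exact hYO hw
    simp only [divergence, this.fderiv_eq]
  have hint1 : Integrable fun z => divergence Y z * h z :=
    integrable_mul_of_hasCompactSupport (continuous_divergence hY)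
      (hasCompactSupport_divergence hYc) hLh.continuous
  have step1 : ∫ z in R, divergence (fun z => B z • X z) z ≤ ∫ z, divergence Y z * h z := by
    have e1 : ∫ z in R, divergence (fun z => B z • X z) z = ∫ z in R, divergence Y z * h z := by
      refine setIntegral_congr_fun hRm fun z hz => ?_
      have h1 : h z = 1 := by
        rw [hh, cutoff, indicator_of_mem (hRD hz)]
        have a1 : 1 ≤ infDist z A / r := (one_le_div hr).2 (hRA z hz)
        have a2 : 1 ≤ infDist z N / ε := (one_le_div hε).2 (hRN z hz)
        rw [min_eq_left a1, min_eq_left a2]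
      simp only [h1, mul_one, hdivY z (hRD hz)]
    rw [e1]
    refine setIntegral_le_integral hint1 (Eventually.of_forall fun z => ?_)
    by_cases hz : z ∈ D
    · exact mul_nonneg (hdivY z hz ▸ hdiv z hz) (cutoff_nonneg hr hε z)
    · have hz0 : h z = 0 := indicator_of_notMem hz _
      simp [hz0]
  have hcompA : IsCompact (cthickening r A) := hA.cthickening
  have hcompN : IsCompact (cthickening ε N) := hN.cthickening
  have hsolX' : ∀ y ∈ A, y ∉ N → ∃ σ : ℝ → Plane, σ 0 = y ∧ HasDerivAt σ (X' y) 0 ∧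
      ∀ᶠ t in 𝓝 0, σ t ∈ A := fun y hy hyN => by
    rw [hXO' (hKO' (hAK hy))]
    exact hsol y hy hyN
  have hmem : ∀ z, infDist z N ≤ ε → z ∈ cthickening ε N := fun z hz => by
    obtain ⟨y, hy, hyd⟩ := hN.exists_infDist_eq_dist hNne z
    exact mem_cthickening_of_dist_le z y ε N hy (hyd ▸ hz)
  have step2 : ∫ z, -fderiv ℝ h z (Y z) ≤ ∫ z, ((cthickening r A).indicator (fun _ => b * L) z +
      (cthickening ε N).indicator (fun _ => C / ε) z) := by
    have i1 : Integrable ((cthickening r A).indicator (fun _ : Plane => b * (L : ℝ))) :=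
      (integrable_indicator_iff hcompA.isClosed.measurableSet).2
        (integrableOn_const hcompA.measure_lt_top.ne)
    have i2 : Integrable ((cthickening ε N).indicator (fun _ : Plane => C / ε)) :=
      (integrable_indicator_iff hcompN.isClosed.measurableSet).2
        (integrableOn_const hcompN.measure_lt_top.ne)
    refine integral_mono_ae hint.neg (i1.add i2) ?_
    filter_upwards [hLh.ae_differentiableAt] with z hz
    have n1 : 0 ≤ (cthickening r A).indicator (fun _ => b * (L : ℝ)) z :=
      indicator_nonneg (fun _ _ => mul_nonneg hb0 L.2) z
    have n2 : 0 ≤ (cthickening ε N).indicator (fun _ => C / ε) z :=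
      indicator_nonneg (fun _ _ => by positivity) z
    by_cases hzD : z ∈ D
    · have hYz : Y z = B z • X' z := by
        rw [hYO (hKO (hDK hzD)), hXO' (hKO' (hDK hzD)), Pi.smul_apply']
      have hbz : |B z| ≤ b := hb z (hDK hzD)
      have key := abs_fderiv_cutoff_le (D := D) hL hA hAne hsolX' hr hrε hz
      calc -fderiv ℝ h z (Y z) ≤ |B z| * |fderiv ℝ h z (X' z)| := by
            rw [hYz, map_smul, smul_eq_mul, ← abs_mul]
            exact neg_le_abs _
        _ ≤ |B z| * ((D ∩ cthickening r A).indicator (fun _ => (L : ℝ)) z +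
            (D ∩ {z | infDist z N ≤ ε}).indicator (fun z => ‖X' z‖ / ε) z) := by gcongr
        _ ≤ _ := by
            rw [mul_add]
            refine add_le_add ?_ ?_
            · by_cases hzA : z ∈ cthickening r A
              · rw [indicator_of_mem (mem_inter hzD hzA), indicator_of_mem hzA]
                gcongr
              · rw [indicator_of_notMem fun h => hzA h.2, mul_zero]
                exact n1
            · by_cases hzN : infDist z N ≤ ε
              · rw [indicator_of_mem (show z ∈ D ∩ {z | infDist z N ≤ ε} from ⟨hzD, hzN⟩),
                  indicator_of_mem (hmem z hzN), ← mul_div_assoc]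
                rw [hXO' (hKO' (hDK hzD))]
                gcongr
                exact hC z hzD hzN
              · rw [indicator_of_notMem fun h => hzN h.2, mul_zero]
                exact n2
    · have hz0 : h z = 0 := indicator_of_notMem hzD _
      have : fderiv ℝ h z = 0 :=
        IsLocalMin.fderiv_eq_zero (Eventually.of_forall fun w => hz0 ▸ cutoff_nonneg hr hε w)
      simp only [this]
      simpa using add_nonneg n1 n2
  have i1 : Integrable ((cthickening r A).indicator (fun _ : Plane => b * (L : ℝ))) :=
    (integrable_indicator_iff hcompA.isClosed.measurableSet).2
      (integrableOn_const hcompA.measure_lt_top.ne)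
  have i2 : Integrable ((cthickening ε N).indicator (fun _ : Plane => C / ε)) :=
    (integrable_indicator_iff hcompN.isClosed.measurableSet).2
      (integrableOn_const hcompN.measure_lt_top.ne)
  refine (step1.trans (hparts.le.trans step2)).trans_eq ?_
  rw [integral_add i1 i2, integral_indicator_const _ hcompA.isClosed.measurableSet,
    integral_indicator_const _ hcompN.isClosed.measurableSet]
  simp only [smul_eq_mul]
  ring

/-- **Dulac's estimate.** Let `D` be a domain whose boundary consists of arcs of solutions (in `A`)
and of a part of a small set `N`. If `div (B X) ≥ 0` in `D`, then the integral of `div (B X)` away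
from the boundary is bounded by a flux through `N`. -/
theorem flux_bound {S : Set Plane} (hS : IsOpen S) {X : Plane → Plane} {B : Plane → ℝ}
    (hX : ContDiffOn ℝ 1 X S) (hB : ContDiffOn ℝ 1 B S) {D A N K : Set Plane} (hK : IsCompact K)
    (hKS : K ⊆ S) (hDK : D ⊆ K) (hAK : A ⊆ K) (hDo : IsOpen D) (hfr : frontier D ⊆ A ∪ N)
    (hA : IsCompact A) (hA0 : volume A = 0) (hAne : A.Nonempty) (hN : IsCompact N)
    (hNne : N.Nonempty)
    (hsol : ∀ y ∈ A, y ∉ N → ∃ σ : ℝ → Plane, σ 0 = y ∧ HasDerivAt σ (X y) 0 ∧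
      ∀ᶠ t in 𝓝 0, σ t ∈ A) {ε : ℝ} (hε : 0 < ε)
    (hdiv : ∀ z ∈ D, 0 ≤ divergence (fun z => B z • X z) z) {R : Set Plane}
    (hRm : MeasurableSet R) (hRD : R ⊆ D) {r₀ : ℝ} (hr₀ : 0 < r₀)
    (hRA : ∀ z ∈ R, r₀ ≤ infDist z A) (hRN : ∀ z ∈ R, ε ≤ infDist z N)
    {C : ℝ} (hC0 : 0 ≤ C) (hC : ∀ z ∈ D, infDist z N ≤ ε → |B z| * ‖X z‖ ≤ C) :
    ∫ z in R, divergence (fun z => B z • X z) z ≤ C / ε * volume.real (cthickening ε N) := by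
  obtain ⟨b, hb⟩ := flux_bound_cutoff hS hX hB hK hKS hDK hAK hDo hfr hA hAne hNne hN hsol hdiv hRm
    hRD hRN hC0 hC
  have h0 : Tendsto (fun r => volume.real (cthickening r A)) (𝓝[>] 0) (𝓝 0) := by
    have h1 := (tendsto_measure_cthickening_of_isCompact (μ := volume) hA).mono_left
      (nhdsWithin_le_nhds (s := Ioi 0))
    rw [hA0] at h1
    exact (ENNReal.tendsto_toReal ENNReal.zero_ne_top).comp h1
  have h2 := (h0.const_mul b).add_const (C / ε * volume.real (cthickening ε N))
  rw [mul_zero, zero_add] at h2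
  refine ge_of_tendsto h2 ?_
  filter_upwards [Ioo_mem_nhdsGT (lt_min hε hr₀)] with r hr
  exact hb r hr.1 (hr.2.trans_le (min_le_left _ _))
    fun z hz => (hr.2.trans_le (min_le_right _ _)).le.trans (hRA z hz)

end PlanarODE
end

/-! ### Transversal segments at a regular point. -/

open Set Filter Topology

noncomputable section

namespace PlanarODE

open MeasureTheory Metric

/-- The dot product of the plane. -/
def dot (z w : Plane) : ℝ := z.1 * w.1 + z.2 * w.2

/-- The cross product of the plane. -/
def cross (z w : Plane) : ℝ := z.1 * w.2 - z.2 * w.1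

theorem dot_self_pos {v : Plane} (hv : v ≠ 0) : 0 < dot v v := by
  by_contra h
  apply hv
  have h1 : v.1 = 0 := by unfold dot at h; nlinarith [sq_nonneg v.1, sq_nonneg v.2]
  have h2 : v.2 = 0 := by unfold dot at h; nlinarith [sq_nonneg v.1, sq_nonneg v.2]
  exact Prod.ext h1 h2

theorem abs_fst_le_norm (z : Plane) : |z.1| ≤ ‖z‖ := norm_fst_le z

theorem abs_snd_le_norm (z : Plane) : |z.2| ≤ ‖z‖ := norm_snd_le z

theorem abs_dot_le (z w : Plane) : |dot z w| ≤ 2 * (‖z‖ * ‖w‖) := by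
  have h1 : |z.1 * w.1| ≤ ‖z‖ * ‖w‖ := by
    rw [abs_mul]
    exact mul_le_mul (norm_fst_le z) (norm_fst_le w) (abs_nonneg _) (norm_nonneg _)
  have h2 : |z.2 * w.2| ≤ ‖z‖ * ‖w‖ := by
    rw [abs_mul]
    exact mul_le_mul (norm_snd_le z) (norm_snd_le w) (abs_nonneg _) (norm_nonneg _)
  unfold dot
  linarith [abs_add_le (z.1 * w.1) (z.2 * w.2)]

theorem abs_cross_le (z w : Plane) : |cross z w| ≤ 2 * (‖z‖ * ‖w‖) := by
  have h1 : |z.1 * w.2| ≤ ‖z‖ * ‖w‖ := by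
    rw [abs_mul]
    exact mul_le_mul (norm_fst_le z) (norm_snd_le w) (abs_nonneg _) (norm_nonneg _)
  have h2 : |z.2 * w.1| ≤ ‖z‖ * ‖w‖ := by
    rw [abs_mul]
    exact mul_le_mul (norm_snd_le z) (norm_fst_le w) (abs_nonneg _) (norm_nonneg _)
  unfold cross
  linarith [abs_sub (z.1 * w.2) (z.2 * w.1)]

theorem continuous_dot (w : Plane) : Continuous fun z => dot z w := by unfold dot; fun_prop

theorem continuous_cross (w : Plane) : Continuous fun z => cross z w := by unfold cross; fun_prop

/-- Expansion of `z` in the orthogonal basis formed by `v` and its rotation. -/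
theorem norm_mul_dot_self_le (z v : Plane) :
    ‖z‖ * dot v v ≤ (|dot z v| + |cross z v|) * ‖v‖ := by
  have e1 : z.1 * dot v v = dot z v * v.1 + cross z v * v.2 := by unfold dot cross; ring
  have e2 : z.2 * dot v v = dot z v * v.2 - cross z v * v.1 := by unfold dot cross; ring
  have h0 : 0 ≤ dot v v := by unfold dot; nlinarith [sq_nonneg v.1, sq_nonneg v.2]
  have a1 := abs_fst_le_norm v
  have a2 := abs_snd_le_norm v
  have b1 := abs_nonneg (dot z v)
  have b2 := abs_nonneg (cross z v)
  rw [Prod.norm_def, max_mul_of_nonneg _ _ h0]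
  refine max_le ?_ ?_
  · calc ‖z.1‖ * dot v v = |z.1 * dot v v| := by rw [abs_mul, abs_of_nonneg h0]; rfl
      _ ≤ |dot z v * v.1| + |cross z v * v.2| := by rw [e1]; exact abs_add_le _ _
      _ ≤ |dot z v| * ‖v‖ + |cross z v| * ‖v‖ := by
          rw [abs_mul, abs_mul]
          gcongr
      _ = _ := by ring
  · calc ‖z.2‖ * dot v v = |z.2 * dot v v| := by rw [abs_mul, abs_of_nonneg h0]; rfl
      _ ≤ |dot z v * v.2| + |cross z v * v.1| := by rw [e2]; exact abs_sub _ _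
      _ ≤ |dot z v| * ‖v‖ + |cross z v| * ‖v‖ := by
          rw [abs_mul, abs_mul]
          gcongr
      _ = _ := by ring

/-- In `A` the velocity lies in the cone `|cross| ≤ dot` around `v`, so `dot ± cross` are both
nondecreasing along the arc. Until the arc reaches the line `dot = 0`, its `cross` coordinate stays
within `2θ`; so it reaches the line before it can leave `A`. -/
theorem exists_forward_crossing {σ σ' : ℝ → Plane} {v p' : Plane} {t₁ τ θ : ℝ} {A : Set Plane}
    (hA : IsOpen A) (ht₁ : t₁ ≤ τ) (hσ : ∀ t ∈ Icc t₁ τ, HasDerivAt σ (σ' t) t)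
    (hin : ∀ t ∈ Icc t₁ τ, σ t ∈ A → |cross (σ' t) v| ≤ dot (σ' t) v) (hout : σ τ ∉ A)
    (ha0 : dot (σ t₁ - p') v ≤ 0) (ha : -θ ≤ dot (σ t₁ - p') v) (hb : |cross (σ t₁ - p') v| ≤ θ)
    (hsmall : ∀ z, |dot (z - p') v| ≤ θ → |cross (z - p') v| ≤ 2 * θ → z ∈ A) :
    ∃ t ∈ Icc t₁ τ, dot (σ t - p') v = 0 ∧ |cross (σ t - p') v| ≤ 2 * θ := by
  have hcont : ContinuousOn σ (Icc t₁ τ) := fun t ht => (hσ t ht).continuousAt.continuousWithinAt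
  have hac : ContinuousOn (fun t => dot (σ t - p') v) (Icc t₁ τ) :=
    (continuous_dot v).comp_continuousOn (hcont.sub continuousOn_const)
  have hbc : ContinuousOn (fun t => cross (σ t - p') v) (Icc t₁ τ) :=
    (continuous_cross v).comp_continuousOn (hcont.sub continuousOn_const)
  -- The first time `e` at which the arc is on or past the line, or outside `A`.
  set E := {t ∈ Icc t₁ τ | 0 ≤ dot (σ t - p') v} ∪ {t ∈ Icc t₁ τ | σ t ∈ Aᶜ} with hE
  have hEc : IsClosed E := (hac.preimage_isClosed_of_isClosed isClosed_Icc isClosed_Ici).union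
    (hcont.preimage_isClosed_of_isClosed isClosed_Icc hA.isClosed_compl)
  have hEsub : E ⊆ Icc t₁ τ := union_subset (fun t ht => ht.1) fun t ht => ht.1
  have hEbd : BddBelow E := bddBelow_Icc.mono hEsub
  have heE : sInf E ∈ E := hEc.csInf_mem ⟨τ, Or.inr ⟨⟨ht₁, le_rfl⟩, hout⟩⟩ hEbd
  set e := sInf E with he
  have heI := hEsub heE
  have hbefore : ∀ t ∈ Ico t₁ e, dot (σ t - p') v < 0 ∧ σ t ∈ A := by
    intro t ht
    have hti : t ∈ Icc t₁ τ := ⟨ht.1, ht.2.le.trans heI.2⟩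
    have hnot : t ∉ E := fun h => not_le.2 ht.2 (csInf_le hEbd h)
    constructor
    · by_contra h
      exact hnot (Or.inl ⟨hti, not_lt.1 h⟩)
    · by_contra h
      exact hnot (Or.inr ⟨hti, h⟩)
  have hsubI : Icc t₁ e ⊆ Icc t₁ τ := Icc_subset_Icc_right heI.2
  have hda : ∀ t ∈ Icc t₁ τ, HasDerivAt (fun t => dot (σ t - p') v) (dot (σ' t) v) t := by
    intro t ht
    have h := (hσ t ht).sub_const p'
    have h1 : HasDerivAt (fun t => (σ t - p').1) (σ' t).1 t := h.fst
    have h2 : HasDerivAt (fun t => (σ t - p').2) (σ' t).2 t := h.snd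
    exact (h1.mul_const _).add (h2.mul_const _)
  have hdb : ∀ t ∈ Icc t₁ τ, HasDerivAt (fun t => cross (σ t - p') v) (cross (σ' t) v) t := by
    intro t ht
    have h := (hσ t ht).sub_const p'
    have h1 : HasDerivAt (fun t => (σ t - p').1) (σ' t).1 t := h.fst
    have h2 : HasDerivAt (fun t => (σ t - p').2) (σ' t).2 t := h.snd
    exact (h1.mul_const _).sub (h2.mul_const _)
  have hm1 : MonotoneOn (fun t => dot (σ t - p') v + cross (σ t - p') v) (Icc t₁ e) := by
    refine monotoneOn_of_hasDerivWithinAt_nonneg (f' := fun t => dot (σ' t) v + cross (σ' t) v)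
      (convex_Icc _ _) ((hac.add hbc).mono hsubI) ?_ ?_
    · intro t ht
      rw [interior_Icc] at ht
      exact ((hda t (hsubI (Ioo_subset_Icc_self ht))).add
        (hdb t (hsubI (Ioo_subset_Icc_self ht)))).hasDerivWithinAt
    · intro t ht
      rw [interior_Icc] at ht
      have := hin t (hsubI (Ioo_subset_Icc_self ht)) (hbefore t (Ioo_subset_Ico_self ht)).2
      linarith [neg_abs_le (cross (σ' t) v)]
  have hm2 : MonotoneOn (fun t => dot (σ t - p') v - cross (σ t - p') v) (Icc t₁ e) := by
    refine monotoneOn_of_hasDerivWithinAt_nonneg (f' := fun t => dot (σ' t) v - cross (σ' t) v)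
      (convex_Icc _ _) ((hac.sub hbc).mono hsubI) ?_ ?_
    · intro t ht
      rw [interior_Icc] at ht
      exact ((hda t (hsubI (Ioo_subset_Icc_self ht))).sub
        (hdb t (hsubI (Ioo_subset_Icc_self ht)))).hasDerivWithinAt
    · intro t ht
      rw [interior_Icc] at ht
      have := hin t (hsubI (Ioo_subset_Icc_self ht)) (hbefore t (Ioo_subset_Ico_self ht)).2
      linarith [le_abs_self (cross (σ' t) v)]
  have i1 := hm1 ⟨le_rfl, heI.1⟩ ⟨heI.1, le_rfl⟩ heI.1
  have i2 := hm2 ⟨le_rfl, heI.1⟩ ⟨heI.1, le_rfl⟩ heI.1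
  simp only at i1 i2
  have hle : dot (σ e - p') v ≤ 0 := by
    rcases heI.1.eq_or_lt with h | h
    · rw [← h]; exact ha0
    · have := (hda e heI).continuousAt.tendsto.mono_left (nhdsWithin_le_nhds (s := Iio e))
      refine le_of_tendsto this ?_
      filter_upwards [Ioo_mem_nhdsLT h] with t ht
      exact (hbefore t (Ioo_subset_Ico_self ht)).1.le
  obtain ⟨hb1, hb2⟩ := abs_le.1 hb
  have hbe : |cross (σ e - p') v| ≤ 2 * θ := abs_le.2 ⟨by linarith, by linarith⟩
  have heA : σ e ∈ A := hsmall _ (abs_le.2 ⟨by linarith, by linarith⟩) hbe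
  refine ⟨e, heI, ?_, hbe⟩
  rcases heE with h | h
  · exact le_antisymm hle h.2
  · exact absurd heA h.2

/-- An arc that is already past the line is followed backwards in time, with `-v` in place of `v`.
-/
theorem exists_crossing {X : Plane → Plane} {σ : ℝ → Plane} {v p' : Plane} {τ θ : ℝ} {A : Set Plane}
    (hA : IsOpen A) (hσ : ∀ t ∈ Icc 0 τ, HasDerivAt σ (X (σ t)) t)
    (hin : ∀ z ∈ A, |cross (X z) v| ≤ dot (X z) v) (h0 : σ 0 ∉ A) (hτ : σ τ ∉ A)
    {t₁ : ℝ} (ht₁ : t₁ ∈ Icc 0 τ) (ha : |dot (σ t₁ - p') v| ≤ θ) (hb : |cross (σ t₁ - p') v| ≤ θ)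
    (hsmall : ∀ z, |dot (z - p') v| ≤ θ → |cross (z - p') v| ≤ 2 * θ → z ∈ A) :
    ∃ t ∈ Icc 0 τ, dot (σ t - p') v = 0 ∧ |cross (σ t - p') v| ≤ 2 * θ := by
  rcases le_total (dot (σ t₁ - p') v) 0 with hs | hs
  · obtain ⟨t, ht, h⟩ := exists_forward_crossing hA ht₁.2
      (fun t ht => hσ t ⟨ht₁.1.trans ht.1, ht.2⟩) (fun t _ h => hin _ h) hτ hs (abs_le.1 ha).1 hb
      hsmall
    exact ⟨t, ⟨ht₁.1.trans ht.1, ht.2⟩, h⟩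
  · have hneg : ∀ z : Plane, dot z (-v) = -dot z v := fun z => by
      simp only [dot, Prod.fst_neg, Prod.snd_neg]; ring
    have hneg' : ∀ z : Plane, cross z (-v) = -cross z v := fun z => by
      simp only [cross, Prod.fst_neg, Prod.snd_neg]; ring
    have hnd : ∀ z w : Plane, dot (-z) w = -dot z w := fun z w => by
      simp only [dot, Prod.fst_neg, Prod.snd_neg]; ring
    have hnc : ∀ z w : Plane, cross (-z) w = -cross z w := fun z w => by
      simp only [cross, Prod.fst_neg, Prod.snd_neg]; ring
    obtain ⟨t, ht, h⟩ := exists_forward_crossing (σ := fun t => σ (-t)) (σ' := fun t => -X (σ (-t)))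
      (v := -v) (p' := p') (t₁ := -t₁) (τ := 0) (θ := θ) hA (neg_nonpos.2 ht₁.1)
      (fun t ht => ((hσ (-t) ⟨by linarith [ht.2], by linarith [ht.1, ht₁.2]⟩).scomp t
        (hasDerivAt_neg t)).congr_deriv (by simp))
      (fun t _ h => by simpa only [hnd, hnc, hneg, hneg', neg_neg] using hin _ h)
      (by simpa using h0) (by simpa [hneg] using hs)
      (by simpa [hneg] using (abs_le.1 ha).2) (by simpa [hneg'] using hb)
      fun z h1 h2 => hsmall z (by simpa [hneg] using h1) (by simpa [hneg'] using h2)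
    refine ⟨-t, ⟨by linarith [ht.2], by linarith [ht.1, ht₁.2]⟩, ?_, ?_⟩
    · simpa [hneg] using h.1
    · simpa [hneg'] using h.2

/-- Orbit arcs passing near a regular point `p` cross a transversal segment near `p` whose end
points avoid a given closed null set. -/
theorem exists_transversal_segment {X : Plane → Plane} {p : Plane} (hX : ContinuousAt X p)
    (hp : X p ≠ 0) {Γ : Set Plane} (hΓ : IsClosed Γ) (hΓ0 : volume Γ = 0) {r₀ : ℝ}
    (hr₀ : 0 < r₀) :
    ∃ a b : Plane, ∃ ρ > 0, ∃ δ > 0, closedBall a ρ ⊆ ball p r₀ ∧ closedBall b ρ ⊆ ball p r₀ ∧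
      (∀ z ∈ closedBall a ρ ∪ closedBall b ρ, ∀ w ∈ Γ, ρ ≤ dist z w) ∧
      (∀ z ∈ segment ℝ a b, 0 < cross (X z) (b - a)) ∧
      ∀ (σ : ℝ → Plane) (τ : ℝ), (∀ t ∈ Icc 0 τ, HasDerivAt σ (X (σ t)) t) → σ 0 ∉ ball p r₀ →
        σ τ ∉ ball p r₀ → (∃ t ∈ Icc 0 τ, dist (σ t) p < δ) →
        ∃ t ∈ Ioo 0 τ, σ t ∈ segment ℝ a b := by
  set v := X p with hv
  set N := dot v v with hN
  have hNpos : 0 < N := dot_self_pos hp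
  have hvpos : 0 < ‖v‖ := norm_pos_iff.2 hp
  obtain ⟨r, hr, hrr₀, hrX⟩ : ∃ r > 0, r ≤ r₀ ∧ ∀ z ∈ ball p r, |cross (X z) v| ≤ dot (X z) v ∧
      0 < dot (X z) v := by
    have hc : Tendsto (fun z => dot (X z) v - |cross (X z) v|) (𝓝 p) (𝓝 (N - |cross v v|)) :=
      (((continuous_dot v).continuousAt.comp hX).sub
        ((continuous_cross v).continuousAt.comp hX).abs).tendsto
    have hcvv : cross v v = 0 := by unfold cross; ring
    rw [hcvv, abs_zero, sub_zero] at hc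
    obtain ⟨r, hr, h⟩ := Metric.eventually_nhds_iff_ball.1 (hc.eventually (lt_mem_nhds hNpos))
    refine ⟨min r r₀, lt_min hr hr₀, min_le_right _ _, fun z hz => ?_⟩
    have := h z (ball_subset_ball (min_le_left _ _) hz)
    exact ⟨by linarith, by linarith [abs_nonneg (cross (X z) v)]⟩
  -- The transversal is centred at some `p'` near `p`, with direction `n` normal to `X p` and
  -- half-length `s ‖n‖ = r / 4`.
  set n : Plane := (-v.2, v.1) with hn
  have hnn : ‖n‖ = ‖v‖ := by
    rw [Prod.norm_def, Prod.norm_def, hn]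
    simp only [norm_neg]
    exact max_comm _ _
  set s := r / (4 * ‖v‖) with hs
  have hspos : 0 < s := by positivity
  have hsn : ‖s • n‖ = r / 4 := by
    rw [norm_smul, hnn, Real.norm_of_nonneg hspos.le, hs]
    field_simp
  -- The first bound makes the crossing occur within the segment, the second keeps the crossing box
  -- inside `ball p r`. The radius `d` then ensures that arcs within `d` of `p` enter the box.
  set θ := min (s * N / 2) (r * N / (8 * ‖v‖)) with hθ
  have hθpos : 0 < θ := by positivity
  set d := min (r / 4) (θ / (4 * ‖v‖)) with hd
  have hdpos : 0 < d := by positivity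
  -- Two translates of a null set cannot cover a ball, so a slight displacement of the centre takes
  -- both ends of the transversal off `Γ`.
  obtain ⟨p', hp'd, hp'1, hp'2⟩ : ∃ p' ∈ ball p d, p' - s • n ∉ Γ ∧ p' + s • n ∉ Γ := by
    have h1 : volume ((fun z => z - s • n) ⁻¹' Γ ∪ (fun z => z + s • n) ⁻¹' Γ) = 0 := by
      refine measure_union_null ?_ ?_
      · simp only [sub_eq_add_neg]
        rw [measure_preimage_add_right, hΓ0]
      · rw [measure_preimage_add_right, hΓ0]
    by_contra! hcon
    have h2 : ball p d ⊆ (fun z => z - s • n) ⁻¹' Γ ∪ (fun z => z + s • n) ⁻¹' Γ := by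
      intro z hz
      by_cases h : z - s • n ∈ Γ
      · exact Or.inl h
      · exact Or.inr (hcon z hz h)
    exact absurd (measure_mono_null h2 h1) (measure_ball_pos volume p hdpos).ne'
  set a := p' - s • n with ha
  set b := p' + s • n with hb
  have hp'r : dist p' p < r / 4 := hp'd.trans_le (min_le_left _ _)
  have hba : b - a = (2 * s) • n := by rw [ha, hb, two_mul, add_smul]; abel
  have hcrossn : ∀ z : Plane, cross z (b - a) = 2 * s * dot z v := fun z => by
    rw [hba]
    simp only [cross, dot, hn, Prod.smul_fst, Prod.smul_snd, smul_eq_mul]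
    ring
  have haball : a ∈ ball p r := by
    rw [mem_ball]
    calc dist a p ≤ dist a p' + dist p' p := dist_triangle _ _ _
      _ < r / 4 + r / 4 := by
          refine add_lt_add_of_le_of_lt ?_ hp'r
          rw [ha, dist_eq_norm, sub_sub_cancel_left, norm_neg, hsn]
      _ ≤ r := by linarith
  have hbball : b ∈ ball p r := by
    rw [mem_ball]
    calc dist b p ≤ dist b p' + dist p' p := dist_triangle _ _ _
      _ < r / 4 + r / 4 := by
          refine add_lt_add_of_le_of_lt ?_ hp'r
          rw [hb, dist_eq_norm, add_sub_cancel_left, hsn]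
      _ ≤ r := by linarith
  have hsub : ball p r ⊆ ball p r₀ := ball_subset_ball hrr₀
  obtain ⟨ρ₁, hρ₁, hρ₁a⟩ := Metric.mem_nhds_iff.1 ((isOpen_ball.inter hΓ.isOpen_compl).mem_nhds
    ⟨haball, hp'1⟩)
  obtain ⟨ρ₂, hρ₂, hρ₂b⟩ := Metric.mem_nhds_iff.1 ((isOpen_ball.inter hΓ.isOpen_compl).mem_nhds
    ⟨hbball, hp'2⟩)
  have hmin : 0 < min ρ₁ ρ₂ := lt_min hρ₁ hρ₂
  refine ⟨a, b, min ρ₁ ρ₂ / 2, half_pos hmin, d, hdpos, ?_, ?_, ?_, ?_, ?_⟩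
  · exact fun z hz => hsub (hρ₁a ((mem_closedBall.1 hz).trans_lt
      ((half_lt_self hmin).trans_le (min_le_left _ _)))).1
  · exact fun z hz => hsub (hρ₂b ((mem_closedBall.1 hz).trans_lt
      ((half_lt_self hmin).trans_le (min_le_right _ _)))).1
  · rintro z (hz | hz) w hw
    · by_contra! hlt
      refine (hρ₁a (a := w) ?_).2 hw
      rw [mem_ball]
      calc dist w a ≤ dist z w + dist z a := dist_triangle_left _ _ _
        _ < min ρ₁ ρ₂ / 2 + min ρ₁ ρ₂ / 2 := add_lt_add_of_lt_of_le hlt hz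
        _ ≤ ρ₁ := by rw [add_halves]; exact min_le_left _ _
    · by_contra! hlt
      refine (hρ₂b (a := w) ?_).2 hw
      rw [mem_ball]
      calc dist w b ≤ dist z w + dist z b := dist_triangle_left _ _ _
        _ < min ρ₁ ρ₂ / 2 + min ρ₁ ρ₂ / 2 := add_lt_add_of_lt_of_le hlt hz
        _ ≤ ρ₂ := by rw [add_halves]; exact min_le_right _ _
  · intro z hz
    rw [hcrossn]
    have := (hrX z ((convex_ball p r).segment_subset haball hbball hz)).2
    positivity
  · intro σ τ hσ h0 hτ ht
    obtain ⟨t₁, ht₁, hd₁⟩ := ht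
    have hdist : ‖σ t₁ - p'‖ ≤ 2 * d := by
      rw [← dist_eq_norm]
      linarith [dist_triangle_right (σ t₁) p' p, mem_ball.1 hp'd]
    have hbound : 2 * (‖σ t₁ - p'‖ * ‖v‖) ≤ θ := by
      calc 2 * (‖σ t₁ - p'‖ * ‖v‖) ≤ 2 * (2 * (θ / (4 * ‖v‖)) * ‖v‖) := by
            gcongr
            exact hdist.trans (by gcongr; exact min_le_right _ _)
        _ = θ := by field_simp; norm_num
    obtain ⟨t, ht, e1, e2⟩ := exists_crossing (X := X) (p' := p') (θ := θ) (v := v)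
      (A := ball p r) isOpen_ball hσ
      (fun z hz => (hrX z hz).1) (fun h => h0 (hsub h)) (fun h => hτ (hsub h)) ht₁
      ((abs_dot_le _ _).trans hbound) ((abs_cross_le _ _).trans hbound) (fun z h1 h2 => by
        have h3 := norm_mul_dot_self_le (z - p') v
        have h4 : ‖z - p'‖ * N ≤ (3 * θ) * ‖v‖ := h3.trans (by gcongr; linarith)
        have h5 : θ * ‖v‖ ≤ r * N / 8 := by
          calc θ * ‖v‖ ≤ r * N / (8 * ‖v‖) * ‖v‖ := by gcongr; exact min_le_right _ _
            _ = r * N / 8 := by field_simp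
        have h6 : ‖z - p'‖ ≤ 3 * r / 8 := le_of_mul_le_mul_right (by linarith) hNpos
        rw [mem_ball]
        rw [← dist_eq_norm] at h6
        linarith [dist_triangle z p' p])
    have hseg : σ t ∈ segment ℝ a b := by
      have hu : |-cross (σ t - p') v / N| ≤ s := by
        rw [abs_div, abs_neg, abs_of_pos hNpos, div_le_iff₀ hNpos]
        exact e2.trans (by linarith [min_le_left (s * N / 2) (r * N / (8 * ‖v‖))])
      set u := -cross (σ t - p') v / N with hudef
      have hz : σ t = p' + u • n := by
        have hN' : v.1 * v.1 + v.2 * v.2 ≠ 0 := hNpos.ne'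
        have e3 : (σ t - p').1 * v.1 + (σ t - p').2 * v.2 = 0 := e1
        have huN : u * (v.1 * v.1 + v.2 * v.2) = -((σ t - p').1 * v.2 - (σ t - p').2 * v.1) :=
          div_mul_cancel₀ _ hNpos.ne'
        have k1 : (σ t - p').1 = u * -v.2 := by
          apply mul_right_cancel₀ hN'
          linear_combination v.1 * e3 + v.2 * huN
        have k2 : (σ t - p').2 = u * v.1 := by
          apply mul_right_cancel₀ hN'
          linear_combination v.2 * e3 - v.1 * huN
        rw [← sub_eq_iff_eq_add']
        exact Prod.ext k1 k2
      obtain ⟨hu1, hu2⟩ := abs_le.1 hu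
      rw [segment_eq_image']
      refine ⟨(u + s) / (2 * s), ⟨by apply div_nonneg <;> linarith, ?_⟩, ?_⟩
      · rw [div_le_one (by positivity)]
        linarith
      · simp only
        rw [hba, smul_smul, div_mul_cancel₀ _ (by positivity), hz, ha, add_smul]
        abel
    have hball : σ t ∈ ball p r := (convex_ball p r).segment_subset haball hbball hseg
    refine ⟨t, ⟨lt_of_le_of_ne ht.1 ?_, lt_of_le_of_ne ht.2 ?_⟩, hseg⟩
    · rintro rfl
      exact h0 (hsub hball)
    · rintro rfl
      exact hτ (hsub hball)

end PlanarODE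
end

/-! ### Closing up arcs, and domains defined by winding numbers. -/

open Set Filter Topology

noncomputable section

namespace PlanarODE

open MeasureTheory Metric

/-- The arc `σ` on `[0, τ]`, closed up by a segment, as a loop on `[0, τ + 1]`. -/
def closeUp (σ : ℝ → Plane) (τ t : ℝ) : Plane :=
  if t ≤ τ then σ t else σ τ + (t - τ) • (σ 0 - σ τ)

section closeUp

variable {σ : ℝ → Plane} {τ t : ℝ}

theorem closeUp_of_le (h : t ≤ τ) : closeUp σ τ t = σ t := if_pos h

theorem continuous_closeUp (hσ : Continuous σ) : Continuous (closeUp σ τ) :=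
  Continuous.if_le hσ (by fun_prop) continuous_id continuous_const fun t ht => by simp [ht]

theorem closeUp_loop (hτ : 0 ≤ τ) : closeUp σ τ (τ + 1) = closeUp σ τ 0 := by
  rw [closeUp_of_le hτ, closeUp, if_neg (by linarith)]
  simp

theorem closeUp_mem_segment (h : τ < t) (ht : t ≤ τ + 1) :
    closeUp σ τ t ∈ segment ℝ (σ τ) (σ 0) := by
  rw [closeUp, if_neg (not_le.2 h), segment_eq_image']
  exact ⟨t - τ, ⟨by linarith, by linarith⟩, rfl⟩

theorem hasDerivAt_closeUp {v : Plane} (hσ : HasDerivAt σ v t) (h : t < τ) :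
    HasDerivAt (closeUp σ τ) v t :=
  hσ.congr_of_eventuallyEq ((gt_mem_nhds h).mono fun _ hs => closeUp_of_le (le_of_lt hs))

end closeUp

section windingSet

variable {ι : Type*} {lam : ι → ℝ → Plane} {T : ι → ℝ} {a : ι → ℤ}

/-- The points where the given combination of the winding numbers of some loops is nonzero. -/
def windingSet [Fintype ι] (lam : ι → ℝ → Plane) (T : ι → ℝ) (a : ι → ℤ) : Set Plane :=
  {z | ∃ n : ι → ℤ, (∀ i, HasWinding (lam i) (T i) z (n i)) ∧ ∑ i, a i * n i ≠ 0}

theorem exists_hasWinding_family (hlam : ∀ i, ContinuousOn (lam i) (Icc 0 (T i)))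
    (hT : ∀ i, 0 ≤ T i) (hloop : ∀ i, lam i (T i) = lam i 0) {z : Plane}
    (hz : ∀ i, z ∉ lam i '' Icc 0 (T i)) :
    ∃ n : ι → ℤ, ∀ i, HasWinding (lam i) (T i) z (n i) := by
  choose n hn using fun i => exists_hasWinding (hlam i) (hT i) (hloop i)
    fun t ht he => hz i ⟨t, ht, he⟩
  exact ⟨n, hn⟩

theorem exists_ball_disjoint [Finite ι] (hlam : ∀ i, ContinuousOn (lam i) (Icc 0 (T i))) {z : Plane}
    (hz : ∀ i, z ∉ lam i '' Icc 0 (T i)) :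
    ∃ r > 0, ∀ i, ∀ t ∈ Icc 0 (T i), lam i t ∉ ball z r := by
  have hcl : IsClosed (⋃ i, lam i '' Icc 0 (T i)) :=
    (isCompact_iUnion fun i => isCompact_Icc.image_of_continuousOn (hlam i)).isClosed
  obtain ⟨r, hr, h⟩ := Metric.mem_nhds_iff.1 (hcl.isOpen_compl.mem_nhds
    (show z ∈ (⋃ i, lam i '' Icc 0 (T i))ᶜ from
      fun hm => (mem_iUnion.1 hm).elim hz))
  exact ⟨r, hr, fun i t ht hm => h hm (mem_iUnion.2 ⟨i, t, ht, rfl⟩)⟩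

variable [Fintype ι]

theorem subset_windingSet_of_convex (hlam : ∀ i, ContinuousOn (lam i) (Icc 0 (T i)))
    (hloop : ∀ i, lam i (T i) = lam i 0) {C : Set Plane} (hC : Convex ℝ C)
    (hd : ∀ i, ∀ t ∈ Icc 0 (T i), lam i t ∉ C) {z : Plane} (hz : z ∈ C)
    (hzW : z ∈ windingSet lam T a) : C ⊆ windingSet lam T a := by
  obtain ⟨n, hn, hs⟩ := hzW
  exact fun w hw => ⟨n, fun i => (hn i).of_segment_disjoint (hlam i) (hloop i)
    fun t ht h => hd i t ht (hC.segment_subset hz hw h), hs⟩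

theorem not_mem_of_mem_windingSet {z : Plane} (hz : z ∈ windingSet lam T a) (i : ι) :
    z ∉ lam i '' Icc 0 (T i) := by
  rintro ⟨t, ht, he⟩
  obtain ⟨n, hn, -⟩ := hz
  exact (hn i).ne ht he

theorem isOpen_windingSet (hlam : ∀ i, ContinuousOn (lam i) (Icc 0 (T i)))
    (hloop : ∀ i, lam i (T i) = lam i 0) : IsOpen (windingSet lam T a) := by
  refine Metric.isOpen_iff.2 fun z hz => ?_
  obtain ⟨r, hr, h⟩ := exists_ball_disjoint hlam (not_mem_of_mem_windingSet hz)
  exact ⟨r, hr, subset_windingSet_of_convex hlam hloop (convex_ball z r) h (mem_ball_self hr) hz⟩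

theorem frontier_windingSet_subset (hlam : ∀ i, ContinuousOn (lam i) (Icc 0 (T i)))
    (hloop : ∀ i, lam i (T i) = lam i 0) :
    frontier (windingSet lam T a) ⊆ ⋃ i, lam i '' Icc 0 (T i) := by
  intro z hz
  by_contra hcon
  obtain ⟨r, hr, h⟩ := exists_ball_disjoint hlam (z := z) fun i hi => hcon (mem_iUnion.2 ⟨i, hi⟩)
  rw [(isOpen_windingSet hlam hloop).frontier_eq] at hz
  obtain ⟨w, hw, hwz⟩ := Metric.mem_closure_iff.1 hz.1 r hr
  exact hz.2 (subset_windingSet_of_convex hlam hloop (convex_ball z r) h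
    (by rwa [mem_ball, dist_comm]) hw (mem_ball_self hr))

theorem isBounded_windingSet (hlam : ∀ i, ContinuousOn (lam i) (Icc 0 (T i)))
    (hT : ∀ i, 0 ≤ T i) (hloop : ∀ i, lam i (T i) = lam i 0) :
    Bornology.IsBounded (windingSet lam T a) := by
  have hc : IsCompact (⋃ i, lam i '' Icc 0 (T i)) :=
    isCompact_iUnion fun i => isCompact_Icc.image_of_continuousOn (hlam i)
  obtain ⟨R, hR⟩ := (hc.image continuous_toComplex).isBounded.exists_norm_le
  refine (isBounded_iff_forall_norm_le.2 ⟨R, fun z hz => ?_⟩)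
  by_contra! hcon
  -- The plane carries the sup norm, whereas `HasWinding.zero_of_norm_lt` uses the modulus of `ℂ`.
  have hle : ‖z‖ ≤ ‖toComplex z‖ := by
    rw [Prod.norm_def]
    exact max_le (Complex.abs_re_le_norm (toComplex z)) (Complex.abs_im_le_norm (toComplex z))
  obtain ⟨n, hn, hs⟩ := hz
  refine hs (Finset.sum_eq_zero fun i _ => ?_)
  have h0 : HasWinding (lam i) (T i) z 0 :=
    HasWinding.zero_of_norm_lt (hlam i) (hT i) (hloop i) fun t ht =>
      (hR _ ⟨_, mem_iUnion.2 ⟨i, t, ht, rfl⟩, rfl⟩).trans_lt (hcon.trans_le hle)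
  rw [(hn i).unique (hT i) h0, mul_zero]

end windingSet

/-- A ball of the sup norm is a square of side `2r`. -/
theorem volume_real_closedBall (z : Plane) {r : ℝ} (hr : 0 ≤ r) :
    volume.real (closedBall z r) = (2 * r) ^ 2 := by
  rw [← closedBall_prod_same z.1 z.2 r, Measure.volume_eq_prod, measureReal_def,
    Measure.prod_prod, Real.volume_closedBall, Real.volume_closedBall, ENNReal.toReal_mul,
    ENNReal.toReal_ofReal (by positivity)]
  ring

/-- The area is `O(ε²)`, so a cut-off of slope `1 / ε` leaves a flux `O(ε)`. -/
theorem volume_real_cthickening_le {ι : Type*} [Fintype ι] (q : ι → Plane) {ε : ℝ} (hε : 0 ≤ ε) :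
    volume.real (cthickening ε (⋃ i, closedBall (q i) ε)) ≤ Fintype.card ι * (16 * ε ^ 2) := by
  have hsub : cthickening ε (⋃ i, closedBall (q i) ε) ⊆ ⋃ i, closedBall (q i) (2 * ε) := by
    rw [(isCompact_iUnion fun i => isCompact_closedBall (q i) ε).cthickening_eq_biUnion_closedBall
      hε]
    intro z hz
    simp only [mem_iUnion, exists_prop] at hz ⊢
    obtain ⟨w, ⟨i, hi⟩, hw⟩ := hz
    refine ⟨i, mem_closedBall.2 ?_⟩
    linarith [dist_triangle z w (q i), mem_closedBall.1 hi, mem_closedBall.1 hw]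
  have hfin : volume (⋃ i, closedBall (q i) (2 * ε)) ≠ ⊤ :=
    (isCompact_iUnion fun i => isCompact_closedBall (q i) (2 * ε)).measure_ne_top
  refine (measureReal_mono hsub hfin).trans ((measureReal_iUnion_fintype_le _).trans ?_)
  rw [Finset.sum_congr rfl fun i _ => volume_real_closedBall (q i) (by positivity : 0 ≤ 2 * ε)]
  rw [Finset.sum_const, Finset.card_univ, nsmul_eq_mul]
  exact le_of_eq (by ring)

end PlanarODE
end

/-! ### The contradiction between positive divergence and small flux. -/

open Set Filter Topology

noncomputable section

namespace PlanarODE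

open MeasureTheory Metric

theorem continuousOn_divergence {Y : Plane → Plane} {S : Set Plane} (hS : IsOpen S)
    (hY : ContDiffOn ℝ 1 Y S) : ContinuousOn (divergence Y) S := by
  have h := hY.continuousOn_fderiv_of_isOpen hS le_rfl
  have h1 : ContinuousOn (fun z => fderiv ℝ Y z ((1 : ℝ), (0 : ℝ))) S :=
    h.clm_apply continuousOn_const
  have h2 : ContinuousOn (fun z => fderiv ℝ Y z ((0 : ℝ), (1 : ℝ))) S :=
    h.clm_apply continuousOn_const
  exact h1.fst.add h2.snd

theorem integral_closedBall_pos {f : Plane → ℝ} {c : Plane} {ρ : ℝ} (hρ : 0 < ρ)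
    (hf : ContinuousOn f (closedBall c ρ)) (hpos : ∀ z ∈ closedBall c ρ, 0 < f z) :
    0 < ∫ z in closedBall c ρ, f z := by
  have hint : IntegrableOn f (closedBall c ρ) := hf.integrableOn_compact (isCompact_closedBall c ρ)
  rw [setIntegral_pos_iff_support_of_nonneg_ae ?_ hint]
  · refine (measure_ball_pos volume c hρ).trans_le (measure_mono fun z hz => ?_)
    exact ⟨(hpos z (ball_subset_closedBall hz)).ne', ball_subset_closedBall hz⟩
  · filter_upwards [ae_restrict_mem isClosed_closedBall.measurableSet] with z hz
    exact (hpos z hz).le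

/-- Dulac's argument: a divergence that is nonnegative on `S`, and positive at points of certain
invariant sets, is incompatible with a relation between the winding numbers of loops near these
sets. -/
theorem false_of_winding_relation {ι : Type*} [Fintype ι] {X : Plane → Plane} {B : Plane → ℝ}
    {S : Set Plane} (hS : IsOpen S) (hX : ContDiffOn ℝ 1 X S) (hB : ContDiffOn ℝ 1 B S)
    (hdiv : ∀ z ∈ S, 0 ≤ divergence (fun z => B z • X z) z) (Γ : ι → Set Plane)
    (hΓ : ∀ i, IsCompact (Γ i)) (hΓ0 : ∀ i, volume (Γ i) = 0) (q p : ι → Plane)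
    (hqS : ∀ i, q i ∈ S) (hpS : ∀ i, p i ∈ S) (hqΓ : ∀ i, q i ∈ Γ i)
    (hqp : ∀ i j, q i ≠ p j) (hpΓ : ∀ i j, i ≠ j → p i ∉ Γ j)
    (hXp : ∀ i, X (p i) ≠ 0) (hdp : ∀ i, divergence (fun z => B z • X z) (p i) ≠ 0)
    (hloop : ∀ i, ∀ ε > 0, ∃ τ > 0, ∃ σ : ℝ → Plane, Continuous σ ∧
      (∀ t ∈ Icc 0 τ, HasDerivAt σ (X (σ t)) t ∧ σ t ∈ S ∧ infDist (σ t) (Γ i) < ε) ∧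
      dist (σ 0) (q i) < ε ∧ dist (σ τ) (q i) < ε ∧ ∃ t ∈ Icc 0 τ, dist (σ t) (p i) < ε)
    (hrel : ∀ (lam : ι → ℝ → Plane) (T : ι → ℝ), (∀ i, 0 ≤ T i) →
      (∀ i, ContinuousOn (lam i) (Icc 0 (T i))) → (∀ i, ∀ t ∈ Icc 0 (T i), lam i t ∈ S) →
      (∀ i, lam i (T i) = lam i 0) → ∃ a : ι → ℤ, (∃ i, a i ≠ 0) ∧ ∀ z ∉ S, ∀ n : ι → ℤ,
        (∀ i, HasWinding (lam i) (T i) z (n i)) → ∑ i, a i * n i = 0) : False := by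
  set F : Plane → ℝ := divergence fun z => B z • X z with hF
  have hFc : ContinuousOn F S := continuousOn_divergence hS (hB.smul hX)
  have hXc : ContinuousOn X S := hX.continuousOn
  -- neighbourhoods of the points `p i`
  have hr : ∀ i, ∃ r > 0, (∀ z ∈ ball (p i) r, z ∈ S ∧ 0 < F z) ∧
      (∀ j, ∀ z ∈ ball (p i) r, r ≤ dist z (q j)) ∧
      ∀ j, i ≠ j → ∀ z ∈ ball (p i) r, ∀ w ∈ Γ j, r ≤ dist z w := by
    intro i
    have hpF : 0 < F (p i) := lt_of_le_of_ne (hdiv _ (hpS i)) (hdp i).symm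
    have hO : IsOpen ((S ∩ F ⁻¹' Ioi 0) ∩ ((⋂ j, {q j}ᶜ) ∩ ⋂ j, ⋂ (_ : i ≠ j), (Γ j)ᶜ)) :=
      (hFc.isOpen_inter_preimage hS isOpen_Ioi).inter
        ((isOpen_iInter_of_finite fun j => isOpen_compl_singleton).inter
          (isOpen_iInter_of_finite fun j => isOpen_iInter_of_finite fun _ =>
            (hΓ j).isClosed.isOpen_compl))
    obtain ⟨r, hr, hb⟩ := Metric.isOpen_iff.1 hO (p i) ⟨⟨hpS i, hpF⟩,
      mem_iInter.2 fun j => (hqp j i).symm, mem_iInter₂.2 fun j hj => hpΓ i j hj⟩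
    have hfar : ∀ z ∈ ball (p i) (r / 2), ∀ w, w ∉ ball (p i) r → r / 2 ≤ dist z w := by
      intro z hz w hw
      rw [mem_ball, not_lt] at hw
      rw [mem_ball] at hz
      linarith [dist_triangle_left w (p i) z]
    refine ⟨r / 2, half_pos hr, fun z hz => ?_, fun j z hz => ?_, fun j hij z hz w hw => ?_⟩
    · exact (hb (ball_subset_ball (half_le_self hr.le) hz)).1
    · exact hfar z hz _ fun h => mem_iInter.1 (hb h).2.1 j rfl
    · exact hfar z hz _ fun h => mem_iInter₂.1 (hb h).2.2 j hij hw
  choose r hr hrS hrq hrΓ using hr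
  have hbox := fun i => exists_transversal_segment ((hXc.continuousAt (hS.mem_nhds (hpS i))))
    (hXp i) (isCompact_iUnion hΓ).isClosed (measure_iUnion_null hΓ0) (hr i)
  choose a b ρ hρ δ hδ haS hbS hfar htrans hcross using hbox
  -- A lower bound, independent of `ε`, for the integral over whichever of the two balls will lie in
  -- `D`.
  set c : ι → ℝ := fun i => min (∫ z in closedBall (a i) (ρ i), F z)
    (∫ z in closedBall (b i) (ρ i), F z) with hc
  have hcpos : ∀ i, 0 < c i := fun i => lt_min
    (integral_closedBall_pos (hρ i) (hFc.mono fun z hz => (hrS i z (haS i hz)).1)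
      fun z hz => (hrS i z (haS i hz)).2)
    (integral_closedBall_pos (hρ i) (hFc.mono fun z hz => (hrS i z (hbS i hz)).1)
      fun z hz => (hrS i z (hbS i hz)).2)
  -- neighbourhoods of the points `q i`
  have hq : ∀ i, ∃ r > 0, closedBall (q i) r ⊆ S := fun i =>
    Metric.nhds_basis_closedBall.mem_iff.1 (hS.mem_nhds (hqS i))
  choose r' hr' hr'S using hq
  have hK₀ : IsCompact (⋃ i, closedBall (q i) (r' i)) :=
    isCompact_iUnion fun i => isCompact_closedBall _ _
  obtain ⟨C, hC⟩ := (hK₀.bddAbove_image (f := fun z => |B z| * ‖X z‖)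
    ((hB.continuousOn.abs.mul hXc.norm).mono (iUnion_subset hr'S)))
  have hC' : ∀ z i, z ∈ closedBall (q i) (r' i) → |B z| * ‖X z‖ ≤ max C 0 := fun z i hz =>
    (hC ⟨z, mem_iUnion.2 ⟨i, hz⟩, rfl⟩).trans (le_max_left _ _)
  -- the choice of `ε`
  obtain ⟨ε, hε, hεall⟩ : ∃ ε > 0, ∀ i, 2 * ε < r' i ∧ ε < δ i ∧ 2 * ε < ρ i ∧ 2 * ε < r i ∧
      max C 0 * (Fintype.card ι * 16) * ε < c i := by
    have hev : ∀ᶠ ε : ℝ in 𝓝[>] 0, ∀ i, 2 * ε < r' i ∧ ε < δ i ∧ 2 * ε < ρ i ∧ 2 * ε < r i ∧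
        max C 0 * (Fintype.card ι * 16) * ε < c i := by
      refine eventually_all.2 fun i => ?_
      have key : ∀ A x : ℝ, 0 < x → ∀ᶠ ε : ℝ in 𝓝[>] 0, A * ε < x := fun A x hx => by
        have : Tendsto (fun ε : ℝ => A * ε) (𝓝 0) (𝓝 (A * 0)) :=
          (continuous_const_mul A).tendsto 0
        rw [mul_zero] at this
        exact nhdsWithin_le_nhds (this.eventually (gt_mem_nhds hx))
      filter_upwards [key 2 _ (hr' i), key 1 _ (hδ i), key 2 _ (hρ i), key 2 _ (hr i),
        key (max C 0 * (Fintype.card ι * 16)) _ (hcpos i)] with ε h1 h2 h3 h4 h5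
      exact ⟨h1, by linarith, h3, h4, h5⟩
    obtain ⟨ε, h1, h2⟩ := (hev.and self_mem_nhdsWithin).exists
    exact ⟨ε, h2, h1⟩
  choose τ hτ σ hσc hσ hσ0 hστ hσp using fun i => hloop i ε hε
  set lam : ι → ℝ → Plane := fun i => closeUp (σ i) (τ i) with hlam
  set T : ι → ℝ := fun i => τ i + 1 with hT
  have hT0 : ∀ i, 0 ≤ T i := fun i => by linarith [hτ i]
  have hlamc : ∀ i, ContinuousOn (lam i) (Icc 0 (T i)) := fun i =>
    (continuous_closeUp (hσc i)).continuousOn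
  have hlooplam : ∀ i, lam i (T i) = lam i 0 := fun i => closeUp_loop (hτ i).le
  set A : Set Plane := ⋃ i, σ i '' Icc 0 (τ i) with hA
  set N : Set Plane := ⋃ i, closedBall (q i) ε with hN
  have hqS' : ∀ i, closedBall (q i) ε ⊆ S := fun i =>
    (closedBall_subset_closedBall (by linarith [(hεall i).1])).trans (hr'S i)
  have hcases : ∀ i, ∀ t ∈ Icc 0 (T i), (t ∈ Icc 0 (τ i) ∧ lam i t = σ i t) ∨
      lam i t ∈ closedBall (q i) ε := by
    intro i t ht
    rcases le_or_gt t (τ i) with h | h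
    · exact Or.inl ⟨⟨ht.1, h⟩, closeUp_of_le h⟩
    · exact Or.inr ((convex_closedBall (q i) ε).segment_subset (mem_closedBall.2 (hστ i).le)
        (mem_closedBall.2 (hσ0 i).le) (closeUp_mem_segment h ht.2))
  have hlamS : ∀ i, ∀ t ∈ Icc 0 (T i), lam i t ∈ S := by
    intro i t ht
    rcases hcases i t ht with ⟨h1, h2⟩ | h
    · rw [h2]; exact (hσ i t h1).2.1
    · exact hqS' i h
  have hlamAN : (⋃ i, lam i '' Icc 0 (T i)) ⊆ A ∪ N := by
    refine iUnion_subset fun i => ?_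
    rintro _ ⟨t, ht, rfl⟩
    rcases hcases i t ht with ⟨h1, h2⟩ | h
    · rw [h2]; exact Or.inl (mem_iUnion.2 ⟨i, t, h1, rfl⟩)
    · exact Or.inr (mem_iUnion.2 ⟨i, h⟩)
  obtain ⟨k, ⟨i₀, hi₀⟩, hk⟩ := hrel lam T hT0 hlamc hlamS hlooplam
  set D := windingSet lam T k with hD
  have hDo : IsOpen D := isOpen_windingSet hlamc hlooplam
  -- This is the only use of the topology of `S`: outside `S` the chosen combination of winding
  -- numbers vanishes.
  have hDS : D ⊆ S := by
    rintro z ⟨n, hn, hs⟩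
    by_contra hz
    exact hs (hk z hz n hn)
  have hfr : frontier D ⊆ A ∪ N := (frontier_windingSet_subset hlamc hlooplam).trans hlamAN
  have hAc : IsCompact A := isCompact_iUnion fun i => isCompact_Icc.image (hσc i)
  have hAS : A ⊆ S := by
    refine iUnion_subset fun i => ?_
    rintro _ ⟨t, ht, rfl⟩
    exact (hσ i t ht).2.1
  have hNS : N ⊆ S := iUnion_subset hqS'
  have hclS : closure D ⊆ S := by
    rw [closure_eq_self_union_frontier]
    exact union_subset hDS (hfr.trans (union_subset hAS hNS))
  have hclc : IsCompact (closure D) := (isBounded_windingSet hlamc hT0 hlooplam).isCompact_closure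
  have hNc : IsCompact N := isCompact_iUnion fun i => isCompact_closedBall _ _
  have hAne : A.Nonempty := ⟨_, mem_iUnion.2 ⟨i₀, 0, ⟨le_rfl, (hτ i₀).le⟩, rfl⟩⟩
  have hNne : N.Nonempty := ⟨_, mem_iUnion.2 ⟨i₀, mem_closedBall_self hε.le⟩⟩
  -- points of the loops near `Γ j`
  have hnearΓ : ∀ j, ∀ t ∈ Icc 0 (τ j), ∃ w ∈ Γ j, dist (σ j t) w < ε := fun j t ht =>
    (infDist_lt_iff ⟨_, hqΓ j⟩).1 (hσ j t ht).2.2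
  have hoff : ∀ C : Set Plane, C ⊆ ball (p i₀) (r i₀) → ∀ j, i₀ ≠ j → ∀ t ∈ Icc 0 (T j),
      lam j t ∉ C := by
    intro C hC j hj t ht hm
    have hr₀ := (hεall i₀).2.2.2.1
    rcases hcases j t ht with ⟨h1, h2⟩ | h
    · obtain ⟨w, hw, hd⟩ := hnearΓ j t h1
      rw [h2] at hm
      linarith [hrΓ i₀ j hj _ (hC hm) w hw]
    · linarith [hrq i₀ j _ (hC hm), mem_closedBall.1 h]
  have hballoff : ∀ c : Plane, closedBall c (ρ i₀) ⊆ ball (p i₀) (r i₀) →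
      (∀ z ∈ closedBall c (ρ i₀), ∀ w ∈ ⋃ j, Γ j, ρ i₀ ≤ dist z w) →
      ∀ j, ∀ t ∈ Icc 0 (T j), lam j t ∉ closedBall c (ρ i₀) := by
    intro c hcb hcf j t ht hm
    rcases hcases j t ht with ⟨h1, h2⟩ | h
    · obtain ⟨w, hw, hd⟩ := hnearΓ j t h1
      rw [h2] at hm
      linarith [hcf _ hm w (mem_iUnion.2 ⟨j, hw⟩), (hεall i₀).2.2.1]
    · linarith [hrq i₀ j _ (hcb hm), mem_closedBall.1 h, (hεall i₀).2.2.2.1]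
  have hoffa := hballoff (a i₀) (haS i₀) fun z hz => hfar i₀ z (Or.inl hz)
  have hoffb := hballoff (b i₀) (hbS i₀) fun z hz => hfar i₀ z (Or.inr hz)
  have haC : a i₀ ∈ closedBall (a i₀) (ρ i₀) := mem_closedBall_self (hρ i₀).le
  have hbC : b i₀ ∈ closedBall (b i₀) (ρ i₀) := mem_closedBall_self (hρ i₀).le
  have hsegball : segment ℝ (a i₀) (b i₀) ⊆ ball (p i₀) (r i₀) :=
    (convex_ball _ _).segment_subset (haS i₀ haC) (hbS i₀ hbC)
  obtain ⟨m, hm⟩ := exists_hasWinding_family hlamc hT0 hlooplam (z := a i₀)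
    fun j ⟨t, ht, he⟩ => hoffa j t ht (he ▸ haC)
  obtain ⟨n, hn⟩ := exists_hasWinding_family hlamc hT0 hlooplam (z := b i₀)
    fun j ⟨t, ht, he⟩ => hoffb j t ht (he ▸ hbC)
  -- Only the loop `i₀` comes near `p i₀`, so the others wind equally around both ends of the
  -- transversal. Since loop `i₀` crosses it in one direction and `k i₀ ≠ 0`, the two combinations
  -- differ and one of them is nonzero.
  have hmn : ∀ j, i₀ ≠ j → m j = n j := fun j hj =>
    ((hm j).of_segment_disjoint (hlamc j) (hlooplam j) (hoff _ hsegball j hj)).unique (hT0 j) (hn j)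
  have hfarq : ∀ z ∈ closedBall (q i₀) ε, z ∉ ball (p i₀) (r i₀) := fun z hz hzb => by
    linarith [hrq i₀ i₀ z hzb, mem_closedBall.1 hz, (hεall i₀).2.2.2.1]
  have hmn₀ : m i₀ ≠ n i₀ := by
    obtain ⟨t, ht, hd⟩ := hσp i₀
    obtain ⟨t₀, ht₀, hmem⟩ := hcross i₀ (σ i₀) (τ i₀) (fun t ht => (hσ i₀ t ht).1)
      (hfarq _ (mem_closedBall.2 (hσ0 i₀).le)) (hfarq _ (mem_closedBall.2 (hστ i₀).le))
      ⟨t, ht, hd.trans (hεall i₀).2.1⟩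
    refine (hm i₀).ne_of_crossing (hn i₀) (fun t ht hseg => ?_) (t₀ := t₀)
      ⟨ht₀.1, ht₀.2.trans (lt_add_one _)⟩
      (by rw [hlam]; simp only; rwa [closeUp_of_le ht₀.2.le])
    rcases hcases i₀ t ht with ⟨h1, h2⟩ | h
    · have htlt : t < τ i₀ := by
        refine lt_of_le_of_ne h1.2 ?_
        rintro rfl
        rw [h2] at hseg
        exact hfarq _ (mem_closedBall.2 (hστ i₀).le) (hsegball hseg)
      refine ⟨X (σ i₀ t), hasDerivAt_closeUp (hσ i₀ t h1).1 htlt, ?_⟩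
      rw [h2] at hseg
      exact htrans i₀ _ hseg
    · exact absurd (hsegball hseg) (hfarq _ h)
  have hsum : ∑ j, k j * m j ≠ ∑ j, k j * n j := by
    intro h
    have h1 : ∑ j, k j * (m j - n j) = 0 := by
      simp only [mul_sub, Finset.sum_sub_distrib, h, sub_self]
    rw [Finset.sum_eq_single i₀ (fun j _ hj => by rw [hmn j hj.symm, sub_self, mul_zero])
      (fun h => absurd (Finset.mem_univ _) h)] at h1
    rcases mul_eq_zero.1 h1 with h2 | h2
    · exact hi₀ h2
    · exact hmn₀ (sub_eq_zero.1 h2)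
  -- the estimate
  have hmain : ∀ x : Plane, closedBall x (ρ i₀) ⊆ ball (p i₀) (r i₀) →
      (∀ z ∈ closedBall x (ρ i₀), ∀ w ∈ ⋃ j, Γ j, ρ i₀ ≤ dist z w) →
      closedBall x (ρ i₀) ⊆ D → ∫ z in closedBall x (ρ i₀), F z < c i₀ := by
    intro x hxb hxf hxD
    have hflux := flux_bound hS hX hB (hclc.union hAc) (union_subset hclS hAS)
      (subset_closure.trans subset_union_left) subset_union_right hDo hfr hAc
      (measure_iUnion_null fun i => volume_image_curve fun t ht => (hσ i t ht).1) hAne hNc hNne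
      (fun y hy hyN => by
        obtain ⟨i, t, ht, rfl⟩ := mem_iUnion.1 hy
        have h0 : 0 < t := by
          refine lt_of_le_of_ne ht.1 ?_
          rintro rfl
          exact hyN (mem_iUnion.2 ⟨i, mem_closedBall.2 (hσ0 i).le⟩)
        have h1 : t < τ i := by
          refine lt_of_le_of_ne ht.2 ?_
          rintro rfl
          exact hyN (mem_iUnion.2 ⟨i, mem_closedBall.2 (hστ i).le⟩)
        refine ⟨fun s => σ i (t + s), by simp, ?_, ?_⟩
        · have := (hσ i t ht).1
          rw [← add_zero t] at this
          simpa using this.comp_const_add t 0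
        · have : Tendsto (fun s => t + s) (𝓝 0) (𝓝 t) := by
            simpa using (continuous_const_add t).tendsto 0
          filter_upwards [this.eventually (Ioo_mem_nhds h0 h1)] with s hs
          exact mem_iUnion.2 ⟨i, t + s, Ioo_subset_Icc_self hs, rfl⟩)
      hε (fun z hz => hdiv z (hDS hz)) isClosed_closedBall.measurableSet hxD
      (r₀ := ρ i₀ / 2) (half_pos (hρ i₀))
      (fun z hz => (le_infDist hAne).2 fun y hy => by
        obtain ⟨i, t, ht, rfl⟩ := mem_iUnion.1 hy
        obtain ⟨w, hw, hd⟩ := hnearΓ i t ht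
        linarith [hxf z hz w (mem_iUnion.2 ⟨i, hw⟩), dist_triangle z (σ i t) w,
          (hεall i₀).2.2.1])
      (fun z hz => (le_infDist hNne).2 fun y hy => by
        obtain ⟨i, hi⟩ := mem_iUnion.1 hy
        linarith [hrq i₀ i z (hxb hz), dist_triangle z y (q i), mem_closedBall.1 hi,
          (hεall i₀).2.2.2.1])
      (C := max C 0) (le_max_right _ _)
      (fun z _ hz => by
        obtain ⟨y, hy, hyd⟩ := hNc.exists_infDist_eq_dist hNne z
        obtain ⟨i, hi⟩ := mem_iUnion.1 hy
        refine hC' z i (mem_closedBall.2 ?_)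
        linarith [dist_triangle z y (q i), mem_closedBall.1 hi, (hεall i).1])
    refine hflux.trans_lt (lt_of_le_of_lt ?_ (hεall i₀).2.2.2.2)
    calc max C 0 / ε * volume.real (cthickening ε N)
        ≤ max C 0 / ε * (Fintype.card ι * (16 * ε ^ 2)) := by
          gcongr
          exact volume_real_cthickening_le q hε.le
      _ = max C 0 * (Fintype.card ι * 16) * ε := by field_simp
  -- Whichever combination is nonzero, the ball around that end lies in `D`, and its integral is at
  -- least `c i₀`.
  by_cases hcase : ∑ j, k j * m j = 0
  · have hbD : b i₀ ∈ D := ⟨n, hn, fun h => hsum (hcase.trans h.symm)⟩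
    exact absurd (hmain (b i₀) (hbS i₀) (fun z hz => hfar i₀ z (Or.inr hz))
      (subset_windingSet_of_convex hlamc hlooplam (convex_closedBall _ _) hoffb hbC hbD))
      (not_lt.2 (min_le_right _ _))
  · have haD : a i₀ ∈ D := ⟨m, hm, hcase⟩
    exact absurd (hmain (a i₀) (haS i₀) (fun z hz => hfar i₀ z (Or.inl hz))
      (subset_windingSet_of_convex hlamc hlooplam (convex_closedBall _ _) hoffa haC haD))
      (not_lt.2 (min_le_left _ _))

end PlanarODE
end

/-! ### The Dulac factor, and confinement of loops to components of `U \ {V = 0}`. -/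

open Set Filter Topology

noncomputable section

namespace PlanarODE

open MeasureTheory Metric

theorem exists_primitive {g : ℝ → ℝ} {τ : ℝ} (hτ : 0 ≤ τ) (hg : ContinuousOn g (Icc 0 τ)) :
    ∃ G : ℝ → ℝ, ∀ t ∈ Icc 0 τ, HasDerivAt G (g t) t := by
  have hc : Continuous fun t => g (max 0 (min t τ)) :=
    hg.comp_continuous (continuous_clamp τ) fun t => clamp_mem hτ t
  refine ⟨fun t => ∫ s in (0 : ℝ)..t, g (max 0 (min s τ)), fun t ht => ?_⟩
  have := (hc.integral_hasStrictDerivAt 0 t).hasDerivAt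
  rwa [clamp_eq ht] at this

theorem apply_eq_add_mul (f : Plane →L[ℝ] ℝ) (v : Plane) :
    f v = f (1, 0) * v.1 + f (0, 1) * v.2 := by
  have h : v = v.1 • ((1 : ℝ), (0 : ℝ)) + v.2 • ((0 : ℝ), (1 : ℝ)) := by ext <;> simp
  conv_lhs => rw [h, map_add, map_smul, map_smul]
  simp [mul_comm]

theorem dulacM_eq (V : Plane → ℝ) (k : ℝ) (X : Plane → Plane) (z : Plane) :
    dulacM V k X z = fderiv ℝ V z (X z) - k * V z * divergence X z := by
  rw [dulacM, apply_eq_add_mul (fderiv ℝ V z) (X z)]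

theorem dulacM_neg (V : Plane → ℝ) (k : ℝ) (X : Plane → Plane) :
    dulacM (fun z => -V z) k X = fun z => -dulacM V k X z := by
  ext z
  rw [dulacM_eq, dulacM_eq, fderiv_fun_neg]
  simp only [neg_apply]
  ring

theorem divergence_smul {B : Plane → ℝ} {X : Plane → Plane} {z : Plane}
    (hB : DifferentiableAt ℝ B z) (hX : DifferentiableAt ℝ X z) :
    divergence (fun z => B z • X z) z = B z * divergence X z + fderiv ℝ B z (X z) := by
  rw [divergence, divergence, fderiv_fun_smul hB hX, apply_eq_add_mul (fderiv ℝ B z) (X z)]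
  simp only [add_apply, smul_apply,
    ContinuousLinearMap.smulRight_apply, Prod.fst_add, Prod.snd_add, Prod.smul_fst, Prod.smul_snd,
    smul_eq_mul]
  ring

/-- The Dulac function associated with `V`. -/
def dulacFactor (V : Plane → ℝ) (k : ℝ) (z : Plane) : ℝ :=
  -(Real.exp (-(1 + 1 / k) * Real.log (V z)) * V z)

section Dulac

variable {X : Plane → Plane} {U : Set Plane} {V : Plane → ℝ} {k : ℝ}

/-- `Real.log` is `log |·|`, so the factor equals `-sgn(V) |V|^(-1/k)` for both signs of `V`. The
exponent is chosen so that `B div X + ⟨∇B, X⟩` becomes a positive multiple of `M`. -/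
theorem divergence_dulacFactor {z : Plane} (hV : DifferentiableAt ℝ V z)
    (hX : DifferentiableAt ℝ X z) (hk : k ≠ 0) (hVz : V z ≠ 0) :
    divergence (fun z => dulacFactor V k z • X z) z =
      Real.exp (-(1 + 1 / k) * Real.log (V z)) / k * dulacM V k X z := by
  have h1 := ((hV.hasFDerivAt.log hVz).const_mul (-(1 + 1 / k))).exp.mul hV.hasFDerivAt
  have h2 : HasFDerivAt (dulacFactor V k) _ z := h1.neg
  rw [divergence_smul h2.differentiableAt hX, h2.fderiv, dulacM_eq, dulacFactor]
  simp only [neg_apply, add_apply,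
    smul_apply, smul_eq_mul]
  field_simp
  ring

theorem contDiffOn_dulacFactor {S : Set Plane} (hV : ContDiffOn ℝ 1 V S) (h0 : ∀ z ∈ S, V z ≠ 0) :
    ContDiffOn ℝ 1 (dulacFactor V k) S :=
  (((contDiffOn_const.mul (hV.log h0)).exp).mul hV).neg

theorem isOpen_diff_zero (hU : IsOpen U) (hV : ContDiffOn ℝ 1 V U) :
    IsOpen (U \ {z | V z = 0}) :=
  hV.continuousOn.isOpen_inter_preimage hU (isOpen_compl_singleton (x := (0 : ℝ)))

theorem differentiableAt_of_contDiffOn {E : Type*} [NormedAddCommGroup E] [NormedSpace ℝ E]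
    {f : Plane → E} (hU : IsOpen U) (hf : ContDiffOn ℝ 1 f U) {z : Plane} (hz : z ∈ U) :
    DifferentiableAt ℝ f z :=
  (hf.contDiffAt (hU.mem_nhds hz)).differentiableAt one_ne_zero

theorem hasDerivAt_comp_solution (hU : IsOpen U) (hV : ContDiffOn ℝ 1 V U) {σ : ℝ → Plane} {t : ℝ}
    (hσ : HasDerivAt σ (X (σ t)) t) (hσU : σ t ∈ U) :
    HasDerivAt (fun t => V (σ t))
      (dulacM V k X (σ t) + k * V (σ t) * divergence X (σ t)) t := by
  refine ((differentiableAt_of_contDiffOn hU hV hσU).hasFDerivAt.comp_hasDerivAt t hσ).congr_deriv ?_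
  rw [dulacM_eq]
  ring

/-- `V` does not vanish along an orbit arc if it has the same sign at both ends. -/
theorem ne_zero_along_solution (hU : IsOpen U) (hX : ContDiffOn ℝ 1 X U) (hV : ContDiffOn ℝ 1 V U)
    (hM : ∀ z ∈ U, 0 ≤ dulacM V k X z) {σ : ℝ → Plane} {τ : ℝ}
    (hσ : ∀ t ∈ Icc 0 τ, HasDerivAt σ (X (σ t)) t) (hσU : ∀ t ∈ Icc 0 τ, σ t ∈ U)
    (hsign : 0 < V (σ 0) ∧ 0 < V (σ τ) ∨ V (σ 0) < 0 ∧ V (σ τ) < 0) {t : ℝ} (ht : t ∈ Icc 0 τ) :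
    V (σ t) ≠ 0 := by
  have hτ : 0 ≤ τ := ht.1.trans ht.2
  have hσc : ContinuousOn σ (Icc 0 τ) := fun t ht => (hσ t ht).continuousAt.continuousWithinAt
  -- `exp (-k G)`, with `G` a primitive of the divergence, is the integrating factor of `V' = M + k
  -- V div X`. A positive value at the start or a negative one at the end then excludes a zero in
  -- between.
  obtain ⟨G, hG⟩ := exists_primitive hτ ((continuousOn_divergence hU hX).comp hσc hσU)
  have hder : ∀ t ∈ Icc 0 τ, HasDerivAt (fun t => V (σ t) * Real.exp (-(k * G t)))
      (dulacM V k X (σ t) * Real.exp (-(k * G t))) t := by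
    intro t ht
    refine ((hasDerivAt_comp_solution hU hV (k := k) (hσ t ht) (hσU t ht)).mul
      ((hG t ht).const_mul k).neg.exp).congr_deriv ?_
    simp only [Function.comp, Pi.neg_apply]
    ring
  have hmono : MonotoneOn (fun t => V (σ t) * Real.exp (-(k * G t))) (Icc 0 τ) := by
    refine monotoneOn_of_hasDerivWithinAt_nonneg (convex_Icc _ _)
      (fun t ht => (hder t ht).continuousAt.continuousWithinAt)
      (fun t ht => (hder t (interior_subset ht)).hasDerivWithinAt) fun t ht => ?_
    have := hM _ (hσU t (interior_subset ht))
    positivity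
  intro h0
  rcases hsign with h | h
  · have := hmono ⟨le_rfl, hτ⟩ ht ht.1
    simp only [h0, zero_mul] at this
    exact absurd this (not_le.2 (mul_pos h.1 (Real.exp_pos _)))
  · have := hmono ht ⟨hτ, le_rfl⟩ ht.2
    simp only [h0, zero_mul] at this
    exact absurd this (not_le.2 (mul_neg_of_neg_of_pos h.2 (Real.exp_pos _)))

theorem same_sign_of_isPreconnected {S : Set Plane} (hS : IsPreconnected S)
    (hV : ContinuousOn V S) (h0 : ∀ z ∈ S, V z ≠ 0) {z w : Plane} (hz : z ∈ S) (hw : w ∈ S) :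
    0 < V z ∧ 0 < V w ∨ V z < 0 ∧ V w < 0 := by
  by_contra hcon
  have hm : (0 : ℝ) ∈ V '' S := by
    rcases lt_trichotomy (V z) 0 with h1 | h1 | h1
    · refine hS.intermediate_value hz hw hV ⟨h1.le, ?_⟩
      by_contra h2
      exact hcon (Or.inr ⟨h1, not_le.1 h2⟩)
    · exact absurd h1 (h0 z hz)
    · refine hS.intermediate_value hw hz hV ⟨?_, h1.le⟩
      by_contra h2
      exact hcon (Or.inl ⟨h1, not_le.1 h2⟩)
  obtain ⟨y, hy, h⟩ := hm
  exact h0 y hy h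

/-- Both ends are near `q`, in one component, where `V` has a fixed sign; so `V` does not vanish
along the arc, which cannot change component. -/
theorem LoopNear.loop_in_component (hU : IsOpen U) (hX : ContDiffOn ℝ 1 X U)
    (hV : ContDiffOn ℝ 1 V U) (hM : ∀ z ∈ U, 0 ≤ dulacM V k X z) {Γ : Set Plane}
    (hΓ : IsCompact Γ) (hΓU : Γ ⊆ U) {q p x : Plane} (hq : q ∈ Γ) (h : LoopNear X Γ q p)
    (hqS : q ∈ connectedComponentIn (U \ {z | V z = 0}) x) {ε : ℝ} (hε : 0 < ε) :
    ∃ τ > 0, ∃ σ : ℝ → Plane, Continuous σ ∧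
      (∀ t ∈ Icc 0 τ, HasDerivAt σ (X (σ t)) t ∧
        σ t ∈ connectedComponentIn (U \ {z | V z = 0}) x ∧ infDist (σ t) Γ < ε) ∧
      dist (σ 0) q < ε ∧ dist (σ τ) q < ε ∧ ∃ t ∈ Icc 0 τ, dist (σ t) p < ε := by
  set O := U \ {z | V z = 0} with hO
  have hOo : IsOpen O := isOpen_diff_zero hU hV
  obtain ⟨η, hη, hηU⟩ := hΓ.exists_thickening_subset_open hU hΓU
  obtain ⟨r, hr, hrS⟩ := Metric.isOpen_iff.1 (hOo.connectedComponentIn (x := x)) q hqS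
  obtain ⟨τ, hτ, σ, hσc, hσ, h0, hτq, hd, hp⟩ := h (min ε (min η r)) (by positivity)
  simp only [lt_min_iff] at h0 hτq hd hp
  have hσU : ∀ t ∈ Icc 0 τ, σ t ∈ U := fun t ht =>
    hηU ((mem_thickening_iff_infDist_lt ⟨q, hq⟩).2 (hd t ht).2.1)
  have hsub : connectedComponentIn O x ⊆ O := connectedComponentIn_subset O x
  have hsign := same_sign_of_isPreconnected isPreconnected_connectedComponentIn
    (hV.continuousOn.mono (hsub.trans sdiff_subset)) (fun z hz => (hsub hz).2) (hrS h0.2.2)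
    (hrS hτq.2.2)
  have hne : ∀ t ∈ Icc 0 τ, V (σ t) ≠ 0 := fun t ht =>
    ne_zero_along_solution hU hX hV hM hσ hσU hsign ht
  have hS : ∀ t ∈ Icc 0 τ, σ t ∈ connectedComponentIn O x := by
    have hi : σ '' Icc 0 τ ⊆ connectedComponentIn O (σ 0) :=
      (isPreconnected_Icc.image σ hσc.continuousOn).subset_connectedComponentIn
        ⟨0, ⟨le_rfl, hτ.le⟩, rfl⟩ (by rintro _ ⟨t, ht, rfl⟩; exact ⟨hσU t ht, hne t ht⟩)
    intro t ht
    rw [connectedComponentIn_eq (hrS h0.2.2)]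
    exact hi ⟨t, ht, rfl⟩
  obtain ⟨t, ht, htp⟩ := hp
  exact ⟨τ, hτ, σ, hσc, fun t ht => ⟨hσ t ht, hS t ht, (hd t ht).1⟩, h0.1, hτq.1, t, ht, htp.1⟩

/-- Where `V = 0` and `M ≠ 0`, the derivative of `V` along the orbit is `M`, so `V ≠ 0` at nearby
times, and `M ≠ 0` persists. -/
theorem exists_mul_ne_zero (hU : IsOpen U) (hX : ContDiffOn ℝ 1 X U) (hV : ContDiffOn ℝ 1 V U)
    {γ : ℝ → Plane} (hγ : ∀ t, HasDerivAt γ (X (γ t)) t) (hγU : ∀ t, γ t ∈ U)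
    (hM : ∃ t, dulacM V k X (γ t) ≠ 0) :
    ∃ t, dulacM V k X (γ t) ≠ 0 ∧ V (γ t) ≠ 0 := by
  obtain ⟨t, ht⟩ := hM
  by_cases h0 : V (γ t) = 0
  · have hder := hasDerivAt_comp_solution hU hV (k := k) (hγ t) (hγU t)
    rw [h0, mul_zero, zero_mul, add_zero] at hder
    have h1 : ∀ᶠ s in 𝓝[≠] t, V (γ s) ≠ 0 := hder.eventually_ne ht
    have hMc : ContinuousOn (dulacM V k X) U := by
      have hf := hV.continuousOn_fderiv_of_isOpen hU le_rfl
      have : ContinuousOn (fun z => fderiv ℝ V z (X z) - k * V z * divergence X z) U :=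
        (hf.clm_apply hX.continuousOn).sub
          ((continuousOn_const.mul hV.continuousOn).mul (continuousOn_divergence hU hX))
      exact this.congr fun z _ => dulacM_eq V k X z
    have h2 : ∀ᶠ s in 𝓝[≠] t, dulacM V k X (γ s) ≠ 0 := nhdsWithin_le_nhds
      (((hMc.continuousAt (hU.mem_nhds (hγU t))).comp (hγ t).continuousAt).eventually_ne ht)
    obtain ⟨s, hs⟩ := (h2.and h1).exists
    exact ⟨s, hs⟩
  · exact ⟨t, ht, h0⟩

/-- Supplies the two points of Dulac's argument: `γ t`, where the divergence of `B X` is nonzero,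
and `γ s`, where the loop will be closed up. -/
theorem exists_pair_of_solution (hU : IsOpen U) (hX : ContDiffOn ℝ 1 X U) (hV : ContDiffOn ℝ 1 V U)
    {γ : ℝ → Plane} (hγ : ∀ t, HasDerivAt γ (X (γ t)) t) (hreg : ∀ t, X (γ t) ≠ 0)
    (hγU : ∀ t, γ t ∈ U) (hM : ∃ t, dulacM V k X (γ t) ≠ 0) :
    ∃ s t, dulacM V k X (γ t) ≠ 0 ∧ γ t ∈ U \ {z | V z = 0} ∧ γ s ≠ γ t ∧
      γ s ∈ connectedComponentIn (U \ {z | V z = 0}) (γ t) := by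
  obtain ⟨t, ht, hVt⟩ := exists_mul_ne_zero hU hX hV hγ hγU hM
  have hmem : γ t ∈ U \ {z | V z = 0} := ⟨hγU t, hVt⟩
  have h1 : ∀ᶠ s in 𝓝[≠] t, γ s ≠ γ t := (hγ t).eventually_ne (hreg t)
  have h2 : ∀ᶠ s in 𝓝[≠] t, γ s ∈ connectedComponentIn (U \ {z | V z = 0}) (γ t) :=
    nhdsWithin_le_nhds ((hγ t).continuousAt.eventually
      ((isOpen_diff_zero hU hV).connectedComponentIn.mem_nhds (mem_connectedComponentIn hmem)))
  obtain ⟨s, hs⟩ := (h1.and h2).exists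
  exact ⟨s, t, ht, hmem, hs⟩

/-- The core argument for a finite family of periodic orbits and polycycles. -/
theorem false_of_family {ι : Type*} [Fintype ι] (hU : IsOpen U) (hX : ContDiffOn ℝ 1 X U)
    (hV : ContDiffOn ℝ 1 V U) (hk : 0 < k) (hM : ∀ z ∈ U, 0 ≤ dulacM V k X z) (Γ : ι → Set Plane)
    (hΓU : ∀ i, Γ i ⊆ U) (hΓ : ∀ i, IsPeriodicOrbit X (Γ i) ∨ IsPolycycle X (Γ i)) {x : Plane}
    (q p : ι → Plane) (hqΓ : ∀ i, q i ∈ Γ i) (hpΓ : ∀ i, p i ∈ Γ i)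
    (hqS : ∀ i, q i ∈ connectedComponentIn (U \ {z | V z = 0}) x)
    (hpS : ∀ i, p i ∈ connectedComponentIn (U \ {z | V z = 0}) x)
    (hqp : ∀ i, q i ≠ p i) (hpΓ' : ∀ i j, i ≠ j → p i ∉ Γ j) (hXq : ∀ i, X (q i) ≠ 0)
    (hXp : ∀ i, X (p i) ≠ 0) (hMp : ∀ i, dulacM V k X (p i) ≠ 0)
    (hrel : ∀ (lam : ι → ℝ → Plane) (T : ι → ℝ), (∀ i, 0 ≤ T i) →
      (∀ i, ContinuousOn (lam i) (Icc 0 (T i))) →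
      (∀ i, ∀ t ∈ Icc 0 (T i), lam i t ∈ connectedComponentIn (U \ {z | V z = 0}) x) →
      (∀ i, lam i (T i) = lam i 0) → ∃ a : ι → ℤ, (∃ i, a i ≠ 0) ∧
        ∀ z ∉ connectedComponentIn (U \ {z | V z = 0}) x, ∀ n : ι → ℤ,
        (∀ i, HasWinding (lam i) (T i) z (n i)) → ∑ i, a i * n i = 0) : False := by
  set S := connectedComponentIn (U \ {z | V z = 0}) x with hS
  have hsub : S ⊆ U \ {z | V z = 0} := connectedComponentIn_subset _ _
  have hSU : S ⊆ U := hsub.trans sdiff_subset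
  have hdiv : ∀ z ∈ S, divergence (fun z => dulacFactor V k z • X z) z =
      Real.exp (-(1 + 1 / k) * Real.log (V z)) / k * dulacM V k X z := fun z hz =>
    divergence_dulacFactor (differentiableAt_of_contDiffOn hU hV (hSU hz))
      (differentiableAt_of_contDiffOn hU hX (hSU hz)) hk.ne' (hsub hz).2
  refine false_of_winding_relation (B := dulacFactor V k)
    (isOpen_diff_zero hU hV).connectedComponentIn (hX.mono hSU)
    (contDiffOn_dulacFactor (hV.mono hSU) fun z hz => (hsub hz).2) (fun z hz => ?_) Γ
    (fun i => isCompact_of_isPeriodicOrbit_or_isPolycycle (hΓ i))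
    (fun i => volume_eq_zero_of_isPeriodicOrbit_or_isPolycycle (hΓ i)) q p hqS hpS hqΓ
    (fun i j => ?_) hpΓ' hXp (fun i => ?_)
    (fun i ε hε => (loopNear_of_isPeriodicOrbit_or_isPolycycle hU hX (hΓU i) (hΓ i) (hqΓ i) (hXq i)
      (hpΓ i) (hXp i)).loop_in_component hU hX hV hM
      (isCompact_of_isPeriodicOrbit_or_isPolycycle (hΓ i)) (hΓU i) (hqΓ i) (hqS i) hε) hrel
  · rw [hdiv z hz]
    have := hM z (hSU hz)
    positivity
  · by_cases hij : i = j
    · subst hij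
      exact hqp i
    · intro h
      exact hpΓ' j i (Ne.symm hij) (h ▸ hqΓ i)
  · rw [hdiv _ (hpS i)]
    exact mul_ne_zero (div_ne_zero (Real.exp_ne_zero _) hk.ne') (hMp i)

theorem false_of_isSimplyConnected (hU : IsOpen U) (hX : ContDiffOn ℝ 1 X U)
    (hV : ContDiffOn ℝ 1 V U) (hk : 0 < k) (hM : ∀ z ∈ U, 0 ≤ dulacM V k X z) {Γ : Set Plane}
    (hΓU : Γ ⊆ U) (hΓ : IsPeriodicOrbit X Γ ∨ IsPolycycle X Γ) {x q p : Plane} (hqΓ : q ∈ Γ)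
    (hpΓ : p ∈ Γ) (hqS : q ∈ connectedComponentIn (U \ {z | V z = 0}) x)
    (hpS : p ∈ connectedComponentIn (U \ {z | V z = 0}) x) (hqp : q ≠ p) (hXq : X q ≠ 0)
    (hXp : X p ≠ 0) (hMp : dulacM V k X p ≠ 0)
    (hsc : IsSimplyConnected (connectedComponentIn (U \ {z | V z = 0}) x)) : False := by
  refine false_of_family (ι := Unit) hU hX hV hk hM (fun _ => Γ) (fun _ => hΓU) (fun _ => hΓ)
    (fun _ => q) (fun _ => p) (fun _ => hqΓ) (fun _ => hpΓ) (fun _ => hqS) (fun _ => hpS)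
    (fun _ => hqp) (fun i j hij => absurd (Subsingleton.elim i j) hij) (fun _ => hXq)
    (fun _ => hXp) (fun _ => hMp) fun lam T hT hlam hlamS hloop => ?_
  refine ⟨fun _ => 1, ⟨(), one_ne_zero⟩, fun z hz n hn => ?_⟩
  refine Finset.sum_eq_zero fun i _ => ?_
  rw [hasWinding_zero_of_isSimplyConnected hsc (hT i) (hlam i) (hlamS i) (hloop i) hz (hn i),
    mul_zero]

theorem false_of_isOneConnected (hU : IsOpen U) (hX : ContDiffOn ℝ 1 X U)
    (hV : ContDiffOn ℝ 1 V U) (hk : 0 < k) (hM : ∀ z ∈ U, 0 ≤ dulacM V k X z) (Γ : Bool → Set Plane)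
    (hΓU : ∀ i, Γ i ⊆ U) (hΓ : ∀ i, IsPeriodicOrbit X (Γ i) ∨ IsPolycycle X (Γ i)) {x : Plane}
    (q p : Bool → Plane) (hqΓ : ∀ i, q i ∈ Γ i) (hpΓ : ∀ i, p i ∈ Γ i)
    (hqS : ∀ i, q i ∈ connectedComponentIn (U \ {z | V z = 0}) x)
    (hpS : ∀ i, p i ∈ connectedComponentIn (U \ {z | V z = 0}) x)
    (hqp : ∀ i, q i ≠ p i) (hpΓ' : ∀ i j, i ≠ j → p i ∉ Γ j) (hXq : ∀ i, X (q i) ≠ 0)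
    (hXp : ∀ i, X (p i) ≠ 0) (hMp : ∀ i, dulacM V k X (p i) ≠ 0)
    (hone : IsOneConnected (connectedComponentIn (U \ {z | V z = 0}) x)) : False := by
  refine false_of_family hU hX hV hk hM Γ hΓU hΓ q p hqΓ hpΓ hqS hpS hqp hpΓ' hXq hXp hMp
    fun lam T hT hlam hlamS hloop => ?_
  obtain ⟨a, b, hab, h⟩ := exists_winding_relation hone (hT true) (hlam true) (hlamS true)
    (hloop true) (hT false) (hlam false) (hlamS false) (hloop false)
  refine ⟨fun i => bif i then a else b, ?_, fun z hz n hn => ?_⟩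
  · rcases hab with ha | hb
    · exact ⟨true, ha⟩
    · exact ⟨false, hb⟩
  · rw [Fintype.sum_bool]
    exact h z hz _ _ (hn true) (hn false)

end Dulac

end PlanarODE
end

/-! ### Diliberto's formula and hyperbolicity. -/

open Set Filter Topology

noncomputable section

namespace PlanarODE

open MeasureTheory Metric

theorem apply_fst_eq (f : Plane →L[ℝ] Plane) (v : Plane) :
    (f v).1 = (f (1, 0)).1 * v.1 + (f (0, 1)).1 * v.2 :=
  apply_eq_add_mul ((ContinuousLinearMap.fst ℝ ℝ ℝ).comp f) v

theorem apply_snd_eq (f : Plane →L[ℝ] Plane) (v : Plane) :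
    (f v).2 = (f (1, 0)).2 * v.1 + (f (0, 1)).2 * v.2 :=
  apply_eq_add_mul ((ContinuousLinearMap.snd ℝ ℝ ℝ).comp f) v

theorem hasDerivAt_fst_of {σ : ℝ → Plane} {v : Plane} {t : ℝ} (h : HasDerivAt σ v t) :
    HasDerivAt (fun t => (σ t).1) v.1 t := h.fst

theorem hasDerivAt_snd_of {σ : ℝ → Plane} {v : Plane} {t : ℝ} (h : HasDerivAt σ v t) :
    HasDerivAt (fun t => (σ t).2) v.2 t := h.snd

section Diliberto

variable {X : Plane → Plane} {U : Set Plane} {γ : ℝ → Plane}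

theorem hasDerivAt_field_along (hU : IsOpen U) (hX : ContDiffOn ℝ 1 X U) {t : ℝ}
    (hγ : HasDerivAt γ (X (γ t)) t) (hγU : γ t ∈ U) :
    HasDerivAt (fun t => X (γ t)) (fderiv ℝ X (γ t) (X (γ t))) t :=
  (differentiableAt_of_contDiffOn hU hX hγU).hasFDerivAt.comp_hasDerivAt t hγ

/-- The second column of a fundamental matrix of the variational equation, by Diliberto's
formula. -/
theorem exists_diliberto_solution (hU : IsOpen U) (hX : ContDiffOn ℝ 1 X U)
    (hγ : ∀ t, HasDerivAt γ (X (γ t)) t) (hreg : ∀ t, X (γ t) ≠ 0) (hγU : ∀ t, γ t ∈ U)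
    {G : ℝ → ℝ} (hG : ∀ t, HasDerivAt G (divergence X (γ t)) t) :
    ∃ α : ℝ → ℝ, α 0 = 0 ∧ ∀ t, HasDerivAt (fun t => α t • X (γ t) +
      (Real.exp (G t) / dot (X (γ t)) (X (γ t))) • ((-(X (γ t)).2, (X (γ t)).1) : Plane))
      (fderiv ℝ X (γ t) (α t • X (γ t) +
        (Real.exp (G t) / dot (X (γ t)) (X (γ t))) • ((-(X (γ t)).2, (X (γ t)).1) : Plane))) t := by
  set f : ℝ → Plane →L[ℝ] Plane := fun t => fderiv ℝ X (γ t) with hf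
  set x : ℝ → ℝ := fun t => (X (γ t)).1 with hx
  set y : ℝ → ℝ := fun t => (X (γ t)).2 with hy
  have hγc : Continuous γ := continuous_iff_continuousAt.2 fun t => (hγ t).continuousAt
  have hfc : Continuous f := (hX.continuousOn_fderiv_of_isOpen hU le_rfl).comp_continuous hγc hγU
  have hXc : Continuous fun t => X (γ t) := hX.continuousOn.comp_continuous hγc hγU
  have hGc : Continuous G := continuous_iff_continuousAt.2 fun t => (hG t).continuousAt
  have hxc : Continuous x := hXc.fst
  have hyc : Continuous y := hXc.snd
  set a : ℝ → ℝ := fun t => (f t (1, 0)).1 with ha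
  set b : ℝ → ℝ := fun t => (f t (0, 1)).1 with hb
  set c : ℝ → ℝ := fun t => (f t (1, 0)).2 with hc
  set d : ℝ → ℝ := fun t => (f t (0, 1)).2 with hd
  have hac : Continuous a := (hfc.clm_apply continuous_const).fst
  have hbc : Continuous b := (hfc.clm_apply continuous_const).fst
  have hcc : Continuous c := (hfc.clm_apply continuous_const).snd
  have hdc : Continuous d := (hfc.clm_apply continuous_const).snd
  have hpos : ∀ t, 0 < x t * x t + y t * y t := fun t => dot_self_pos (hreg t)
  have hdx : ∀ t, HasDerivAt x (a t * x t + b t * y t) t := fun t => by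
    have := hasDerivAt_fst_of (hasDerivAt_field_along hU hX (hγ t) (hγU t))
    rwa [apply_fst_eq] at this
  have hdy : ∀ t, HasDerivAt y (c t * x t + d t * y t) t := fun t => by
    have := hasDerivAt_snd_of (hasDerivAt_field_along hU hX (hγ t) (hγU t))
    rwa [apply_snd_eq] at this
  -- The coefficient `exp G / |X|²` of the normal is dictated by Liouville's formula, the
  -- determinant of `X` and the solution being `exp G`. The tangential coefficient has derivative
  -- `θ`, obtained by projecting the variational equation on `X`.
  set θ : ℝ → ℝ := fun t => Real.exp (G t) *
    ((-a t * y t + b t * x t) * x t + (-c t * y t + d t * x t) * y t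
      + (c t * x t + d t * y t) * x t - (a t * x t + b t * y t) * y t) /
      (x t * x t + y t * y t) ^ 2 with hθ
  have hθc : Continuous θ := by
    refine Continuous.div ?_ (by fun_prop) fun t => (pow_pos (hpos t) 2).ne'
    have := Real.continuous_exp.comp hGc
    exact this.mul (by fun_prop)
  refine ⟨fun t => ∫ s in (0 : ℝ)..t, θ s, by simp, fun t => ?_⟩
  have hα : HasDerivAt (fun t => ∫ s in (0 : ℝ)..t, θ s) (θ t) t :=
    (hθc.integral_hasStrictDerivAt 0 t).hasDerivAt
  set α : ℝ → ℝ := fun t => ∫ s in (0 : ℝ)..t, θ s with hαdef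
  have hGt : HasDerivAt G (a t + d t) t := hG t
  have hβ : HasDerivAt (fun t => Real.exp (G t) / (x t * x t + y t * y t)) _ t :=
    hGt.exp.div (((hdx t).mul (hdx t)).add ((hdy t).mul (hdy t))) (hpos t).ne'
  have h1 := (hα.mul (hdx t)).add (hβ.mul (hdy t).neg)
  have h2 := (hα.mul (hdy t)).add (hβ.mul (hdx t))
  refine (h1.prodMk h2).congr_deriv (Prod.ext ?_ ?_)
  · rw [apply_fst_eq]
    simp only [dot, Prod.fst_add, Prod.snd_add, Prod.smul_fst, Prod.smul_snd, smul_eq_mul,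
      Pi.neg_apply]
    change _ = a t * (α t * x t + Real.exp (G t) / (x t * x t + y t * y t) * -y t) +
      b t * (α t * y t + Real.exp (G t) / (x t * x t + y t * y t) * x t)
    simp only [hθ]
    have : x t ^ 2 + y t ^ 2 ≠ 0 := by rw [sq, sq]; exact (hpos t).ne'
    field_simp
    ring
  · rw [apply_snd_eq]
    simp only [dot, Prod.fst_add, Prod.snd_add, Prod.smul_fst, Prod.smul_snd, smul_eq_mul]
    change _ = c t * (α t * x t + Real.exp (G t) / (x t * x t + y t * y t) * -y t) +
      d t * (α t * y t + Real.exp (G t) / (x t * x t + y t * y t) * x t)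
    simp only [hθ]
    have : x t ^ 2 + y t ^ 2 ≠ 0 := by rw [sq, sq]; exact (hpos t).ne'
    field_simp
    ring

/-- A periodic orbit along which the integral of the divergence is nonzero is hyperbolic. -/
theorem isHyperbolicOrbit_of_primitive (hU : IsOpen U) (hX : ContDiffOn ℝ 1 X U)
    {T : ℝ} (hγ : IsPeriodicSolution X γ T) (hγU : ∀ t, γ t ∈ U)
    {G : ℝ → ℝ} (hG : ∀ t, HasDerivAt G (divergence X (γ t)) t) (hGT : G T ≠ G 0) :
    IsHyperbolicOrbit X (range γ) := by
  have hsol : ∀ t, HasDerivAt γ (X (γ t)) t := hγ.solution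
  obtain ⟨α, hα0, hα⟩ := exists_diliberto_solution hU hX hsol hγ.regular hγU
    (G := fun t => G t - G 0) (fun t => (hG t).sub_const _)
  set n : ℝ → Plane := fun t => (-(X (γ t)).2, (X (γ t)).1) with hn
  set w : ℝ → Plane := fun t => α t • X (γ t) +
    (Real.exp (G t - G 0) / dot (X (γ t)) (X (γ t))) • n t with hw
  set x₀ := X (γ 0) with hx₀
  set N := dot x₀ x₀ with hN
  have hNpos : 0 < N := dot_self_pos (hγ.regular 0)
  have hγT : γ T = γ 0 := by simpa using hγ.periodic 0
  -- `l₁`, `l₂` form the basis dual to `x₀`, `w 0`; the fundamental matrix is `X(γ t) ⊗ l₁ + w t ⊗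
  -- l₂`.
  set l₁ : Plane →L[ℝ] ℝ := (x₀.1 / N) • ContinuousLinearMap.fst ℝ ℝ ℝ +
    (x₀.2 / N) • ContinuousLinearMap.snd ℝ ℝ ℝ with hl₁
  set l₂ : Plane →L[ℝ] ℝ := (-x₀.2) • ContinuousLinearMap.fst ℝ ℝ ℝ +
    x₀.1 • ContinuousLinearMap.snd ℝ ℝ ℝ with hl₂
  have e₁ : ∀ z : Plane, l₁ z = x₀.1 / N * z.1 + x₀.2 / N * z.2 := fun z => rfl
  have e₂ : ∀ z : Plane, l₂ z = -x₀.2 * z.1 + x₀.1 * z.2 := fun z => rfl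
  have hN' : N = x₀.1 * x₀.1 + x₀.2 * x₀.2 := rfl
  have hw0 : w 0 = (1 / N) • ((-x₀.2, x₀.1) : Plane) := by
    simp only [hw, hα0, zero_smul, zero_add, sub_self, Real.exp_zero, ← hx₀, ← hN, hn]
  have hwT : w T = α T • x₀ + (Real.exp (G T - G 0) / N) • ((-x₀.2, x₀.1) : Plane) := by
    simp only [hw, hγT, ← hx₀, ← hN, hn]
  refine ⟨γ, T, hγ, rfl, fun t => l₁.smulRight (X (γ t)) + l₂.smulRight (w t), ?_, fun t => ?_,
    Real.exp (G T - G 0), ?_, ?_⟩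
  · ext <;>
    · simp only [hw0, ← hx₀, add_apply, ContinuousLinearMap.smulRight_apply,
        ContinuousLinearMap.comp_apply, ContinuousLinearMap.inl_apply,
        ContinuousLinearMap.inr_apply, e₁, e₂, ContinuousLinearMap.id_apply, Prod.fst_add,
        Prod.snd_add, Prod.smul_fst, Prod.smul_snd, smul_eq_mul]
      field_simp
      rw [hN']
      ring
  · have d1 := (ContinuousLinearMap.smulRightL ℝ Plane Plane l₁).hasFDerivAt.comp_hasDerivAt t
      (hasDerivAt_field_along hU hX (hsol t) (hγU t))
    have d2 := (ContinuousLinearMap.smulRightL ℝ Plane Plane l₂).hasFDerivAt.comp_hasDerivAt t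
      (hα t)
    refine (d1.add d2).congr_deriv ?_
    refine ContinuousLinearMap.ext fun z => ?_
    change l₁ z • fderiv ℝ X (γ t) (X (γ t)) + l₂ z • fderiv ℝ X (γ t) (w t) =
      fderiv ℝ X (γ t) (l₁ z • X (γ t) + l₂ z • w t)
    rw [map_add (fderiv ℝ X (γ t)) (l₁ z • X (γ t)), map_smul, map_smul (fderiv ℝ X (γ t)) (l₂ z)]
  · rw [abs_of_pos (Real.exp_pos _), Ne, Real.exp_eq_one_iff, sub_eq_zero]
    exact hGT
  · set β := Real.exp (G T - G 0) with hβ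
    have hβ1 : β - 1 ≠ 0 := by
      rw [sub_ne_zero, hβ, Ne, Real.exp_eq_one_iff, sub_eq_zero]
      exact hGT
    -- The monodromy fixes `x₀` and maps `w 0` to `α T • x₀ + β • w 0`; as `β ≠ 1`, the vector `w 0
    -- + (α T / (β - 1)) • x₀` is an eigenvector for `β`.
    refine Module.End.hasEigenvalue_of_hasEigenvector
      (x := (1 / N) • ((-x₀.2, x₀.1) : Plane) + (α T / (β - 1)) • x₀)
      ⟨Module.End.mem_eigenspace_iff.2 ?_, ?_⟩
    · have k1 : l₁ ((1 / N) • ((-x₀.2, x₀.1) : Plane) + (α T / (β - 1)) • x₀) = α T / (β - 1) := by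
        simp only [e₁, Prod.fst_add, Prod.snd_add, Prod.smul_fst, Prod.smul_snd, smul_eq_mul]
        field_simp
        rw [hN']
        ring
      have k2 : l₂ ((1 / N) • ((-x₀.2, x₀.1) : Plane) + (α T / (β - 1)) • x₀) = 1 := by
        simp only [e₂, Prod.fst_add, Prod.snd_add, Prod.smul_fst, Prod.smul_snd, smul_eq_mul]
        field_simp
        rw [hN']
        ring
      change l₁ _ • X (γ T) + l₂ _ • w T = _
      rw [k1, k2, hwT, hγT, ← hx₀]
      ext <;>
      · simp only [Prod.fst_add, Prod.snd_add, Prod.smul_fst, Prod.smul_snd, smul_eq_mul]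
        field_simp
        ring
    · intro h0
      have := congrArg l₂ h0
      rw [map_zero] at this
      simp only [e₂, Prod.fst_add, Prod.snd_add, Prod.smul_fst, Prod.smul_snd, smul_eq_mul] at this
      have hone : -x₀.2 * (1 / N * -x₀.2 + α T / (β - 1) * x₀.1) +
        x₀.1 * (1 / N * x₀.1 + α T / (β - 1) * x₀.2) = 1 := by
        field_simp
        rw [hN']
        ring
      rw [hone] at this
      exact one_ne_zero this

end Diliberto

end PlanarODE
end

/-! ### The quadratic estimate behind the Lyapunov function. -/

open Set Filter Topology

noncomputable section

namespace PlanarODE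

open MeasureTheory Metric

theorem norm_sq_le_dot_self (u : Plane) : ‖u‖ ^ 2 ≤ dot u u := by
  have h0 : 0 ≤ dot u u := by unfold dot; nlinarith [sq_nonneg u.1, sq_nonneg u.2]
  refine (sq_le_sq₀ (norm_nonneg _) (Real.sqrt_nonneg _)).2 ?_ |>.trans_eq (Real.sq_sqrt h0)
  rw [Prod.norm_def]
  refine max_le (Real.abs_le_sqrt ?_) (Real.abs_le_sqrt ?_)
  · unfold dot; nlinarith [sq_nonneg u.2]
  · unfold dot; nlinarith [sq_nonneg u.1]

/-- The trace of the matrix is the sum of its tangential and normal diagonal entries with respect to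
`(x, y)`. The form thus vanishes on the normal to `(x, y)`, and `⟨(u, v), (x, y)⟩` factors out. -/
theorem quadratic_form_eq {u v x y a b c d : ℝ} (hD : x ^ 2 + y ^ 2 ≠ 0) :
    2 * (u * (a * u + b * v) + v * (c * u + d * v)) +
      (2 * (x * (a * x + b * y) + y * (c * x + d * y)) / (x ^ 2 + y ^ 2) - 2 * (a + d)) *
        (u * u + v * v) =
    2 * (u * x + v * y) * ((u * x + v * y) *
      ((x * (a * x + b * y) + y * (c * x + d * y)) -
        (-y * (-a * y + b * x) + x * (-c * y + d * x))) + (v * x - u * y) *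
      ((x * (-a * y + b * x) + y * (-c * y + d * x)) +
        (-y * (a * x + b * y) + x * (c * x + d * y)))) / (x ^ 2 + y ^ 2) ^ 2 := by
  field_simp
  ring

theorem exists_uniform_differentiability {Y : Plane → Plane} (hY : ContDiff ℝ 1 Y)
    (hYc : HasCompactSupport Y) {δ : ℝ} (hδ : 0 < δ) :
    ∃ r > 0, ∀ z w, dist z w ≤ r → ‖Y z - Y w - fderiv ℝ Y w (z - w)‖ ≤ δ * ‖z - w‖ := by
  have huc : UniformContinuous (fderiv ℝ Y) := (hYc.fderiv ℝ).uniformContinuous_of_continuous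
    (hY.continuous_fderiv one_ne_zero)
  obtain ⟨r, hr, h⟩ := Metric.uniformContinuous_iff.1 huc δ hδ
  refine ⟨r / 2, half_pos hr, fun z w hzw => ?_⟩
  refine (convex_closedBall w (r / 2)).norm_image_sub_le_of_norm_fderiv_le'
    (fun x _ => (hY.differentiable one_ne_zero) x) (fun x hx => ?_)
    (mem_closedBall_self (half_pos hr).le) hzw
  rw [← dist_eq_norm]
  exact (h ((mem_closedBall.1 hx).trans_lt (half_lt_self hr))).le

section Attractor

variable {X : Plane → Plane} {γ : ℝ → Plane} {T m : ℝ}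

/-- The logarithmic derivative of the weight in the Lyapunov function of a periodic orbit. -/
def weightSlope (X : Plane → Plane) (γ : ℝ → Plane) (m t : ℝ) : ℝ :=
  2 * dot (X (γ t)) (fderiv ℝ X (γ t) (X (γ t))) / dot (X (γ t)) (X (γ t)) -
    2 * (divergence X (γ t) - m)

/-- The stationarity condition makes the tangential component `⟨u, X⟩` of `u = z - γ t` of second
order in `u`. By `quadratic_form_eq` the quadratic part is then `2 m |u|²` up to third order, and
the Taylor remainder is also small compared with `|u|²`. -/
theorem stationary_estimate (hX : ContDiff ℝ 1 X) (hXc : HasCompactSupport X)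
    (hγ : ∀ t, HasDerivAt γ (X (γ t)) t) (hreg : ∀ t, X (γ t) ≠ 0) (hm : m < 0) :
    ∃ r > 0, ∀ z, ∀ t ∈ Icc 0 T, ‖z - γ t‖ ≤ r → z ≠ γ t →
      dot (z - γ t) (z - γ t) * weightSlope X γ m t = 2 * dot (z - γ t) (X (γ t)) →
      2 * dot (z - γ t) (X z - X (γ t)) +
        dot (z - γ t) (z - γ t) * weightSlope X γ m t < m / 2 * dot (z - γ t) (z - γ t) := by
  set f : ℝ → Plane →L[ℝ] Plane := fun t => fderiv ℝ X (γ t) with hf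
  set x : ℝ → ℝ := fun t => (X (γ t)).1 with hx
  set y : ℝ → ℝ := fun t => (X (γ t)).2 with hy
  have hγc : Continuous γ := continuous_iff_continuousAt.2 fun t => (hγ t).continuousAt
  have hfc : Continuous f := (hX.continuous_fderiv one_ne_zero).comp hγc
  have hXγ : Continuous fun t => X (γ t) := hX.continuous.comp hγc
  have hxc : Continuous x := hXγ.fst
  have hyc : Continuous y := hXγ.snd
  set a : ℝ → ℝ := fun t => (f t (1, 0)).1 with ha
  set b : ℝ → ℝ := fun t => (f t (0, 1)).1 with hb
  set c : ℝ → ℝ := fun t => (f t (1, 0)).2 with hc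
  set d : ℝ → ℝ := fun t => (f t (0, 1)).2 with hd
  have hac : Continuous a := (hfc.clm_apply continuous_const).fst
  have hbc : Continuous b := (hfc.clm_apply continuous_const).fst
  have hcc : Continuous c := (hfc.clm_apply continuous_const).snd
  have hdc : Continuous d := (hfc.clm_apply continuous_const).snd
  have hpos : ∀ t, 0 < x t ^ 2 + y t ^ 2 := fun t => by
    rw [sq, sq]; exact dot_self_pos (hreg t)
  have hsl : ∀ t, weightSlope X γ m t = 2 * (x t * (a t * x t + b t * y t) +
      y t * (c t * x t + d t * y t)) / (x t ^ 2 + y t ^ 2) - 2 * (a t + d t - m) := fun t => by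
    simp only [weightSlope, dot, apply_fst_eq (fderiv ℝ X (γ t)) (X (γ t)),
      apply_snd_eq (fderiv ℝ X (γ t)) (X (γ t)), sq]
    rfl
  have hslc : Continuous (weightSlope X γ m) := by
    rw [funext hsl]
    exact ((by fun_prop : Continuous fun t => 2 * (x t * (a t * x t + b t * y t) +
      y t * (c t * x t + d t * y t))).div (by fun_prop) fun t => (hpos t).ne').sub (by fun_prop)
  set a₁ : ℝ → ℝ := fun t => (x t * (a t * x t + b t * y t) + y t * (c t * x t + d t * y t)) -
        (-y t * (-a t * y t + b t * x t) + x t * (-c t * y t + d t * x t)) with ha₁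
  set a₂ : ℝ → ℝ := fun t => (x t * (-a t * y t + b t * x t) + y t * (-c t * y t + d t * x t)) +
        (-y t * (a t * x t + b t * y t) + x t * (c t * x t + d t * y t)) with ha₂
  set κ : ℝ → ℝ := fun t => |weightSlope X γ m t| * (2 * ‖X (γ t)‖ * (|a₁ t| + |a₂ t|)) /
    (x t ^ 2 + y t ^ 2) ^ 2 with hκ
  have hκc : Continuous κ := by
    refine Continuous.div ?_ (by fun_prop) fun t => (pow_pos (hpos t) 2).ne'
    exact hslc.abs.mul ((continuous_const.mul hXγ.norm).mul
      ((by fun_prop : Continuous a₁).abs.add (by fun_prop : Continuous a₂).abs))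
  obtain ⟨K, hK⟩ := (isCompact_Icc (a := (0 : ℝ)) (b := T)).bddAbove_image hκc.continuousOn
  obtain ⟨r, hr, hdiff⟩ := exists_uniform_differentiability hX hXc (δ := -m / 8) (by linarith)
  -- The radius makes the cubic term at most `(-m / 2) N`, and `δ = -m / 8` does the same for the
  -- remainder; of `2 m N` there remains `m N < (m / 2) N`.
  refine ⟨min r (-m / (2 * (|K| + 1))), lt_min hr (div_pos (by linarith) (by positivity)),
    fun z t ht hzr hz hstat => ?_⟩
  set u := z - γ t with hu
  set N := dot u u with hN
  have hNpos : 0 < N := dot_self_pos (sub_ne_zero.2 hz)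
  have hN2 : ‖u‖ ^ 2 ≤ N := norm_sq_le_dot_self u
  set e := X z - X (γ t) - f t u with he
  have hed : ‖e‖ ≤ -m / 8 * ‖u‖ :=
    hdiff z (γ t) (by rw [dist_eq_norm]; exact hzr.trans (min_le_left _ _))
  have hsplit : dot u (X z - X (γ t)) = dot u (f t u) + dot u e := by
    rw [he]
    simp only [dot, Prod.fst_sub, Prod.snd_sub]
    ring
  have h1 : 2 * dot u e ≤ -m / 2 * N := by
    have := (le_abs_self _).trans (abs_dot_le u e)
    have h2 : ‖u‖ * ‖e‖ ≤ ‖u‖ * (-m / 8 * ‖u‖) := by gcongr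
    have h3 : -m / 2 * ‖u‖ ^ 2 ≤ -m / 2 * N := by
      apply mul_le_mul_of_nonneg_left hN2
      linarith
    nlinarith
  have hquad := quadratic_form_eq (u := u.1) (v := u.2) (a := a t) (b := b t) (c := c t) (d := d t)
    (hpos t).ne'
  have hfu : dot u (f t u) =
      u.1 * (a t * u.1 + b t * u.2) + u.2 * (c t * u.1 + d t * u.2) := by
    rw [dot, apply_fst_eq, apply_snd_eq]
  have hp : 2 * (u.1 * x t + u.2 * y t) = N * weightSlope X γ m t := hstat.symm
  have hp' : |u.1 * x t + u.2 * y t| ≤ 2 * (‖u‖ * ‖X (γ t)‖) := abs_dot_le u (X (γ t))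
  have hk' : |u.2 * x t - u.1 * y t| ≤ 2 * (‖u‖ * ‖X (γ t)‖) := by
    have := abs_cross_le u (X (γ t))
    rwa [cross, abs_sub_comm] at this
  have h2 : 2 * dot u (f t u) + N * weightSlope X γ m t ≤ 2 * m * N + N * (κ t * ‖u‖) := by
    have e1 : 2 * dot u (f t u) + N * weightSlope X γ m t = 2 * m * N +
        2 * (u.1 * x t + u.2 * y t) * ((u.1 * x t + u.2 * y t) * a₁ t +
          (u.2 * x t - u.1 * y t) * a₂ t) / (x t ^ 2 + y t ^ 2) ^ 2 := by
      rw [← hquad, hfu, hsl, hN, dot]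
      ring
    rw [e1, hp]
    have e2 : (u.1 * x t + u.2 * y t) * a₁ t + (u.2 * x t - u.1 * y t) * a₂ t ≤
        |(u.1 * x t + u.2 * y t) * a₁ t + (u.2 * x t - u.1 * y t) * a₂ t| := le_abs_self _
    have e3 : |(u.1 * x t + u.2 * y t) * a₁ t + (u.2 * x t - u.1 * y t) * a₂ t| ≤
        2 * (‖u‖ * ‖X (γ t)‖) * (|a₁ t| + |a₂ t|) := by
      refine (abs_add_le _ _).trans ?_
      rw [abs_mul, abs_mul, mul_add]
      gcongr
    have e4 : weightSlope X γ m t * ((u.1 * x t + u.2 * y t) * a₁ t +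
        (u.2 * x t - u.1 * y t) * a₂ t) ≤
        |weightSlope X γ m t| * (2 * (‖u‖ * ‖X (γ t)‖) * (|a₁ t| + |a₂ t|)) := by
      refine (le_abs_self _).trans ?_
      rw [abs_mul]
      gcongr
    have e5 : N * weightSlope X γ m t * ((u.1 * x t + u.2 * y t) * a₁ t +
        (u.2 * x t - u.1 * y t) * a₂ t) / (x t ^ 2 + y t ^ 2) ^ 2 ≤
        N * (|weightSlope X γ m t| * (2 * (‖u‖ * ‖X (γ t)‖) * (|a₁ t| + |a₂ t|))) /
          (x t ^ 2 + y t ^ 2) ^ 2 := by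
      rw [mul_assoc]
      gcongr
    refine (add_le_add_right e5 _).trans_eq ?_
    simp only [hκ]
    ring
  have h3 : κ t * ‖u‖ ≤ -m / 2 := by
    have k1 : κ t ≤ |K| + 1 := (hK ⟨t, ht, rfl⟩).trans ((le_abs_self K).trans (by linarith))
    have hK1 : 0 < |K| + 1 := by positivity
    calc κ t * ‖u‖ ≤ (|K| + 1) * ‖u‖ := by gcongr
      _ ≤ (|K| + 1) * (-m / (2 * (|K| + 1))) := by
          gcongr
          exact hzr.trans (min_le_right _ _)
      _ = -m / 2 := by field_simp
  rw [hsplit]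
  have h4 : N * (κ t * ‖u‖) ≤ N * (-m / 2) := by gcongr
  nlinarith

end Attractor

end PlanarODE
end

/-! ### The Lyapunov function of a periodic orbit, and stability. -/

open Set Filter Topology

noncomputable section

namespace PlanarODE

open MeasureTheory Metric

theorem hasDerivAt_dot {σ w : ℝ → Plane} {v v' : Plane} {t : ℝ} (h : HasDerivAt σ v t)
    (h' : HasDerivAt w v' t) :
    HasDerivAt (fun t => dot (σ t) (w t)) (dot v (w t) + dot (σ t) v') t := by
  refine (((hasDerivAt_fst_of h).mul (hasDerivAt_fst_of h')).add
    ((hasDerivAt_snd_of h).mul (hasDerivAt_snd_of h'))).congr_deriv ?_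
  simp only [dot]
  ring

theorem continuous_dot_comp {A : Type*} [TopologicalSpace A] {f g : A → Plane} (hf : Continuous f)
    (hg : Continuous g) : Continuous fun a => dot (f a) (g a) :=
  (hf.fst.mul hg.fst).add (hf.snd.mul hg.snd)

section Attractor

variable {X : Plane → Plane} {γ : ℝ → Plane} {T m : ℝ}

/-- The weighted distance function to a periodic orbit. -/
def weightedSq (γ : ℝ → Plane) (ρ : ℝ → ℝ) (z : Plane) (t : ℝ) : ℝ :=
  dot (z - γ t) (z - γ t) * ρ t

theorem hasDerivAt_weightedSq {σ w : ℝ → Plane} {ρ : ℝ → ℝ} {v v' : Plane} {s t : ℝ}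
    (h : HasDerivAt σ v t) (h' : HasDerivAt w v' t) (hρ : HasDerivAt ρ (ρ t * s) t) :
    HasDerivAt (fun t => dot (σ t - w t) (σ t - w t) * ρ t)
      ((2 * dot (σ t - w t) (v - v') + dot (σ t - w t) (σ t - w t) * s) * ρ t) t := by
  refine ((hasDerivAt_dot (h.sub h') (h.sub h')).mul hρ).congr_deriv ?_
  simp only [dot, Pi.sub_apply]
  ring

/-- Exponential decay of the weighted distance to a periodic orbit. -/
theorem exists_weighted_decay {φ : ℝ → Plane → Plane} (hX : ContDiff ℝ 1 X)
    (hXc : HasCompactSupport X) (hφ : IsFlow X φ)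
    (hγ : ∀ t, HasDerivAt γ (X (γ t)) t) (hreg : ∀ t, X (γ t) ≠ 0) (hT : 0 < T)
    (hper : Function.Periodic γ T) (hm : m < 0) {ρ : ℝ → ℝ} (hρpos : ∀ t, 0 < ρ t)
    (hρ : ∀ t, HasDerivAt ρ (ρ t * weightSlope X γ m t) t) (hρper : Function.Periodic ρ T) :
    ∃ Φ : Plane → ℝ, Continuous Φ ∧ (∀ t, Φ (γ t) = 0) ∧
      (∃ ρ₀ > 0, ∀ z, ρ₀ * infDist z (range γ) ^ 2 ≤ Φ z) ∧
      ∃ c > 0, ∀ c' ∈ Ioc 0 c, ∀ z, Φ z ≤ c' → ∀ t ≥ 0, Φ (φ t z) ≤ c' * Real.exp (m / 2 * t) := by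
  have hγc : Continuous γ := continuous_iff_continuousAt.2 fun t => (hγ t).continuousAt
  have hρc : Continuous ρ := continuous_iff_continuousAt.2 fun t => (hρ t).continuousAt
  have hne : (Icc 0 T).Nonempty := ⟨0, le_rfl, hT.le⟩
  obtain ⟨r, hr, hest⟩ := stationary_estimate (T := T) hX hXc hγ hreg hm
  obtain ⟨t₀, -, ht₀⟩ := isCompact_Icc.exists_isMinOn hne hρc.continuousOn
  set ρ₀ := ρ t₀ with hρ₀
  have hρ₀pos : 0 < ρ₀ := hρpos t₀
  have hFc : Continuous ↿(weightedSq γ ρ) := by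
    have h1 : Continuous fun p : Plane × ℝ => p.1 - γ p.2 :=
      continuous_fst.sub (hγc.comp continuous_snd)
    exact (continuous_dot_comp h1 h1).mul (hρc.comp continuous_snd)
  have hFcz : ∀ z, Continuous (weightedSq γ ρ z) := fun z =>
    hFc.comp (Continuous.prodMk_right z)
  have hdotnn : ∀ u : Plane, 0 ≤ dot u u := fun u => (sq_nonneg _).trans (norm_sq_le_dot_self u)
  -- The minimum over `t` of the weighted squared distance to `γ t`; by periodicity it is a minimum
  -- over all times.
  set Φ : Plane → ℝ := fun z => sInf (weightedSq γ ρ z '' Icc 0 T) with hΦ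
  have hΦc : Continuous Φ := isCompact_Icc.continuous_sInf hFc
  have hFper : ∀ z, Function.Periodic (weightedSq γ ρ z) T := fun z t => by
    simp only [weightedSq, hper t, hρper t]
  have hmin : ∀ z, ∃ t ∈ Icc 0 T, Φ z = weightedSq γ ρ z t ∧ ∀ s, Φ z ≤ weightedSq γ ρ z s := by
    intro z
    obtain ⟨t, ht, he, hle⟩ := isCompact_Icc.exists_sInf_image_eq_and_le hne (hFcz z).continuousOn
    refine ⟨t, ht, he, fun s => ?_⟩
    obtain ⟨s', hs', hss'⟩ := (hFper z).exists_mem_Ico₀ hT s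
    rw [hss', hΦ]
    simp only
    rw [he]
    exact hle s' (Ico_subset_Icc_self hs')
  choose θ hθ hθeq hθle using hmin
  have hΦnn : ∀ z, 0 ≤ Φ z := fun z => by
    rw [hθeq]
    exact mul_nonneg (hdotnn _) (hρpos _).le
  have hlow : ∀ z, ρ₀ * ‖z - γ (θ z)‖ ^ 2 ≤ Φ z := fun z => by
    rw [hθeq, weightedSq, mul_comm]
    have h1 := norm_sq_le_dot_self (z - γ (θ z))
    have h2 : ρ₀ ≤ ρ (θ z) := ht₀ (hθ z)
    gcongr
    exact hdotnn _
  refine ⟨Φ, hΦc, fun t => ?_, ⟨ρ₀, hρ₀pos, fun z => ?_⟩, ρ₀ * r ^ 2, by positivity, ?_⟩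
  · refine le_antisymm ((hθle (γ t) t).trans_eq ?_) (hΦnn _)
    simp [weightedSq, dot]
  · refine le_trans ?_ (hlow z)
    gcongr
    · exact infDist_nonneg
    · rw [← dist_eq_norm]
      exact infDist_le_dist_of_mem (mem_range_self _)
  · intro c' hc' z hz t ht
    set D : Plane → ℝ := fun z => (2 * dot (z - γ (θ z)) (X z - X (γ (θ z))) +
      dot (z - γ (θ z)) (z - γ (θ z)) * weightSlope X γ m (θ z)) * ρ (θ z) with hD
    have hB : ∀ s, HasDerivAt (fun s => c' * Real.exp (m / 2 * s))
        (m / 2 * (c' * Real.exp (m / 2 * s))) s := fun s =>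
      (((hasDerivAt_id s).const_mul (m / 2)).exp.const_mul c').congr_deriv (by simp; ring)
    -- `Φ` need not be differentiable along the flow. A fencing argument asks only for an upper
    -- bound of its right slopes, which must be below the slope of the barrier where the two meet.
    refine image_le_of_liminf_slope_right_lt_deriv_boundary (f := fun s => Φ (φ s z))
      (f' := fun s => D (φ s z)) (a := 0) (b := t)
      (hΦc.comp (hφ.continuous_time z)).continuousOn (fun s _ b hb => ?_)
      (by simpa [hφ.zero] using hz) hB (fun s hs he => ?_) ⟨ht, le_rfl⟩
    · set w := φ s z with hw
      -- The competitor in the minimum moves along the orbit together with the flow, which bounds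
      -- the slopes of `Φ` from above.
      have hshift : HasDerivAt (fun y => θ w + (y - s)) 1 s :=
        ((hasDerivAt_id s).sub_const s).const_add (θ w)
      have hval : θ w + (s - s) = θ w := by simp
      have h1 : HasDerivAt (fun y => γ (θ w + (y - s))) (X (γ (θ w))) s := by
        have := (hγ (θ w + (s - s))).scomp s hshift
        rw [one_smul] at this
        rwa [hval] at this
      have h2 : HasDerivAt (fun y => ρ (θ w + (y - s))) (ρ (θ w) * weightSlope X γ m (θ w)) s := by
        have := (hρ (θ w + (s - s))).comp s hshift
        rw [mul_one] at this
        rwa [hval] at this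
      have h3 := hasDerivAt_weightedSq (ρ := fun y => ρ (θ w + (y - s)))
        (s := weightSlope X γ m (θ w)) (hφ.hasDerivAt z s) h1 (by simpa only [hval] using h2)
      rw [hval] at h3
      have h4 := (hasDerivAt_iff_tendsto_slope.1 h3).mono_left
        (nhdsWithin_mono s fun y (hy : s < y) => hy.ne')
      refine Eventually.frequently ?_
      filter_upwards [h4.eventually (gt_mem_nhds hb), self_mem_nhdsWithin] with y hy hsy
      refine lt_of_le_of_lt ?_ hy
      have hys : 0 < y - s := sub_pos.2 hsy
      rw [slope_def_field, slope_def_field]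
      have e1 : Φ (φ y z) ≤ weightedSq γ ρ (φ y z) (θ w + (y - s)) := hθle _ _
      have e2 : Φ w = weightedSq γ ρ w (θ w) := hθeq w
      simp only [hval]
      change (Φ (φ y z) - Φ w) / _ ≤
        (weightedSq γ ρ (φ y z) (θ w + (y - s)) - weightedSq γ ρ w (θ w)) / _
      rw [e2]
      gcongr
    · set w := φ s z with hw
      have hΦpos : 0 < Φ w := by
        have he' : Φ w = c' * Real.exp (m / 2 * s) := he
        rw [he']
        exact mul_pos hc'.1 (Real.exp_pos _)
      have hΦle : Φ w ≤ ρ₀ * r ^ 2 := by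
        have he' : Φ w = c' * Real.exp (m / 2 * s) := he
        rw [he']
        refine le_trans (mul_le_of_le_one_right hc'.1.le ?_) hc'.2
        rw [Real.exp_le_one_iff]
        exact mul_nonpos_of_nonpos_of_nonneg (by linarith) hs.1
      have hnorm : ‖w - γ (θ w)‖ ≤ r := by
        have h1 := (hlow w).trans hΦle
        exact (sq_le_sq₀ (norm_nonneg _) hr.le).1 (le_of_mul_le_mul_left h1 hρ₀pos)
      have hwne : w ≠ γ (θ w) := by
        intro h
        rw [hθeq, weightedSq, ← h, sub_self] at hΦpos
        simp [dot] at hΦpos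
      have hder := hasDerivAt_weightedSq (hasDerivAt_const (θ w) w) (hγ (θ w)) (hρ (θ w))
      -- Minimality of `θ w` is the stationarity required by `stationary_estimate`.
      have hmin : IsLocalMin (weightedSq γ ρ w) (θ w) :=
        Eventually.of_forall fun s => (hθeq w).symm.trans_le (hθle w s)
      have h0 := hmin.hasDerivAt_eq_zero hder
      have h0' := (mul_eq_zero.1 h0).resolve_right (hρpos _).ne'
      have hstat : dot (w - γ (θ w)) (w - γ (θ w)) * weightSlope X γ m (θ w) =
          2 * dot (w - γ (θ w)) (X (γ (θ w))) := by
        simp only [dot, Prod.fst_sub, Prod.snd_sub, Prod.fst_zero, Prod.snd_zero] at h0' ⊢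
        linear_combination h0'
      have hlt := hest w (θ w) (hθ w) hnorm hwne hstat
      have he' : Φ w = c' * Real.exp (m / 2 * s) := he
      change D w < m / 2 * (c' * Real.exp (m / 2 * s))
      rw [← he', hθeq w, weightedSq, ← mul_assoc]
      exact mul_lt_mul_of_pos_right hlt (hρpos _)

/-- A periodic orbit along which the integral of the divergence is negative is an attractor. -/
theorem isAttractor_of_primitive {U : Set Plane} (hU : IsOpen U) (hX : ContDiffOn ℝ 1 X U)
    (hγ : IsPeriodicSolution X γ T) (hγU : ∀ t, γ t ∈ U) {G : ℝ → ℝ}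
    (hG : ∀ t, HasDerivAt G (divergence X (γ t)) t) {d : ℝ} (hd : d < 0)
    (hGT : ∀ t, G (t + T) = G t + d) : IsAttractor X (range γ) := by
  have hsol : ∀ t, HasDerivAt γ (X (γ t)) t := hγ.solution
  have hT := hγ.period_pos
  have hΓc : IsCompact (range γ) := IsPeriodicOrbit.isCompact (X := X) ⟨γ, T, hγ, rfl⟩
  have hΓne : (range γ).Nonempty := range_nonempty γ
  obtain ⟨Y, O, L, φ, hO, hΓO, -, hYX, hY, hYc, hL, hφ⟩ := exists_complete_extension hU hΓc
    (range_subset_iff.2 hγU) hX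
  have hγO : ∀ t, γ t ∈ O := fun t => hΓO (mem_range_self t)
  have hYγ : ∀ t, Y (γ t) = X (γ t) := fun t => hYX (hγO t)
  have hdivY : ∀ t, divergence Y (γ t) = divergence X (γ t) := fun t => by
    have : Y =ᶠ[𝓝 (γ t)] X := hYX.eventuallyEq_of_mem (hO.mem_nhds (hγO t))
    rw [divergence, divergence, this.fderiv_eq]
  have hsolY : ∀ t, HasDerivAt γ (Y (γ t)) t := fun t => by rw [hYγ]; exact hsol t
  have hregY : ∀ t, Y (γ t) ≠ 0 := fun t => by rw [hYγ]; exact hγ.regular t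
  set m := d / T with hm
  have hm0 : m < 0 := div_neg_of_neg_of_pos hd hT
  -- `weightSlope` is the logarithmic derivative of this weight; the choice `m = d / T` makes `G t -
  -- m t`, hence `ρ`, periodic.
  set ρ : ℝ → ℝ := fun t => dot (Y (γ t)) (Y (γ t)) * Real.exp (-(2 * (G t - m * t))) with hρdef
  have hρpos : ∀ t, 0 < ρ t := fun t => mul_pos (dot_self_pos (hregY t)) (Real.exp_pos _)
  have hρ : ∀ t, HasDerivAt ρ (ρ t * weightSlope Y γ m t) t := fun t => by
    have h1 := hasDerivAt_field_along isOpen_univ hY.contDiffOn (hsolY t) (mem_univ _)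
    have h2 := ((((hG t).sub ((hasDerivAt_id t).const_mul m)).const_mul 2).neg).exp
    refine ((hasDerivAt_dot h1 h1).mul h2).congr_deriv ?_
    have hne := (dot_self_pos (hregY t)).ne'
    have hsymm : dot (fderiv ℝ Y (γ t) (Y (γ t))) (Y (γ t)) =
        dot (Y (γ t)) (fderiv ℝ Y (γ t) (Y (γ t))) := by simp only [dot]; ring
    rw [hsymm]
    simp only [hρdef, weightSlope, hdivY, mul_one, Pi.neg_apply, Pi.sub_apply, id]
    field_simp
    ring
  have hρper : Function.Periodic ρ T := fun t => by
    have h1 : G (t + T) - m * (t + T) = G t - m * t := by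
      rw [hGT, hm]
      field_simp
      ring
    simp only [hρdef, hγ.periodic t, h1]
  obtain ⟨Φ, hΦc, hΦ0, ⟨ρ₀, hρ₀, hlow⟩, c, hc, hdecay⟩ := exists_weighted_decay hY hYc hφ hsolY
    hregY hT hγ.periodic hm0 hρpos hρ hρper
  intro W hW hΓW
  obtain ⟨η, hη, hηW⟩ := hΓc.exists_thickening_subset_open (hO.inter hW) (subset_inter hΓO hΓW)
  set c' := min c (ρ₀ * η ^ 2 / 2) with hc'
  have hc'pos : 0 < c' := by positivity
  have hinf : ∀ w, Φ w ≤ c' → infDist w (range γ) < η := by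
    intro w hw
    have h1 : ρ₀ * infDist w (range γ) ^ 2 < ρ₀ * η ^ 2 := by
      refine ((hlow w).trans (hw.trans (min_le_right _ _))).trans_lt ?_
      have : 0 < ρ₀ * η ^ 2 := by positivity
      linarith
    exact (sq_lt_sq₀ infDist_nonneg hη.le).1 (lt_of_mul_lt_mul_left h1 hρ₀.le)
  refine ⟨{z | Φ z < c'}, isOpen_lt hΦc continuous_const, ?_, fun z hz => ?_⟩
  · rintro _ ⟨t, rfl⟩
    change Φ (γ t) < c'
    rw [hΦ0]
    exact hc'pos
  · have hdec := hdecay c' ⟨hc'pos, min_le_left _ _⟩ z (le_of_lt hz)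
    have hmem : ∀ t ≥ 0, φ t z ∈ O ∩ W := fun t ht =>
      hηW ((mem_thickening_iff_infDist_lt hΓne).2 (hinf _ ((hdec t ht).trans
        (mul_le_of_le_one_right hc'pos.le (Real.exp_le_one_iff.2
          (mul_nonpos_of_nonpos_of_nonneg (by linarith) ht))))))
    refine ⟨fun t => φ t z, fun t ht => ?_, hφ.zero z, fun t ht => (hmem t ht).2, ?_⟩
    · have := hφ.hasDerivAt z t
      rw [hYX (hmem t ht).1] at this
      exact this.hasDerivWithinAt
    · have hsq : Tendsto (fun t => infDist (φ t z) (range γ) ^ 2) atTop (𝓝 0) := by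
        have h1 : Tendsto (fun t => c' / ρ₀ * Real.exp (m / 2 * t)) atTop (𝓝 (c' / ρ₀ * 0)) :=
          (Real.tendsto_exp_atBot.comp
            (tendsto_id.const_mul_atTop_of_neg (by linarith : m / 2 < 0))).const_mul _
        rw [mul_zero] at h1
        refine tendsto_of_tendsto_of_tendsto_of_le_of_le' tendsto_const_nhds h1
          (Eventually.of_forall fun t => sq_nonneg _) ?_
        filter_upwards [eventually_ge_atTop 0] with t ht
        rw [div_mul_eq_mul_div, le_div_iff₀ hρ₀, mul_comm]
        exact (hlow _).trans (hdec t ht)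
      have h2 := hsq.sqrt
      rw [Real.sqrt_zero] at h2
      exact h2.congr fun t => Real.sqrt_sq infDist_nonneg

/-- A periodic orbit along which the integral of the divergence is positive is a repeller. -/
theorem isRepeller_of_primitive {U : Set Plane} (hU : IsOpen U) (hX : ContDiffOn ℝ 1 X U)
    (hγ : IsPeriodicSolution X γ T) (hγU : ∀ t, γ t ∈ U) {G : ℝ → ℝ}
    (hG : ∀ t, HasDerivAt G (divergence X (γ t)) t) {d : ℝ} (hd : 0 < d)
    (hGT : ∀ t, G (t + T) = G t + d) : IsRepeller X (range γ) := by
  have hsol : ∀ t, HasDerivAt γ (X (γ t)) t := hγ.solution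
  have hγ' : IsPeriodicSolution (fun z => -X z) (fun t => γ (-t)) T := by
    refine ⟨fun t => ?_, fun t => neg_ne_zero.2 (hγ.regular (-t)), hγ.period_pos, fun t => ?_⟩
    · exact ((hsol (-t)).scomp t (hasDerivAt_neg t)).congr_deriv (by simp)
    · have := hγ.periodic (-t - T)
      rw [sub_add_cancel] at this
      simp only [neg_add]
      rw [this, sub_eq_add_neg]
  have hr : range (fun t => γ (-t)) = range γ := (Equiv.neg ℝ).surjective.range_comp γ
  have := isAttractor_of_primitive hU hX.neg hγ' (fun t => hγU (-t)) (G := fun t => G (-t))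
    (fun t => ?_) (neg_neg_of_pos hd) (fun t => ?_)
  · rwa [hr] at this
  · refine ((hG (-t)).comp t (hasDerivAt_neg t)).congr_deriv ?_
    simp only [divergence]
    rw [fderiv_fun_neg]
    simp
    ring
  · have := hGT (-t - T)
    rw [sub_add_cancel] at this
    simp only [neg_add]
    rw [this, ← sub_eq_add_neg]
    ring

end Attractor

end PlanarODE
end

/-! ### Assembling the criterion. -/

open Set Filter Topology

noncomputable section

namespace PlanarODE

open MeasureTheory Metric

theorem contDiff_eval_mvPolynomial (p : MvPolynomial (Fin 2) ℝ) :
    ContDiff ℝ 1 fun z : Plane => MvPolynomial.eval ![z.1, z.2] p := by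
  induction p using MvPolynomial.induction_on with
  | C a => simpa using contDiff_const
  | add p q hp hq => simpa using hp.add hq
  | mul_X p i hp =>
    have hi : ContDiff ℝ 1 fun z : Plane => (![z.1, z.2] : Fin 2 → ℝ) i := by
      fin_cases i
      · exact contDiff_fst
      · exact contDiff_snd
    simpa using hp.mul hi

theorem contDiffOn_ratFun {U : Set Plane} {p q : MvPolynomial (Fin 2) ℝ}
    (hq : ∀ z ∈ U, MvPolynomial.eval ![z.1, z.2] q ≠ 0) : ContDiffOn ℝ 1 (ratFun p q) U :=
  (contDiff_eval_mvPolynomial p).contDiffOn.div (contDiff_eval_mvPolynomial q).contDiffOn hq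

section Dulac

variable {X : Plane → Plane} {U : Set Plane} {V : Plane → ℝ} {k : ℝ}

/-- The integral of the divergence along a periodic orbit has the sign of `-V`. -/
theorem exists_divergence_primitive (hU : IsOpen U) (hX : ContDiffOn ℝ 1 X U)
    (hV : ContDiffOn ℝ 1 V U) (hk : 0 < k) (hM : ∀ z ∈ U, 0 ≤ dulacM V k X z) {γ : ℝ → Plane}
    {T : ℝ} (hγ : IsPeriodicSolution X γ T) (hγU : ∀ t, γ t ∈ U) {t₀ : ℝ}
    (hMt : dulacM V k X (γ t₀) ≠ 0) :
    ∃ (G : ℝ → ℝ) (d : ℝ), (∀ t, HasDerivAt G (divergence X (γ t)) t) ∧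
      (∀ t, G (t + T) = G t + d) ∧ (0 < V (γ t₀) → d < 0) ∧ (V (γ t₀) < 0 → 0 < d) := by
  have hsol : ∀ t, HasDerivAt γ (X (γ t)) t := hγ.solution
  have hT := hγ.period_pos
  have hγc : Continuous γ := continuous_iff_continuousAt.2 fun t => (hsol t).continuousAt
  have hdc : Continuous fun t => divergence X (γ t) :=
    (continuousOn_divergence hU hX).comp_continuous hγc hγU
  set G : ℝ → ℝ := fun t => ∫ s in (0 : ℝ)..t, divergence X (γ s) with hGdef
  have hG : ∀ t, HasDerivAt G (divergence X (γ t)) t := fun t =>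
    (hdc.integral_hasStrictDerivAt 0 t).hasDerivAt
  have hdiff : ∀ t, HasDerivAt (fun t => G (t + T) - G t) 0 t := fun t => by
    have := ((hG (t + T)).comp_add_const t T).sub (hG t)
    rwa [hγ.periodic t, sub_self] at this
  have hGT : ∀ t, G (t + T) = G t + (G (t₀ + T) - G t₀) := fun t => by
    have := is_const_of_deriv_eq_zero (f := fun t => G (t + T) - G t)
      (fun t => (hdiff t).differentiableAt) (fun t => (hdiff t).deriv) t t₀
    linarith
  set H : ℝ → ℝ := fun t => V (γ t) * Real.exp (-(k * G t)) with hH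
  have hHd : ∀ t, HasDerivAt H (dulacM V k X (γ t) * Real.exp (-(k * G t))) t := by
    intro t
    refine ((hasDerivAt_comp_solution hU hV (k := k) (hsol t) (hγU t)).mul
      ((hG t).const_mul k).neg.exp).congr_deriv ?_
    simp only [Pi.neg_apply]
    ring
  have hmono : Monotone H := monotone_of_deriv_nonneg (fun t => (hHd t).differentiableAt)
    fun t => by
      rw [(hHd t).deriv]
      exact mul_nonneg (hM _ (hγU t)) (Real.exp_pos _).le
  -- `H` is monotone with nonzero derivative at `t₀`. As `V ∘ γ` has equal values at `t₀` and `t₀ +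
  -- T`, the strict growth concerns the exponential factor only, and the sign of `V` decides that of
  -- `d`.
  have hlt : H t₀ < H (t₀ + T) := by
    have h1 : ∀ᶠ s in 𝓝[>] t₀, H s ≠ H t₀ := nhdsWithin_mono _ (fun s (hs : t₀ < s) => hs.ne')
      ((hHd t₀).eventually_ne (mul_ne_zero hMt (Real.exp_ne_zero _)))
    obtain ⟨s, hs, hs'⟩ := (h1.and (Ioo_mem_nhdsGT (show t₀ < t₀ + T by linarith))).exists
    exact (lt_of_le_of_ne (hmono hs'.1.le) hs.symm).trans_le (hmono hs'.2.le)
  simp only [hH, hγ.periodic t₀] at hlt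
  refine ⟨G, G (t₀ + T) - G t₀, hG, hGT, fun hpos => ?_, fun hneg => ?_⟩
  · have h1 := Real.exp_lt_exp.1 (lt_of_mul_lt_mul_left hlt hpos.le)
    have h2 : G (t₀ + T) < G t₀ := lt_of_mul_lt_mul_left (by linarith) hk.le
    linarith
  · have h1 := Real.exp_lt_exp.1 (lt_of_mul_lt_mul_left (a := -V (γ t₀))
      (b := Real.exp (-(k * G (t₀ + T)))) (c := Real.exp (-(k * G t₀))) (by linarith)
      (by linarith : (0 : ℝ) ≤ -V (γ t₀)))
    have h2 : G t₀ < G (t₀ + T) := lt_of_mul_lt_mul_left (by linarith) hk.le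
    linarith

theorem not_isPeriodicOrbit_or_isPolycycle (hU : IsOpen U) (hX : ContDiffOn ℝ 1 X U)
    (hV : ContDiffOn ℝ 1 V U) (hk : 0 < k) (hM : ∀ z ∈ U, 0 ≤ dulacM V k X z)
    (hinv : ∀ γ : ℝ → Plane, (∀ t, HasDerivAt γ (X (γ t)) t) → (∀ t, X (γ t) ≠ 0) →
      (∀ t, γ t ∈ U) → ∃ t, dulacM V k X (γ t) ≠ 0)
    (hsc : ∀ S, IsComponentOf S (U \ {z | V z = 0}) → IsSimplyConnected S) {Γ : Set Plane}
    (hΓU : Γ ⊆ U) : ¬ (IsPeriodicOrbit X Γ ∨ IsPolycycle X Γ) := by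
  intro hΓ
  obtain ⟨γ, hγ, hreg, hmem⟩ := exists_regular_solution hΓ
  have hγU : ∀ t, γ t ∈ U := fun t => hΓU (hmem t)
  obtain ⟨s, t, hMt, htA, hst, hs⟩ :=
    exists_pair_of_solution hU hX hV hγ hreg hγU (hinv γ hγ hreg hγU)
  exact false_of_isSimplyConnected hU hX hV hk hM hΓU hΓ (hmem s) (hmem t) hs
    (mem_connectedComponentIn htA) hst (hreg s) (hreg t) hMt (hsc _ ⟨_, htA, rfl⟩)

/-- Dulac's argument in the component of `p` would give a contradiction if that component were
simply connected. -/
theorem connectedComponentIn_eq_of_solution (hU : IsOpen U) (hX : ContDiffOn ℝ 1 X U)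
    (hV : ContDiffOn ℝ 1 V U) (hk : 0 < k) (hM : ∀ z ∈ U, 0 ≤ dulacM V k X z)
    {W : Set Plane} (hsc : ∀ S, IsComponentOf S (U \ {z | V z = 0}) → S ≠ W → IsSimplyConnected S)
    {Γ : Set Plane} (hΓU : Γ ⊆ U) (hΓ : IsPeriodicOrbit X Γ ∨ IsPolycycle X Γ) {p q : Plane}
    (hp : p ∈ Γ) (hq : q ∈ Γ) (hXp : X p ≠ 0) (hXq : X q ≠ 0)
    (hMp : dulacM V k X p ≠ 0) (hpA : p ∈ U \ {z | V z = 0}) (hqp : q ≠ p)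
    (hqS : q ∈ connectedComponentIn (U \ {z | V z = 0}) p) :
    connectedComponentIn (U \ {z | V z = 0}) p = W := by
  by_contra hne
  exact false_of_isSimplyConnected hU hX hV hk hM hΓU hΓ hq hp hqS
    (mem_connectedComponentIn hpA) hqp hXq hXp hMp (hsc _ ⟨_, hpA, rfl⟩ hne)

/-- Each of two distinct curves contains a regular orbit disjoint from the other curve, on which `p`
and `q` are chosen. Both pairs are in `W`, so the two loops satisfy a common winding relation. -/
theorem subsingleton_of_isOneConnected (hU : IsOpen U) (hX : ContDiffOn ℝ 1 X U)
    (hV : ContDiffOn ℝ 1 V U) (hk : 0 < k) (hM : ∀ z ∈ U, 0 ≤ dulacM V k X z)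
    (hinv : ∀ γ : ℝ → Plane, (∀ t, HasDerivAt γ (X (γ t)) t) → (∀ t, X (γ t) ≠ 0) →
      (∀ t, γ t ∈ U) → ∃ t, dulacM V k X (γ t) ≠ 0)
    {W : Set Plane} (hW : IsComponentOf W (U \ {z | V z = 0})) (hone : IsOneConnected W)
    (hsc : ∀ S, IsComponentOf S (U \ {z | V z = 0}) → S ≠ W → IsSimplyConnected S) :
    {Γ : Set Plane | Γ ⊆ U ∧ (IsPeriodicOrbit X Γ ∨ IsPolycycle X Γ)}.Subsingleton := by
  rintro Γ₁ ⟨hΓ₁U, hΓ₁⟩ Γ₂ ⟨hΓ₂U, hΓ₂⟩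
  by_contra hne
  have hchoice : ∀ Γ Γ' : Set Plane, Γ ⊆ U → Γ' ⊆ U → (IsPeriodicOrbit X Γ ∨ IsPolycycle X Γ) →
      (IsPeriodicOrbit X Γ' ∨ IsPolycycle X Γ') → Γ ≠ Γ' → ∃ q p, q ∈ Γ ∧ p ∈ Γ ∧ q ∈ W ∧ p ∈ W ∧
        q ≠ p ∧ p ∉ Γ' ∧ X q ≠ 0 ∧ X p ≠ 0 ∧ dulacM V k X p ≠ 0 := by
    intro Γ Γ' hΓU hΓU' hΓ hΓ' hne
    obtain ⟨γ, hγ, hreg, hmem, hdisj⟩ := exists_orbit_disjoint hU hX hΓU hΓU' hΓ hΓ' hne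
    have hγU : ∀ t, γ t ∈ U := fun t => hΓU (hmem t)
    obtain ⟨s, t, hMt, htA, hst, hs⟩ :=
      exists_pair_of_solution hU hX hV hγ hreg hγU (hinv γ hγ hreg hγU)
    have hcomp := connectedComponentIn_eq_of_solution hU hX hV hk hM hsc hΓU hΓ (hmem t) (hmem s)
      (hreg t) (hreg s) hMt htA hst hs
    exact ⟨γ s, γ t, hmem s, hmem t, hcomp ▸ hs, hcomp ▸ mem_connectedComponentIn htA, hst,
      hdisj t, hreg s, hreg t, hMt⟩
  obtain ⟨q₁, p₁, a1, a2, a3, a4, a5, a6, a7, a8, a9⟩ :=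
    hchoice Γ₁ Γ₂ hΓ₁U hΓ₂U hΓ₁ hΓ₂ hne
  obtain ⟨q₂, p₂, b1, b2, b3, b4, b5, b6, b7, b8, b9⟩ :=
    hchoice Γ₂ Γ₁ hΓ₂U hΓ₁U hΓ₂ hΓ₁ (Ne.symm hne)
  obtain ⟨x, -, rfl⟩ := hW
  exact false_of_isOneConnected hU hX hV hk hM (fun i => bif i then Γ₁ else Γ₂)
    (Bool.forall_bool.2 ⟨hΓ₂U, hΓ₁U⟩) (Bool.forall_bool.2 ⟨hΓ₂, hΓ₁⟩)
    (fun i => bif i then q₁ else q₂) (fun i => bif i then p₁ else p₂)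
    (Bool.forall_bool.2 ⟨b1, a1⟩) (Bool.forall_bool.2 ⟨b2, a2⟩) (Bool.forall_bool.2 ⟨b3, a3⟩)
    (Bool.forall_bool.2 ⟨b4, a4⟩) (Bool.forall_bool.2 ⟨b5, a5⟩)
    (Bool.forall_bool.2 ⟨Bool.forall_bool.2 ⟨fun h => absurd rfl h, fun _ => b6⟩,
      Bool.forall_bool.2 ⟨fun _ => a6, fun h => absurd rfl h⟩⟩)
    (Bool.forall_bool.2 ⟨b7, a7⟩) (Bool.forall_bool.2 ⟨b8, a8⟩) (Bool.forall_bool.2 ⟨b9, a9⟩) hone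

/-- Location, hyperbolicity and stability of a periodic orbit. -/
theorem IsPeriodicOrbit.hyperbolic_and_stability (hU : IsOpen U) (hX : ContDiffOn ℝ 1 X U)
    (hV : ContDiffOn ℝ 1 V U) (hk : 0 < k) (hM : ∀ z ∈ U, 0 ≤ dulacM V k X z)
    (hinv : ∀ γ : ℝ → Plane, (∀ t, HasDerivAt γ (X (γ t)) t) → (∀ t, X (γ t) ≠ 0) →
      (∀ t, γ t ∈ U) → ∃ t, dulacM V k X (γ t) ≠ 0)
    {W : Set Plane} (hsc : ∀ S, IsComponentOf S (U \ {z | V z = 0}) → S ≠ W → IsSimplyConnected S)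
    {Γ : Set Plane} (hΓU : Γ ⊆ U) (hΓ : IsPeriodicOrbit X Γ) :
    IsHyperbolicOrbit X Γ ∧ Γ ⊆ W ∧
      ((∀ z ∈ W, -(V z * dulacM V k X z) ≤ 0) ∨ (∀ z ∈ W, 0 ≤ -(V z * dulacM V k X z))) ∧
      ((∀ z ∈ W, -(V z * dulacM V k X z) ≤ 0) → IsAttractor X Γ) ∧
      ((∀ z ∈ W, 0 ≤ -(V z * dulacM V k X z)) → IsRepeller X Γ) := by
  obtain ⟨γ, T, hγ, rfl⟩ := hΓ
  have hsol : ∀ t, HasDerivAt γ (X (γ t)) t := hγ.solution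
  have hγU : ∀ t, γ t ∈ U := fun t => hΓU (mem_range_self t)
  have hγc : Continuous γ := continuous_iff_continuousAt.2 fun t => (hsol t).continuousAt
  obtain ⟨s, t₀, hMt, htA, hst, hs⟩ :=
    exists_pair_of_solution hU hX hV hsol hγ.regular hγU (hinv γ hsol hγ.regular hγU)
  have hcomp := connectedComponentIn_eq_of_solution hU hX hV hk hM hsc hΓU
    (Or.inl ⟨γ, T, hγ, rfl⟩) (mem_range_self t₀) (mem_range_self s) (hγ.regular t₀)
    (hγ.regular s) hMt htA hst hs
  have hV0 : ∀ t, V (γ t) ≠ 0 := by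
    intro t
    have hmem : γ t ∈ γ '' Icc t₀ (t₀ + T) := by
      rw [hγ.periodic.image_Icc hγ.period_pos]
      exact mem_range_self t
    obtain ⟨u, hu, he⟩ := hmem
    rw [← he]
    -- One full period is an arc with the same nonzero value of `V` at both ends.
    have h1 := ne_zero_along_solution hU hX hV hM (σ := fun t => γ (t₀ + t)) (τ := T)
      (fun t _ => (hsol (t₀ + t)).comp_const_add t₀ t) (fun t _ => hγU _)
      (by
        simp only [add_zero, hγ.periodic t₀]
        rcases lt_or_gt_of_ne htA.2 with h | h
        · exact Or.inr ⟨h, h⟩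
        · exact Or.inl ⟨h, h⟩) (t := u - t₀) ⟨by linarith [hu.1], by linarith [hu.2]⟩
    simpa using h1
  have hΓW : range γ ⊆ W := by
    rw [← hcomp]
    refine (isPreconnected_range hγc).subset_connectedComponentIn (mem_range_self t₀) ?_
    rintro _ ⟨t, rfl⟩
    exact ⟨hγU t, hV0 t⟩
  obtain ⟨G, d, hG, hGT, hneg, hpos⟩ := exists_divergence_primitive hU hX hV hk hM hγ hγU hMt
  have hMpos : 0 < dulacM V k X (γ t₀) := lt_of_le_of_ne (hM _ (hγU t₀)) hMt.symm
  have hd : d ≠ 0 := by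
    rcases lt_or_gt_of_ne htA.2 with h | h
    · exact (hpos h).ne'
    · exact (hneg h).ne
  have hWsub : W ⊆ U \ {z | V z = 0} := hcomp ▸ connectedComponentIn_subset _ _
  have hWpre : IsPreconnected W := hcomp ▸ isPreconnected_connectedComponentIn
  refine ⟨isHyperbolicOrbit_of_primitive hU hX hγ hγU hG ?_, hΓW, ?_, fun h => ?_, fun h => ?_⟩
  · have := hGT 0
    rw [zero_add] at this
    rw [this]
    simpa using hd
  · have hsign : ∀ z ∈ W, 0 < V (γ t₀) ∧ 0 < V z ∨ V (γ t₀) < 0 ∧ V z < 0 := fun z hz =>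
      same_sign_of_isPreconnected hWpre (hV.continuousOn.mono (hWsub.trans sdiff_subset))
        (fun z hz => (hWsub hz).2) (hΓW (mem_range_self t₀)) hz
    rcases lt_or_gt_of_ne htA.2 with h | h
    · refine Or.inr fun z hz => ?_
      have h1 : V z < 0 := ((hsign z hz).resolve_left fun h' => lt_asymm h h'.1).2
      have h2 := hM z (hWsub hz).1
      nlinarith
    · refine Or.inl fun z hz => ?_
      have h1 : 0 < V z := ((hsign z hz).resolve_right fun h' => lt_asymm h h'.1).2
      have h2 := hM z (hWsub hz).1
      nlinarith
  · refine isAttractor_of_primitive hU hX hγ hγU hG (hneg ?_) hGT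
    have h1 := h _ (hΓW (mem_range_self t₀))
    refine lt_of_le_of_ne ?_ (Ne.symm htA.2)
    by_contra h2
    nlinarith [mul_pos_of_neg_of_neg (not_le.1 h2) (neg_neg_of_pos hMpos)]
  · refine isRepeller_of_primitive hU hX hγ hγU hG (hpos ?_) hGT
    have h1 := h _ (hΓW (mem_range_self t₀))
    refine lt_of_le_of_ne ?_ htA.2
    by_contra h2
    nlinarith [mul_pos (not_le.1 h2) hMpos]

/-- The Bendixson–Dulac criterion, in the case `0 ≤ M`. -/
theorem bendixson_dulac_of_nonneg (hU : IsOpen U) (hX : ContDiffOn ℝ 1 X U)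
    (hV : ContDiffOn ℝ 1 V U) (hk : 0 < k) (hM : ∀ z ∈ U, 0 ≤ dulacM V k X z)
    (hinv : ¬ ∃ γ : ℝ → Plane, IsSolution X γ ∧ (∀ t, X (γ t) ≠ 0) ∧
      ∀ t, γ t ∈ U ∧ dulacM V k X (γ t) = 0) :
    ((∀ S, IsComponentOf S (U \ {z | V z = 0}) → IsSimplyConnected S) →
      ∀ Γ : Set Plane, Γ ⊆ U → ¬ IsPeriodicOrbit X Γ ∧ ¬ IsPolycycle X Γ) ∧
    (∀ W : Set Plane, IsComponentOf W (U \ {z | V z = 0}) → IsOneConnected W →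
      (∀ S, IsComponentOf S (U \ {z | V z = 0}) → S ≠ W → IsSimplyConnected S) →
      {Γ : Set Plane | Γ ⊆ U ∧ (IsPeriodicOrbit X Γ ∨ IsPolycycle X Γ)}.Subsingleton ∧
      ∀ Γ : Set Plane, Γ ⊆ U → IsLimitCycle X Γ →
        IsHyperbolicOrbit X Γ ∧ Γ ⊆ W ∧
        ((∀ z ∈ W, -(V z * dulacM V k X z) ≤ 0) ∨ (∀ z ∈ W, 0 ≤ -(V z * dulacM V k X z))) ∧
        ((∀ z ∈ W, -(V z * dulacM V k X z) ≤ 0) → IsAttractor X Γ) ∧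
        ((∀ z ∈ W, 0 ≤ -(V z * dulacM V k X z)) → IsRepeller X Γ)) := by
  have hinv' : ∀ γ : ℝ → Plane, (∀ t, HasDerivAt γ (X (γ t)) t) → (∀ t, X (γ t) ≠ 0) →
      (∀ t, γ t ∈ U) → ∃ t, dulacM V k X (γ t) ≠ 0 := by
    intro γ hγ hreg hγU
    by_contra! hcon
    exact hinv ⟨γ, hγ, hreg, fun t => ⟨hγU t, hcon t⟩⟩
  refine ⟨fun hsc Γ hΓU => ?_, fun W hW hone hsc => ⟨?_, fun Γ hΓU hΓ => ?_⟩⟩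
  · exact not_or.1 (not_isPeriodicOrbit_or_isPolycycle hU hX hV hk hM hinv' hsc hΓU)
  · exact subsingleton_of_isOneConnected hU hX hV hk hM hinv' hW hone hsc
  · exact hΓ.1.hyperbolic_and_stability hU hX hV hk hM hinv' hsc hΓU

end Dulac

end PlanarODE
end

theorem mainTheorem4
    (X : PlanarODE.Plane → PlanarODE.Plane) (U : Set PlanarODE.Plane)
    (hU : IsOpen U) (hX : ContDiffOn ℝ 1 X U)
    (p q : MvPolynomial (Fin 2) ℝ)
    (hq : ∀ z ∈ U, MvPolynomial.eval ![z.1, z.2] q ≠ 0)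
    (V : PlanarODE.Plane → ℝ) (hV : V = PlanarODE.ratFun p q)
    (k : ℝ) (hk : 0 < k)
    (M : PlanarODE.Plane → ℝ) (hM : M = PlanarODE.dulacM V k X)
    (hsign : (∀ z ∈ U, 0 ≤ M z) ∨ (∀ z ∈ U, M z ≤ 0))
    (hinv : ¬ ∃ γ : ℝ → PlanarODE.Plane, PlanarODE.IsSolution X γ ∧ (∀ t, X (γ t) ≠ 0) ∧
      ∀ t, γ t ∈ U ∧ M (γ t) = 0) :
    ((∀ S, PlanarODE.IsComponentOf S (U \ {z | V z = 0}) → IsSimplyConnected S) →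
      ∀ Γ : Set PlanarODE.Plane, Γ ⊆ U →
        ¬ PlanarODE.IsPeriodicOrbit X Γ ∧ ¬ PlanarODE.IsPolycycle X Γ) ∧
    (∀ W : Set PlanarODE.Plane, PlanarODE.IsComponentOf W (U \ {z | V z = 0}) →
      PlanarODE.IsOneConnected W →
      (∀ S, PlanarODE.IsComponentOf S (U \ {z | V z = 0}) → S ≠ W → IsSimplyConnected S) →
      {Γ : Set PlanarODE.Plane |
        Γ ⊆ U ∧ (PlanarODE.IsPeriodicOrbit X Γ ∨ PlanarODE.IsPolycycle X Γ)}.Subsingleton ∧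
      ∀ Γ : Set PlanarODE.Plane, Γ ⊆ U → PlanarODE.IsLimitCycle X Γ →
        PlanarODE.IsHyperbolicOrbit X Γ ∧ Γ ⊆ W ∧
        ((∀ z ∈ W, -(V z * M z) ≤ 0) ∨ (∀ z ∈ W, 0 ≤ -(V z * M z))) ∧
        ((∀ z ∈ W, -(V z * M z) ≤ 0) → PlanarODE.IsAttractor X Γ) ∧
        ((∀ z ∈ W, 0 ≤ -(V z * M z)) → PlanarODE.IsRepeller X Γ)) := by
  have hVC : ContDiffOn ℝ 1 V U := by
    rw [hV]
    exact PlanarODE.contDiffOn_ratFun hq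
  subst hM
  rcases hsign with hsign | hsign
  · exact PlanarODE.bendixson_dulac_of_nonneg hU hX hVC hk hsign hinv
  -- Passing from `V` to `-V` changes the sign of `M` and leaves `{V = 0}`, `{M = 0}` and the
  -- product `V M` unchanged.
  · have h := PlanarODE.bendixson_dulac_of_nonneg (V := fun z => -V z) hU hX hVC.neg hk
      (fun z hz => by
        rw [PlanarODE.dulacM_neg]
        exact neg_nonneg.2 (hsign z hz))
      (by simpa only [PlanarODE.dulacM_neg, neg_eq_zero] using hinv)
    simpa only [PlanarODE.dulacM_neg, neg_eq_zero, neg_mul_neg] using h
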